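/- Let $\widehat Q=[-1,1]^2$. For $m\in\mathbb N$ and an open set $\omega\subseteq\mathbb R^2$ let $H^m(\omega)$ be the usual Sobolev space of functions whose weak derivatives up to order $m$ lie in $L^2(\omega)$, with seminorm $|v|_{m,\omega}=\big(\sum_{|\alpha|=m}\|D^\alpha v\|_{L^2(\omega)}^2\big)^{1/2}$; for a closed region, $H^m$ and $|\cdot|_m$ refer to its interior. Let $\mathbb P_p(\widehat Q)$ be the space of polynomials of total degree at most $p$ on $\widehat Q$. There exist a constant $C>0$ and a family of linear projection operators $\widehat\Pi_{p}:H^2(\widehat Q)\to\mathbb P_p(\widehat Q)$, $p=1,2,\dots$ (that is, $\widehat\Pi_p$ maps into $\mathbb P_p(\widehat Q)$ and $\widehat\Pi_p q=q$ for all $q\in\mathbb P_p(\widehat Q)$), such that: (i) for every $p\ge 2$ and every $\widehat u\in H^2(\widehat Q)$, the polynomial $\widehat\Pi_p\widehat u$ takes the same values as (the continuous representative of) $\widehat u$ at the four vertices of $\widehat Q$; (ii) for every closed simple polygon $\widehat K\subseteq\widehat Q$ with barycenter at $\mathbf 0$, all integers $k\ge 1$ and $p\ge 2k$, and every $\widehat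 u\in H^{k+1}(\widehat Q)$, $$|\widehat u-\widehat\Pi_p\widehat u|_{1,\widehat K}\le C\,2^k e^k p^{-k}\,|\widehat u|_{k+1,\widehat Q}.$$ In particular $C$ is independent of $\widehat u$, $k$, $p$ and $\widehat K$. -/

import Mathlib

open MeasureTheory Set
open scoped ContDiff

noncomputable section

/-! ### Weak derivatives and Sobolev spaces on open subsets of the plane -/

/-- The classical partial derivative `∂₁ f`. -/
def partialX (f : ℝ × ℝ → ℝ) (z : ℝ × ℝ) : ℝ := fderiv ℝ f z (1, 0)

/-- The classical partial derivative `∂₂ f`. -/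
def partialY (f : ℝ × ℝ → ℝ) (z : ℝ × ℝ) : ℝ := fderiv ℝ f z (0, 1)

/-- A test function on `U`: smooth, with compact support contained in `U`. -/
def IsTestFunction (U : Set (ℝ × ℝ)) (φ : ℝ × ℝ → ℝ) : Prop :=
  ContDiff ℝ ∞ φ ∧ HasCompactSupport φ ∧ tsupport φ ⊆ U

/-- `v` is a weak derivative `∂₁ᵃ ∂₂ᵇ u` of `u` on the open set `U`. -/
def HasWeakDeriv (a b : ℕ) (U : Set (ℝ × ℝ)) (u v : ℝ × ℝ → ℝ) : Prop :=
  LocallyIntegrableOn u U ∧ LocallyIntegrableOn v U ∧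
    ∀ φ, IsTestFunction U φ →
      ∫ z in U, u z * partialX^[a] (partialY^[b] φ) z = (-1) ^ (a + b) * ∫ z in U, v z * φ z

open Classical in
/-- The weak derivative `∂₁ᵃ ∂₂ᵇ u` on the open set `U` (unique up to a null set when it exists;
`0` when it does not exist). -/
def weakDeriv (a b : ℕ) (U : Set (ℝ × ℝ)) (u : ℝ × ℝ → ℝ) : ℝ × ℝ → ℝ :=
  if h : ∃ v, HasWeakDeriv a b U u v then h.choose else 0

/-- The Sobolev seminorm `|u|_{m,U} = (∑_{a+b=m} ‖∂₁ᵃ ∂₂ᵇ u‖²_{L²(U)})^{1/2}`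
of a function `u` in `H^m(U)`, `U` open. -/
def sobolevSeminorm (m : ℕ) (U : Set (ℝ × ℝ)) (u : ℝ × ℝ → ℝ) : ℝ :=
  √(∑ a ∈ Finset.range (m + 1), ∫ z in U, (weakDeriv a (m - a) U u z) ^ 2)

theorem IsTestFunction.partialX {U : Set (ℝ × ℝ)} {φ : ℝ × ℝ → ℝ} (h : IsTestFunction U φ) :
    IsTestFunction U (partialX φ) := by
  obtain ⟨h1, h2, h3⟩ := h
  refine ⟨?_, ?_, ?_⟩
  · exact (h1.fderiv_right (m := ∞) (by simp)).clm_apply contDiff_const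
  · exact h2.fderiv_apply (𝕜 := ℝ) (1, 0)
  · exact (tsupport_fderiv_apply_subset ℝ (1, 0)).trans h3

theorem IsTestFunction.partialY {U : Set (ℝ × ℝ)} {φ : ℝ × ℝ → ℝ} (h : IsTestFunction U φ) :
    IsTestFunction U (partialY φ) := by
  obtain ⟨h1, h2, h3⟩ := h
  refine ⟨?_, ?_, ?_⟩
  · exact (h1.fderiv_right (m := ∞) (by simp)).clm_apply contDiff_const
  · exact h2.fderiv_apply (𝕜 := ℝ) (0, 1)
  · exact (tsupport_fderiv_apply_subset ℝ (0, 1)).trans h3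

theorem IsTestFunction.iterate {U : Set (ℝ × ℝ)} {φ : ℝ × ℝ → ℝ} (h : IsTestFunction U φ)
    (a b : ℕ) : IsTestFunction U (_root_.partialX^[a] (_root_.partialY^[b] φ)) := by
  have h1 : IsTestFunction U (_root_.partialY^[b] φ) := by
    induction b with
    | zero => exact h
    | succ b ih => rw [Function.iterate_succ_apply']; exact ih.partialY
  induction a with
  | zero => exact h1
  | succ a ih => rw [Function.iterate_succ_apply']; exact ih.partialX

theorem IsTestFunction.integrable_mul {U : Set (ℝ × ℝ)} {φ u : ℝ × ℝ → ℝ}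
    (h : IsTestFunction U φ) (hu : LocallyIntegrableOn u U) :
    IntegrableOn (fun z => u z * φ z) U := by
  obtain ⟨h1, h2, h3⟩ := h
  have hK : IntegrableOn u (tsupport φ) := hu.integrableOn_compact_subset h3 h2.isCompact
  have h4 : IntegrableOn (fun z => u z * φ z) (tsupport φ) :=
    hK.mul_continuousOn h1.continuous.continuousOn h2.isCompact
  refine (integrableOn_iff_integrable_of_support_subset ?_).1 h4 |>.integrableOn
  intro z hz
  exact subset_tsupport φ (fun h0 => hz (by simp [h0]))

theorem HasWeakDeriv.add {a b : ℕ} {U : Set (ℝ × ℝ)} {u₁ v₁ u₂ v₂ : ℝ × ℝ → ℝ}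
    (h₁ : HasWeakDeriv a b U u₁ v₁) (h₂ : HasWeakDeriv a b U u₂ v₂) :
    HasWeakDeriv a b U (u₁ + u₂) (v₁ + v₂) := by
  refine ⟨h₁.1.add h₂.1, h₁.2.1.add h₂.2.1, fun φ hφ => ?_⟩
  have e1 := h₁.2.2 φ hφ
  have e2 := h₂.2.2 φ hφ
  simp only [Pi.add_apply, add_mul]
  rw [integral_add ((hφ.iterate a b).integrable_mul h₁.1) ((hφ.iterate a b).integrable_mul h₂.1),
    integral_add (hφ.integrable_mul h₁.2.1) (hφ.integrable_mul h₂.2.1), e1, e2, mul_add]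

theorem HasWeakDeriv.smul {a b : ℕ} {U : Set (ℝ × ℝ)} {u v : ℝ × ℝ → ℝ} (c : ℝ)
    (h : HasWeakDeriv a b U u v) : HasWeakDeriv a b U (c • u) (c • v) := by
  refine ⟨h.1.smul c, h.2.1.smul c, fun φ hφ => ?_⟩
  simp only [Pi.smul_apply, smul_eq_mul, mul_assoc, integral_const_mul]
  rw [h.2.2 φ hφ]
  ring

theorem HasWeakDeriv.congr {a b : ℕ} {U : Set (ℝ × ℝ)} {u u' v : ℝ × ℝ → ℝ}
    (h : HasWeakDeriv a b U u v) (hu' : LocallyIntegrableOn u' U)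
    (e : u' =ᵐ[volume.restrict U] u) : HasWeakDeriv a b U u' v := by
  refine ⟨hu', h.2.1, fun φ hφ => ?_⟩
  rw [← h.2.2 φ hφ]
  exact integral_congr_ae (e.mono fun z hz => by simp [hz])

theorem locallyIntegrableOn_of_Lp {U : Set (ℝ × ℝ)} (u : Lp ℝ 2 (volume.restrict U)) :
    LocallyIntegrableOn u U := by
  have h : LocallyIntegrable u (volume.restrict U) := (Lp.memLp u).locallyIntegrable (by norm_num)
  exact locallyIntegrableOn_of_locallyIntegrable_restrict h

/-- The Sobolev space `H^m(U)`, `U` open: the classes of functions in `L²(U)` all of whose weak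
derivatives of order at most `m` exist and lie in `L²(U)`. -/
def Sobolev (m : ℕ) (U : Set (ℝ × ℝ)) : Submodule ℝ (Lp ℝ 2 (volume.restrict U)) where
  carrier := {u | ∀ a b : ℕ, a + b ≤ m →
    ∃ v : ℝ × ℝ → ℝ, HasWeakDeriv a b U u v ∧ MemLp v 2 (volume.restrict U)}
  add_mem' := by
    intro u₁ u₂ h₁ h₂ a b hab
    obtain ⟨v₁, w₁, m₁⟩ := h₁ a b hab
    obtain ⟨v₂, w₂, m₂⟩ := h₂ a b hab
    exact ⟨v₁ + v₂, (w₁.add w₂).congr (locallyIntegrableOn_of_Lp _) (Lp.coeFn_add u₁ u₂),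
      m₁.add m₂⟩
  zero_mem' := by
    intro a b _
    refine ⟨0, HasWeakDeriv.congr (u := 0) ⟨locallyIntegrableOn_zero, locallyIntegrableOn_zero,
      fun φ _ => by simp⟩ (locallyIntegrableOn_of_Lp _) (Lp.coeFn_zero _ _ _), MemLp.zero⟩
  smul_mem' := by
    intro c u h a b hab
    obtain ⟨v, w, m⟩ := h a b hab
    exact ⟨c • v, (w.smul c).congr (locallyIntegrableOn_of_Lp _) (Lp.coeFn_smul c u),
      m.const_smul c⟩

/-! ### The reference square and polynomials on it -/

/-- The closed square `[-1,1]²`. -/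
def closedSquare : Set (ℝ × ℝ) := Icc (-1) 1 ×ˢ Icc (-1) 1

/-- The open square `(-1,1)²`, the interior of `closedSquare`. -/
def openSquare : Set (ℝ × ℝ) := Ioo (-1) 1 ×ˢ Ioo (-1) 1

/-- The four vertices of the square. -/
def squareVertices : Set (ℝ × ℝ) := {(-1, -1), (1, -1), (1, 1), (-1, 1)}

/-- The value at `z` of a polynomial in two variables. -/
def polyValue (q : MvPolynomial (Fin 2) ℝ) (z : ℝ × ℝ) : ℝ := MvPolynomial.eval ![z.1, z.2] q

/-- The space `ℙ_p` of polynomials of total degree at most `p` on the square, as a subspace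
of `H²`. -/
def polySpace (p : ℕ) : Submodule ℝ (Sobolev 2 openSquare) where
  carrier := {u | ∃ q : MvPolynomial (Fin 2) ℝ, q.totalDegree ≤ p ∧
    (u : Lp ℝ 2 (volume.restrict openSquare)) =ᵐ[volume.restrict openSquare] polyValue q}
  add_mem' := by
    rintro u₁ u₂ ⟨q₁, d₁, e₁⟩ ⟨q₂, d₂, e₂⟩
    refine ⟨q₁ + q₂, (MvPolynomial.totalDegree_add _ _).trans (max_le d₁ d₂), ?_⟩
    refine (Lp.coeFn_add _ _).trans ((e₁.add e₂).trans (.of_eq ?_))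
    ext z
    simp [polyValue]
  zero_mem' := ⟨0, by simp, (Lp.coeFn_zero _ _ _).trans (.of_eq (by ext z; simp [polyValue]))⟩
  smul_mem' := by
    rintro c u ⟨q, d, e⟩
    refine ⟨c • q, (MvPolynomial.totalDegree_smul_le _ _).trans d, ?_⟩
    refine (Lp.coeFn_smul _ _).trans ((e.const_smul c).trans (.of_eq ?_))
    ext z
    simp [polyValue]

/-- `w` interpolates `u` at the vertices of the square: both classes have representatives that are
continuous on the closed square (these are unique there), and the representatives agree at the
four vertices. -/
def InterpolatesAtVertices (u w : Sobolev 2 openSquare) : Prop :=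
  ∃ f g : ℝ × ℝ → ℝ, ContinuousOn f closedSquare ∧ ContinuousOn g closedSquare ∧
    (u : Lp ℝ 2 (volume.restrict openSquare)) =ᵐ[volume.restrict openSquare] f ∧
    (w : Lp ℝ 2 (volume.restrict openSquare)) =ᵐ[volume.restrict openSquare] g ∧
    ∀ V ∈ squareVertices, g V = f V

/-! ### Polygons -/

/-- A closed polygonal line is simple if it has at least three vertices and any two distinct edges
meet at most in a common end point of consecutive edges. -/
def IsSimplePolygon {n : ℕ} (P : Polygon (ℝ × ℝ) n) : Prop :=
  3 ≤ n ∧ Function.Injective P.vertices ∧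
    ∀ i j : Fin n, i ≠ j → ∀ z ∈ P.edgeSet ℝ i ∩ P.edgeSet ℝ j,
      (j = finRotate n i ∧ z = P.vertices j) ∨ (i = finRotate n j ∧ z = P.vertices i)

/-- The closed region enclosed by a closed polygonal line: the line itself together with the
points of its complement that lie in a bounded connected component. -/
def polygonRegion {n : ℕ} (P : Polygon (ℝ × ℝ) n) : Set (ℝ × ℝ) :=
  P.boundary ℝ ∪
    {z ∈ (P.boundary ℝ)ᶜ | Bornology.IsBounded (connectedComponentIn (P.boundary ℝ)ᶜ z)}

/-- `K` is a (closed, simple, not necessarily convex) polygon. -/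
def IsPolygonalRegion (K : Set (ℝ × ℝ)) : Prop :=
  ∃ (n : ℕ) (P : Polygon (ℝ × ℝ) n), IsSimplePolygon P ∧ K = polygonRegion P

/-- The barycenter `|K|⁻¹ ∫_K z dz`. -/
def barycenter (K : Set (ℝ × ℝ)) : ℝ × ℝ := ⨍ z in K, z

end

/-! For `p ≥ 2`, the projection sends `u` to a minimiser of `‖∇(u - q)‖` in `L²` of the square over
the polynomials `q` of total degree at most `p` with the vertex values of `u`. Once an interpolant
of `u` is subtracted, this is an orthogonal projection, hence linear
(`exists_constrained_minimal_projection`). The interior of `K` lies in the open square, so it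
suffices to bound the gradient of the error on the whole square. By minimality, any admissible
competitor gives a bound, and the competitor may depend on `k` although the operator does not.

The competitor is a tensor product. On `[-1,1]` let `P_n` be the `L²` projection onto polynomials of
degree less than `n`, and let `π_n f` be `f(-1)` plus the primitive of `P_n f'`; then `(π_n f)' =
P_n f'`, and `π_n` keeps both end point values. The spectral gap of the Legendre operator gives `n
‖f - P_n f‖ ≤ ‖f'‖`. Passing to primitives and iterating gives `n(n-1)⋯(n-k+1) ‖f - P_n f‖ ≤ ‖f⁽ᵏ⁾‖`
(`legendreProj_error`), and a duality argument gains one more `1/n` for `f - π_n f`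
(`sub_endpointProj_le`). Since `n^k ≤ e^k n(n-1)⋯(n-k+1)`, the rates are `e^k n^{-k}`. On the
square, `π_n ⊗ π_n` keeps the vertex values and has total degree at most `2n`; the derivative of its
error splits into two one-dimensional errors (`exists_interpolating_poly`). The choice `n = ⌊p/2⌋`
costs `2^k` and a factor 3.

These estimates are proved for polynomials `u` of arbitrary degree. They extend to Sobolev functions
because polynomials are dense, by contraction, mollification and Landau kernels
(`exists_polyValue_close`). The bound of the maximum of `q` by the `L²` norms of `q`, `∂₁q`, `∂₂q`,
`∂₁∂₂q` (`polyValue_sq_le`) yields the continuous representative and makes vertex values converge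
along the approximation; the small remaining mismatch is repaired by a bilinear polynomial
(`norm_sobolevGrad_le_of_minimal`). -/

theorem isOpen_openSquare : IsOpen openSquare := isOpen_Ioo.prod isOpen_Ioo

/-! ### Uniqueness and restriction of weak derivatives -/

theorem IsTestFunction.setIntegral_mul {U : Set (ℝ × ℝ)} {φ : ℝ × ℝ → ℝ} (h : IsTestFunction U φ)
    (u : ℝ × ℝ → ℝ) : ∫ z in U, u z * φ z = ∫ z, u z * φ z := by
  refine setIntegral_eq_integral_of_forall_compl_eq_zero fun z hz => ?_
  rw [image_eq_zero_of_notMem_tsupport (fun hz' => hz (h.2.2 hz')), mul_zero]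

/-- This is the fundamental lemma of the calculus of variations. It makes the arbitrary choice in
`weakDeriv` harmless. -/
theorem HasWeakDeriv.ae_unique {a b : ℕ} {U : Set (ℝ × ℝ)} (hU : IsOpen U)
    {u v₁ v₂ : ℝ × ℝ → ℝ} (h₁ : HasWeakDeriv a b U u v₁) (h₂ : HasWeakDeriv a b U u v₂) :
    v₁ =ᵐ[volume.restrict U] v₂ := by
  have key : ∀ᵐ z, z ∈ U → (v₁ - v₂) z = 0 := by
    refine hU.ae_eq_zero_of_integral_contDiff_smul_eq_zero (h₁.2.1.sub h₂.2.1)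
      fun φ hφ hc hs => ?_
    have ht : IsTestFunction U φ := ⟨hφ, hc, hs⟩
    have e := (h₁.2.2 φ ht).symm.trans (h₂.2.2 φ ht)
    have e' : ∫ z in U, v₁ z * φ z = ∫ z in U, v₂ z * φ z :=
      mul_left_cancel₀ (pow_ne_zero _ (by norm_num)) e
    have : ∫ z in U, (v₁ - v₂) z * φ z = 0 := by
      simp only [Pi.sub_apply, sub_mul]
      rw [integral_sub (ht.integrable_mul h₁.2.1) (ht.integrable_mul h₂.2.1), e', sub_self]
    rw [ht.setIntegral_mul] at this
    simpa only [smul_eq_mul, mul_comm] using this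
  filter_upwards [(ae_restrict_iff' hU.measurableSet).2 key] with z hz
  exact sub_eq_zero.1 hz

/-- A test function on `V` is one on `U`, and both integrals equal integrals over the plane. -/
theorem HasWeakDeriv.mono {a b : ℕ} {U V : Set (ℝ × ℝ)} (hVU : V ⊆ U)
    {u v : ℝ × ℝ → ℝ} (h : HasWeakDeriv a b U u v) : HasWeakDeriv a b V u v := by
  refine ⟨h.1.mono_set hVU, h.2.1.mono_set hVU, fun φ hφ => ?_⟩
  have hφU : IsTestFunction U φ := ⟨hφ.1, hφ.2.1, hφ.2.2.trans hVU⟩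
  have := h.2.2 φ hφU
  rwa [hφU.setIntegral_mul, (hφU.iterate a b).setIntegral_mul, ← hφ.setIntegral_mul,
    ← (hφ.iterate a b).setIntegral_mul] at this

theorem weakDeriv_ae_eq {a b : ℕ} {U : Set (ℝ × ℝ)} (hU : IsOpen U) {u v : ℝ × ℝ → ℝ}
    (h : HasWeakDeriv a b U u v) : weakDeriv a b U u =ᵐ[volume.restrict U] v := by
  have h' : ∃ v, HasWeakDeriv a b U u v := ⟨v, h⟩
  have : weakDeriv a b U u = h'.choose := by simp [weakDeriv, h']
  rw [this]
  exact h'.choose_spec.ae_unique hU h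

/-! ### Polynomials -/

open MvPolynomial in
theorem polyValue_hasFDerivAt (q : MvPolynomial (Fin 2) ℝ) (z : ℝ × ℝ) :
    HasFDerivAt (polyValue q)
      (polyValue (pderiv 0 q) z • ContinuousLinearMap.fst ℝ ℝ ℝ +
        polyValue (pderiv 1 q) z • ContinuousLinearMap.snd ℝ ℝ ℝ) z := by
  induction q using MvPolynomial.induction_on with
  | C a =>
    have : polyValue (C a) = fun _ => a := by ext z; simp [polyValue]
    rw [this]
    simpa [polyValue] using hasFDerivAt_const (𝕜 := ℝ) a z
  | add p q hp hq =>
    have : polyValue (p + q) = polyValue p + polyValue q := by ext z; simp [polyValue]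
    rw [this]
    convert! hp.add hq using 1
    ext <;> simp [polyValue]
  | mul_X p i hp =>
    have hX : HasFDerivAt (polyValue (X i : MvPolynomial (Fin 2) ℝ))
        (polyValue (pderiv 0 (X i)) z • ContinuousLinearMap.fst ℝ ℝ ℝ +
        polyValue (pderiv 1 (X i)) z • ContinuousLinearMap.snd ℝ ℝ ℝ) z := by
      fin_cases i
      · have : polyValue (X 0 : MvPolynomial (Fin 2) ℝ) = Prod.fst := by ext z; simp [polyValue]
        simp only [Fin.zero_eta, this]
        convert! (ContinuousLinearMap.fst ℝ ℝ ℝ).hasFDerivAt using 1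
        simp [polyValue, pderiv_X]
      · have : polyValue (X 1 : MvPolynomial (Fin 2) ℝ) = Prod.snd := by ext z; simp [polyValue]
        simp only [Fin.mk_one, this]
        convert! (ContinuousLinearMap.snd ℝ ℝ ℝ).hasFDerivAt using 1
        simp [polyValue, pderiv_X]
    have : polyValue (p * X i) = polyValue p * polyValue (X i) := by ext z; simp [polyValue]
    rw [this]
    convert! hp.mul hX using 1
    ext <;> simp [polyValue]

theorem partialX_polyValue (q : MvPolynomial (Fin 2) ℝ) :
    partialX (polyValue q) = polyValue (MvPolynomial.pderiv 0 q) := by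
  ext z; simp [partialX, (polyValue_hasFDerivAt q z).fderiv]

theorem partialY_polyValue (q : MvPolynomial (Fin 2) ℝ) :
    partialY (polyValue q) = polyValue (MvPolynomial.pderiv 1 q) := by
  ext z; simp [partialY, (polyValue_hasFDerivAt q z).fderiv]

theorem differentiable_polyValue (q : MvPolynomial (Fin 2) ℝ) : Differentiable ℝ (polyValue q) :=
  fun z => (polyValue_hasFDerivAt q z).differentiableAt

theorem continuous_polyValue (q : MvPolynomial (Fin 2) ℝ) : Continuous (polyValue q) :=
  (differentiable_polyValue q).continuous

/-- The partial derivative `∂₁ᵃ ∂₂ᵇ` of a polynomial. -/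
noncomputable def polyDeriv (a b : ℕ) (q : MvPolynomial (Fin 2) ℝ) : MvPolynomial (Fin 2) ℝ :=
  (MvPolynomial.pderiv 0)^[a] ((MvPolynomial.pderiv 1)^[b] q)

theorem partial_iterate_polyValue (a b : ℕ) (q : MvPolynomial (Fin 2) ℝ) :
    partialX^[a] (partialY^[b] (polyValue q)) = polyValue (polyDeriv a b q) := by
  have hY : Function.Semiconj polyValue (MvPolynomial.pderiv (R := ℝ) (1 : Fin 2)) partialY :=
    fun q => (partialY_polyValue q).symm
  have hX : Function.Semiconj polyValue (MvPolynomial.pderiv (R := ℝ) (0 : Fin 2)) partialX :=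
    fun q => (partialX_polyValue q).symm
  rw [polyDeriv, ← (hY.iterate_right b) q, ← (hX.iterate_right a)]

theorem pderiv_commute (q : MvPolynomial (Fin 2) ℝ) :
    MvPolynomial.pderiv 0 (MvPolynomial.pderiv 1 q) =
      MvPolynomial.pderiv 1 (MvPolynomial.pderiv 0 q) := by
  have : ⁅MvPolynomial.pderiv (R := ℝ) (0 : Fin 2), MvPolynomial.pderiv (R := ℝ) (1 : Fin 2)⁆ = 0 := by
    refine MvPolynomial.derivation_ext fun i => ?_
    fin_cases i <;> simp [Derivation.commutator_apply, MvPolynomial.pderiv_X]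
  have h := congrArg (fun D => D q) this
  simpa [Derivation.commutator_apply, sub_eq_zero] using h

theorem integral_poly_mul_fderiv (q : MvPolynomial (Fin 2) ℝ) {φ : ℝ × ℝ → ℝ}
    (hφ : ContDiff ℝ ∞ φ) (hc : HasCompactSupport φ) (v : ℝ × ℝ) :
    ∫ z, polyValue q z * fderiv ℝ φ z v = - ∫ z, fderiv ℝ (polyValue q) z v * φ z := by
  have hd : Continuous fun z => fderiv ℝ φ z v :=
    (hφ.continuous_fderiv (by simp)).clm_apply continuous_const
  have hq : Continuous fun z => fderiv ℝ (polyValue q) z v := by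
    have : (fun z => fderiv ℝ (polyValue q) z v) = fun z =>
        polyValue (MvPolynomial.pderiv 0 q) z * v.1 +
          polyValue (MvPolynomial.pderiv 1 q) z * v.2 := by
      ext z; simp [(polyValue_hasFDerivAt q z).fderiv]
    rw [this]
    have h0 := continuous_polyValue (MvPolynomial.pderiv 0 q)
    have h1 := continuous_polyValue (MvPolynomial.pderiv 1 q)
    fun_prop
  refine integral_mul_fderiv_eq_neg_fderiv_mul_of_integrable ?_ ?_ ?_
    (fun z _ => differentiable_polyValue q z) (fun z _ => hφ.differentiable (by simp) z)
  · exact (hq.mul hφ.continuous).integrable_of_hasCompactSupport hc.mul_left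
  · exact ((continuous_polyValue q).mul hd).integrable_of_hasCompactSupport
      (hc.fderiv_apply (𝕜 := ℝ) v).mul_left
  · exact ((continuous_polyValue q).mul hφ.continuous).integrable_of_hasCompactSupport hc.mul_left

/-- Integration by parts moves the outermost derivative of the test function onto `q`, where it acts
before all others. The induction in `polyValue_hasWeakDeriv` therefore needs the new derivative
innermost, which rests on `pderiv_commute`. -/
theorem polyDeriv_succ_left (a b : ℕ) (q : MvPolynomial (Fin 2) ℝ) :
    polyDeriv (a + 1) b q = polyDeriv a b (MvPolynomial.pderiv 0 q) := by
  have hc : Function.Commute (MvPolynomial.pderiv (R := ℝ) (0 : Fin 2)) (MvPolynomial.pderiv 1) :=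
    pderiv_commute
  rw [polyDeriv, Function.iterate_succ_apply, (hc.iterate_right b) q, polyDeriv]

theorem polyDeriv_succ_right (a b : ℕ) (q : MvPolynomial (Fin 2) ℝ) :
    polyDeriv a (b + 1) q = polyDeriv a b (MvPolynomial.pderiv 1 q) := by
  rw [polyDeriv, Function.iterate_succ_apply, polyDeriv]

theorem polyValue_hasWeakDeriv (a b : ℕ) {U : Set (ℝ × ℝ)}
    (q : MvPolynomial (Fin 2) ℝ) :
    HasWeakDeriv a b U (polyValue q) (polyValue (polyDeriv a b q)) := by
  refine ⟨(continuous_polyValue _).locallyIntegrable.locallyIntegrableOn _,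
    (continuous_polyValue _).locallyIntegrable.locallyIntegrableOn _, fun φ hφ => ?_⟩
  rw [hφ.setIntegral_mul, (hφ.iterate a b).setIntegral_mul]
  induction a generalizing q with
  | zero =>
    induction b generalizing q with
    | zero => simp [polyDeriv]
    | succ b ih =>
      have ht := hφ.iterate 0 b
      have := integral_poly_mul_fderiv q ht.1 ht.2.1 (0, 1)
      rw [polyDeriv_succ_right, Function.iterate_succ_apply', Function.iterate_zero, id]
      change ∫ z, polyValue q z * fderiv ℝ (partialY^[b] φ) z (0, 1) = _
      refine this.trans ?_
      change -∫ z, partialY (polyValue q) z * _ = _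
      rw [partialY_polyValue, ih]
      ring
  | succ a ih =>
      have ht := hφ.iterate a b
      have := integral_poly_mul_fderiv q ht.1 ht.2.1 (1, 0)
      rw [polyDeriv_succ_left, Function.iterate_succ_apply']
      refine this.trans ?_
      change -∫ z, partialX (polyValue q) z * _ = _
      rw [partialX_polyValue, ih]
      ring

/-! ### Polynomial approximation on the interval `[-1,1]` -/

section Interval

open Polynomial

/-- The `L²(-1,1)` inner product of polynomials. -/
noncomputable def polyInner : LinearMap.BilinForm ℝ ℝ[X] :=
  LinearMap.mk₂ ℝ (fun f g => ∫ x in (-1 : ℝ)..1, f.eval x * g.eval x)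
    (fun f f' g => by
      simp only [eval_add, add_mul]
      exact intervalIntegral.integral_add
        ((f.continuous.mul g.continuous).intervalIntegrable _ _)
        ((f'.continuous.mul g.continuous).intervalIntegrable _ _))
    (fun c f g => by simp [mul_assoc])
    (fun f g g' => by
      simp only [eval_add, mul_add]
      exact intervalIntegral.integral_add
        ((f.continuous.mul g.continuous).intervalIntegrable _ _)
        ((f.continuous.mul g'.continuous).intervalIntegrable _ _))
    (fun c f g => by simp [mul_left_comm])

theorem polyInner_apply (f g : ℝ[X]) :
    polyInner f g = ∫ x in (-1 : ℝ)..1, f.eval x * g.eval x := rfl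

theorem polyInner_comm (f g : ℝ[X]) : polyInner f g = polyInner g f := by
  simp only [polyInner_apply, mul_comm]

theorem polyInner_mul_left (f g h : ℝ[X]) : polyInner (f * g) h = polyInner f (g * h) := by
  simp only [polyInner_apply, eval_mul, mul_assoc]

theorem polyInner_self_nonneg (f : ℝ[X]) : 0 ≤ polyInner f f :=
  intervalIntegral.integral_nonneg (by norm_num) fun x _ => mul_self_nonneg _

theorem polyInner_self_eq_zero {f : ℝ[X]} (h : polyInner f f = 0) : f = 0 := by
  have h1 : ∀ x ∈ Icc (-1 : ℝ) 1, f.eval x * f.eval x = 0 := by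
    by_contra! hne
    obtain ⟨c, hc, hne⟩ := hne
    have := intervalIntegral.integral_pos (a := (-1 : ℝ)) (b := 1) (by norm_num)
      (f.continuous.mul f.continuous).continuousOn (fun x _ => mul_self_nonneg _)
      ⟨c, hc, lt_of_le_of_ne (mul_self_nonneg _) hne.symm⟩
    exact this.ne' h
  refine Polynomial.eq_zero_of_infinite_isRoot f ((Set.Icc_infinite (by norm_num : (-1 : ℝ) < 1)).mono
    fun x hx => ?_)
  simpa using h1 x hx

theorem polyInner_isSymm : LinearMap.IsSymm polyInner := ⟨fun f g => by simpa using polyInner_comm f g⟩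

theorem polyInner_sq_le (f g : ℝ[X]) :
    polyInner f g ^ 2 ≤ polyInner f f * polyInner g g :=
  LinearMap.BilinForm.apply_sq_le_of_symm polyInner polyInner_self_nonneg polyInner_isSymm f g

theorem polyInner_derivative_left (f g : ℝ[X]) :
    polyInner (derivative f) g =
      f.eval 1 * g.eval 1 - f.eval (-1) * g.eval (-1) - polyInner f (derivative g) := by
  have := intervalIntegral.integral_mul_deriv_eq_deriv_mul (a := (-1 : ℝ)) (b := 1)
    (u := fun x => f.eval x) (v := fun x => g.eval x)
    (u' := fun x => (derivative f).eval x) (v' := fun x => (derivative g).eval x)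
    (fun x _ => f.hasDerivAt x) (fun x _ => g.hasDerivAt x)
    ((derivative f).continuous.intervalIntegrable _ _)
    ((derivative g).continuous.intervalIntegrable _ _)
  simp only [polyInner_apply] at *
  linarith

instance (n : ℕ) : FiniteDimensional ℝ (degreeLT ℝ n) :=
  (degreeLTEquiv ℝ n).symm.finiteDimensional

/-- Definiteness on a finite-dimensional space is enough to define the projection through the dual,
so the polynomials need not be completed to a Hilbert space. -/
theorem polyInner_restrict_nondegenerate (n : ℕ) :
    (polyInner.restrict (degreeLT ℝ n)).Nondegenerate :=
  ⟨fun f hf => Subtype.ext (polyInner_self_eq_zero (hf f)),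
    fun f hf => Subtype.ext (polyInner_self_eq_zero (hf f))⟩

/-- The `L²(-1,1)`-orthogonal projection onto the polynomials of degree less than `n`. -/
noncomputable def legendreProj (n : ℕ) : ℝ[X] →ₗ[ℝ] ℝ[X] :=
  (degreeLT ℝ n).subtype ∘ₗ
    ((polyInner.restrict (degreeLT ℝ n)).toDual
      (polyInner_restrict_nondegenerate n)).symm.toLinearMap ∘ₗ
    (degreeLT ℝ n).subtype.dualMap ∘ₗ polyInner

theorem legendreProj_mem (n : ℕ) (f : ℝ[X]) : legendreProj n f ∈ degreeLT ℝ n :=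
  Submodule.coe_mem _

theorem polyInner_sub_legendreProj (n : ℕ) (f : ℝ[X]) {g : ℝ[X]} (hg : g ∈ degreeLT ℝ n) :
    polyInner (f - legendreProj n f) g = 0 := by
  have h := LinearMap.BilinForm.apply_toDual_symm_apply
    (hB := polyInner_restrict_nondegenerate n)
    ((degreeLT ℝ n).subtype.dualMap (polyInner f)) ⟨g, hg⟩
  rw [map_sub, LinearMap.sub_apply, sub_eq_zero]
  exact h.symm

theorem eq_zero_of_mem_degreeLT_of_orthogonal {n : ℕ} {f : ℝ[X]} (hf : f ∈ degreeLT ℝ n)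
    (h : ∀ g ∈ degreeLT ℝ n, polyInner f g = 0) : f = 0 :=
  polyInner_self_eq_zero (h f hf)

theorem legendreProj_of_mem {n : ℕ} {f : ℝ[X]} (hf : f ∈ degreeLT ℝ n) : legendreProj n f = f :=
  (sub_eq_zero.1 (eq_zero_of_mem_degreeLT_of_orthogonal
    ((degreeLT ℝ n).sub_mem hf (legendreProj_mem n f))
    fun _ hg => polyInner_sub_legendreProj n f hg)).symm

/-- The projection is a contraction. -/
theorem polyInner_legendreProj_le (n : ℕ) (f : ℝ[X]) :
    polyInner (legendreProj n f) (legendreProj n f) ≤ polyInner f f := by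
  have h := polyInner_sub_legendreProj n f (legendreProj_mem n f)
  have h2 := polyInner_self_nonneg (f - legendreProj n f)
  have h3 := polyInner_comm (legendreProj n f) f
  simp only [map_sub, LinearMap.sub_apply] at h h2
  linarith

/-- The projection fixes `g`, so `f` and `f - g` have the same error, and the complementary
projection is a contraction. -/
theorem polyInner_sub_legendreProj_self_le (n : ℕ) (f : ℝ[X]) {g : ℝ[X]} (hg : g ∈ degreeLT ℝ n) :
    polyInner (f - legendreProj n f) (f - legendreProj n f) ≤ polyInner (f - g) (f - g) := by
  have e : f - legendreProj n f = (f - g) - legendreProj n (f - g) := by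
    rw [map_sub, legendreProj_of_mem hg]; abel
  have h := polyInner_sub_legendreProj n (f - g) (legendreProj_mem n (f - g))
  have h2 := polyInner_self_nonneg (legendreProj n (f - g))
  have h3 := polyInner_comm (legendreProj n (f - g)) (f - g)
  rw [e]
  generalize f - g = w at *
  simp only [map_sub, LinearMap.sub_apply] at *
  linarith

/-- The Legendre differential operator `-((1 - x²) f')'`. -/
noncomputable def legendreOp : ℝ[X] →ₗ[ℝ] ℝ[X] :=
  -(derivative ∘ₗ LinearMap.mulLeft ℝ (1 - X ^ 2) ∘ₗ derivative)

theorem legendreOp_apply (f : ℝ[X]) :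
    legendreOp f = -derivative ((1 - X ^ 2) * derivative f) := rfl

/-- The weight `1 - x²` vanishes at both end points, so integration by parts leaves no boundary
term. -/
theorem polyInner_legendreOp (f g : ℝ[X]) :
    polyInner (legendreOp f) g = polyInner ((1 - X ^ 2) * derivative f) (derivative g) := by
  rw [legendreOp_apply, map_neg, LinearMap.neg_apply, polyInner_derivative_left]
  simp

theorem polyInner_legendreOp_comm (f g : ℝ[X]) :
    polyInner (legendreOp f) g = polyInner f (legendreOp g) := by
  rw [polyInner_legendreOp, polyInner_comm f, polyInner_legendreOp, polyInner_comm,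
    mul_comm (1 - X ^ 2) (derivative g), polyInner_mul_left]

theorem legendreOp_X_pow_sub_mem (m : ℕ) :
    legendreOp (X ^ m) - ((m : ℝ) * (m + 1)) • X ^ m ∈ degreeLT ℝ m := by
  rcases m with _ | m
  · simp [legendreOp_apply]
  -- In degree 1 the truncated exponent `m - 1` is harmless, since its coefficient vanishes.
  have : legendreOp (X ^ (m + 1)) - (((m + 1 : ℕ) : ℝ) * ((m + 1 : ℕ) + 1)) • X ^ (m + 1) =
      (-((m : ℝ) * (m + 1))) • X ^ (m - 1) := by
    rw [legendreOp_apply]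
    rcases m with _ | m
    · simp [smul_eq_C_mul]
    · simp [smul_eq_C_mul]; ring
  rw [this]
  refine Submodule.smul_mem _ _ ?_
  rw [mem_degreeLT, degree_X_pow]
  exact_mod_cast (by omega)

theorem degreeLT_succ_decomp {n : ℕ} {f : ℝ[X]} (hf : f ∈ degreeLT ℝ (n + 1)) :
    ∃ a : ℝ, f - a • X ^ n ∈ degreeLT ℝ n := by
  refine ⟨f.coeff n, ?_⟩
  rw [mem_degreeLT, degree_lt_iff_coeff_zero] at *
  intro m hm
  rcases hm.eq_or_lt with rfl | hm
  · simp
  · simp [hf m hm, coeff_X_pow, hm.ne']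

theorem degreeLT_le_succ (n : ℕ) : degreeLT ℝ n ≤ degreeLT ℝ (n + 1) :=
  degreeLT_mono (Nat.le_succ n)

theorem legendreOp_mem {m : ℕ} {f : ℝ[X]} (hf : f ∈ degreeLT ℝ m) :
    legendreOp f ∈ degreeLT ℝ m := by
  induction m generalizing f with
  | zero =>
    have : f = 0 := by simpa [mem_degreeLT] using hf
    simp [this]
  | succ m ih =>
    obtain ⟨a, ha⟩ := degreeLT_succ_decomp hf
    have h1 := degreeLT_le_succ m (ih ha)
    have h2 := degreeLT_le_succ m (legendreOp_X_pow_sub_mem m)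
    have h3 : (X ^ m : ℝ[X]) ∈ degreeLT ℝ (m + 1) := by
      rw [mem_degreeLT, degree_X_pow]; exact_mod_cast Nat.lt_succ_self m
    have : legendreOp f = legendreOp (f - a • X ^ m) +
        a • ((legendreOp (X ^ m) - ((m : ℝ) * (m + 1)) • X ^ m) +
          ((m : ℝ) * (m + 1)) • X ^ m) := by
      simp
    rw [this]
    exact Submodule.add_mem _ h1 (Submodule.smul_mem _ _ (Submodule.add_mem _ h2
      (Submodule.smul_mem _ _ h3)))

/-- The operator is triangular in the monomials with diagonal entries `m(m+1)`, so the difference of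
the two sides has degree less than `m`. It is also orthogonal to that space by symmetry, hence zero.
-/
theorem legendreOp_eq_smul {m : ℕ} {s : ℝ[X]} (hs : s ∈ degreeLT ℝ (m + 1))
    (h : ∀ g ∈ degreeLT ℝ m, polyInner s g = 0) :
    legendreOp s = ((m : ℝ) * (m + 1)) • s := by
  refine sub_eq_zero.1 (eq_zero_of_mem_degreeLT_of_orthogonal (n := m) ?_ fun g hg => ?_)
  · obtain ⟨a, ha⟩ := degreeLT_succ_decomp hs
    have : legendreOp s - ((m : ℝ) * (m + 1)) • s =
        legendreOp (s - a • X ^ m) + a • (legendreOp (X ^ m) - ((m : ℝ) * (m + 1)) • X ^ m)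
          - ((m : ℝ) * (m + 1)) • (s - a • X ^ m) := by
      rw [map_sub, map_smul, smul_sub, smul_sub, smul_comm a ((m : ℝ) * (m + 1))]; abel
    rw [this]
    exact Submodule.sub_mem _ (Submodule.add_mem _ (legendreOp_mem ha)
      (Submodule.smul_mem _ _ (legendreOp_X_pow_sub_mem m))) (Submodule.smul_mem _ _ ha)
  · rw [map_sub, LinearMap.sub_apply, polyInner_legendreOp_comm, h _ (legendreOp_mem hg),
      map_smul, LinearMap.smul_apply, h g hg, smul_zero, sub_zero]

/-- The spectral gap of the Legendre operator on the polynomials orthogonal to those of degree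
less than `n`. -/
theorem legendre_spectral_gap (n : ℕ) {w : ℝ[X]} (h : ∀ g ∈ degreeLT ℝ n, polyInner w g = 0) :
    (n : ℝ) * (n + 1) * polyInner w w ≤ polyInner (legendreOp w) w := by
  have key : ∀ m : ℕ, ∀ w ∈ degreeLT ℝ (n + m), (∀ g ∈ degreeLT ℝ n, polyInner w g = 0) →
      (n : ℝ) * (n + 1) * polyInner w w ≤ polyInner (legendreOp w) w := by
    intro m
    induction m with
    | zero =>
      intro w hw h
      have : w = 0 := eq_zero_of_mem_degreeLT_of_orthogonal hw h
      simp [this]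
    | succ m ih =>
      intro w hw h
      -- Peel off the top-degree part `s = w - r`: it is an eigenvector with eigenvalue
      -- `(n+m)(n+m+1)`, at least `n(n+1)`, and it is orthogonal to `r` in both quadratic forms.
      set r := legendreProj (n + m) w with hr
      have hrm : r ∈ degreeLT ℝ (n + m) := legendreProj_mem _ _
      obtain ⟨s, hs⟩ : ∃ s, s = w - r := ⟨_, rfl⟩
      have hso : ∀ g ∈ degreeLT ℝ (n + m), polyInner s g = 0 := fun g hg => by
        rw [hs]; exact polyInner_sub_legendreProj _ w hg
      have hsm : s ∈ degreeLT ℝ (n + m + 1) := by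
        rw [hs]; exact Submodule.sub_mem _ hw (degreeLT_le_succ _ hrm)
      have hro : ∀ g ∈ degreeLT ℝ n, polyInner r g = 0 := fun g hg => by
        have h1 := hso g (degreeLT_mono (Nat.le_add_right n m) hg)
        rw [hs, map_sub, LinearMap.sub_apply, h g hg] at h1
        linarith
      have hL := legendreOp_eq_smul hsm hso
      have hw' : w = r + s := by rw [hs]; abel
      have e1 : polyInner s r = 0 := hso r hrm
      have e2 : polyInner r s = 0 := by rw [polyInner_comm, e1]
      have e3 : polyInner (legendreOp r) s = 0 := by
        rw [polyInner_comm, hso _ (legendreOp_mem hrm)]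
      have i1 := ih r hrm hro
      have i2 := polyInner_self_nonneg s
      rw [hw']
      simp only [map_add, LinearMap.add_apply, hL, map_smul, LinearMap.smul_apply, e1, e2, e3,
        smul_eq_mul, mul_zero, add_zero, zero_add]
      push_cast
      have i3 : (n : ℝ) * (n + 1) ≤ (n + m : ℝ) * (n + m + 1) := by
        have : (0 : ℝ) ≤ m := Nat.cast_nonneg m
        have : (0 : ℝ) ≤ n := Nat.cast_nonneg n
        gcongr <;> linarith
      nlinarith [mul_le_mul_of_nonneg_right i3 i2]
  exact key (w.natDegree + 1) w (by
    rw [mem_degreeLT]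
    refine lt_of_le_of_lt degree_le_natDegree ?_
    exact_mod_cast (by omega : w.natDegree < n + (w.natDegree + 1))) h

end Interval

/-! ### Error estimates for the one-dimensional projections -/

section Interval

open Polynomial

theorem polyInner_one_sub_sq_le (f : ℝ[X]) :
    polyInner ((1 - X ^ 2) * f) f ≤ polyInner f f := by
  simp only [polyInner_apply]
  refine intervalIntegral.integral_mono_on (by norm_num)
    ((((1 - X ^ 2) * f).continuous.mul f.continuous).intervalIntegrable _ _)
    ((f.continuous.mul f.continuous).intervalIntegrable _ _) fun x _ => ?_
  simp only [eval_mul, eval_sub, eval_one, eval_pow, eval_X]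
  nlinarith [mul_self_nonneg (x * f.eval x)]

theorem polyInner_one_sub_sq_nonneg (f : ℝ[X]) : 0 ≤ polyInner ((1 - X ^ 2) * f) f := by
  refine intervalIntegral.integral_nonneg (by norm_num) fun x hx => ?_
  simp only [eval_mul, eval_sub, eval_one, eval_pow, eval_X]
  have : 0 ≤ 1 - x ^ 2 := by nlinarith [hx.1, hx.2]
  rw [mul_assoc]
  exact mul_nonneg this (mul_self_nonneg _)

theorem sub_legendreProj_le_derivative (n : ℕ) (f : ℝ[X]) :
    (n : ℝ) ^ 2 * polyInner (f - legendreProj n f) (f - legendreProj n f) ≤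
      polyInner (derivative f) (derivative f) := by
  set r := legendreProj n f with hr
  obtain ⟨w, hw⟩ : ∃ w, w = f - r := ⟨_, rfl⟩
  have hwo : ∀ g ∈ degreeLT ℝ n, polyInner w g = 0 := fun g hg => by
    rw [hw]; exact polyInner_sub_legendreProj n f hg
  have hrn : r ∈ degreeLT ℝ n := legendreProj_mem n f
  have h1 := legendre_spectral_gap n hwo
  have e1 : polyInner (legendreOp r) w = 0 := by rw [polyInner_comm, hwo _ (legendreOp_mem hrn)]
  have e2 : polyInner (legendreOp w) r = 0 := by rw [polyInner_legendreOp_comm, hwo _ (legendreOp_mem hrn)]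
  -- The Legendre operator preserves degrees, so the cross terms between `w` and `r` vanish and the
  -- energy of `f` is the sum of theirs.
  have h2 : polyInner (legendreOp w) w ≤ polyInner (legendreOp f) f := by
    have hf : f = w + r := by rw [hw]; abel
    have h3 := polyInner_one_sub_sq_nonneg (derivative r)
    rw [← polyInner_legendreOp] at h3
    rw [hf]
    simp only [map_add, LinearMap.add_apply, e1, e2]
    linarith
  have h4 := polyInner_one_sub_sq_le (derivative f)
  rw [← polyInner_legendreOp] at h4
  rw [← hw]
  have h5 := polyInner_self_nonneg w
  have h6 : (0 : ℝ) ≤ n := Nat.cast_nonneg n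
  nlinarith [mul_nonneg h6 h5]

/-- The primitive of a polynomial that vanishes at `-1`. -/
noncomputable def polyPrim : ℝ[X] →ₗ[ℝ] ℝ[X] :=
  let F : ℝ[X] →ₗ[ℝ] ℝ[X] :=
    lsum fun i => monomial (i + 1) ∘ₗ LinearMap.lsmul ℝ ℝ ((i : ℝ) + 1)⁻¹
  F - (CAlgHom.toLinearMap ∘ₗ leval (-1)) ∘ₗ F

theorem derivative_polyPrim (f : ℝ[X]) : derivative (polyPrim f) = f := by
  induction f using Polynomial.induction_on' with
  | add p q hp hq => rw [map_add, map_add, hp, hq]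
  | monomial n a =>
    have : ((n : ℝ) + 1) ≠ 0 := by positivity
    simp [polyPrim, lsum_apply, sum_monomial_index, -map_pow]
    field_simp

theorem eval_neg_one_polyPrim (f : ℝ[X]) : (polyPrim f).eval (-1) = 0 := by
  simp [polyPrim, leval]

theorem polyPrim_mem {n : ℕ} {f : ℝ[X]} (hf : f ∈ degreeLT ℝ n) :
    polyPrim f ∈ degreeLT ℝ (n + 1) := by
  have h := derivative_polyPrim f
  rw [mem_degreeLT, degree_lt_iff_coeff_zero] at *
  intro m hm
  obtain ⟨m, rfl⟩ : ∃ k, m = k + 1 := ⟨m - 1, by omega⟩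
  have h1 := hf m (by omega)
  rw [← h, coeff_derivative] at h1
  exact (mul_eq_zero.1 h1).resolve_right (by positivity)

/-- Subtracting from `f` a primitive of the projection of `f'` leaves the error of `f` unchanged and
replaces `f'` by its own error. Each such step lowers `n` by one, which is where the falling
factorial comes from. -/
theorem sub_legendreProj_le_sub_legendreProj_derivative (n : ℕ) (f : ℝ[X]) :
    ((n : ℝ) + 1) ^ 2 * polyInner (f - legendreProj (n + 1) f) (f - legendreProj (n + 1) f) ≤
      polyInner (derivative f - legendreProj n (derivative f))
        (derivative f - legendreProj n (derivative f)) := by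
  set R := polyPrim (legendreProj n (derivative f))
  have hR : R ∈ degreeLT ℝ (n + 1) := polyPrim_mem (legendreProj_mem _ _)
  have h := sub_legendreProj_le_derivative (n + 1) (f - R)
  have e : f - R - legendreProj (n + 1) (f - R) = f - legendreProj (n + 1) f := by
    rw [map_sub, legendreProj_of_mem hR]; abel
  rw [e, derivative_sub, derivative_polyPrim] at h
  exact_mod_cast h

theorem legendreProj_error (n k : ℕ) (hk : k ≤ n) (f : ℝ[X]) :
    (n.descFactorial k : ℝ) ^ 2 * polyInner (f - legendreProj n f) (f - legendreProj n f) ≤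
      polyInner (derivative^[k] f) (derivative^[k] f) := by
  induction k generalizing n f with
  | zero =>
    simpa using polyInner_sub_legendreProj_self_le n f (Submodule.zero_mem _)
  | succ k ih =>
    obtain ⟨n, rfl⟩ : ∃ m, n = m + 1 := ⟨n - 1, by omega⟩
    rw [Nat.succ_descFactorial_succ, Function.iterate_succ_apply]
    refine le_trans ?_ (ih n (by omega) (derivative f))
    push_cast
    rw [mul_pow, mul_comm ((_ : ℝ) ^ 2) ((n.descFactorial k : ℝ) ^ 2), mul_assoc]
    exact mul_le_mul_of_nonneg_left (sub_legendreProj_le_sub_legendreProj_derivative n f)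
      (sq_nonneg _)

/-- The `H¹(-1,1)`-projection onto the polynomials of degree at most `n`
that preserves the values at the end points. -/
noncomputable def endpointProj (n : ℕ) : ℝ[X] →ₗ[ℝ] ℝ[X] :=
  CAlgHom.toLinearMap ∘ₗ leval (-1) + polyPrim ∘ₗ legendreProj n ∘ₗ derivative

theorem derivative_endpointProj (n : ℕ) (f : ℝ[X]) :
    derivative (endpointProj n f) = legendreProj n (derivative f) := by
  simp [endpointProj, derivative_polyPrim]

theorem eval_neg_one_endpointProj (n : ℕ) (f : ℝ[X]) :
    (endpointProj n f).eval (-1) = f.eval (-1) := by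
  simp [endpointProj, eval_neg_one_polyPrim, leval]

theorem eval_one_sub_eval_neg_one (f : ℝ[X]) :
    f.eval 1 - f.eval (-1) = polyInner (derivative f) 1 := by
  rw [polyInner_derivative_left]; simp

/-- The error of the derivative is orthogonal to the constant 1, so the error takes equal values at
both end points. -/
theorem eval_one_endpointProj {n : ℕ} (hn : 1 ≤ n) (f : ℝ[X]) :
    (endpointProj n f).eval 1 = f.eval 1 := by
  have h1 := eval_one_sub_eval_neg_one (f - endpointProj n f)
  have hone : (1 : ℝ[X]) ∈ degreeLT ℝ n := by
    rw [mem_degreeLT, degree_one]; exact_mod_cast hn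
  rw [map_sub, derivative_endpointProj, polyInner_sub_legendreProj n _ hone] at h1
  simp only [eval_sub, eval_neg_one_endpointProj] at h1
  linarith

theorem endpointProj_mem (n : ℕ) (f : ℝ[X]) : endpointProj n f ∈ degreeLT ℝ (n + 1) := by
  refine Submodule.add_mem _ ?_ (polyPrim_mem (legendreProj_mem _ _))
  rw [mem_degreeLT]
  refine lt_of_le_of_lt degree_C_le ?_
  exact_mod_cast Nat.succ_pos n

/-- An Aubin–Nitsche argument: the error `e` vanishes at the end points and its derivative `g` is
orthogonal to degree less than `n`. With `R' = e`, the square of `‖e‖` is therefore `-(R - P_n R,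
g)`, at most `n⁻¹ ‖e‖ ‖g‖`. -/
theorem sub_endpointProj_le {n : ℕ} (hn : 1 ≤ n) (f : ℝ[X]) :
    (n : ℝ) ^ 2 * polyInner (f - endpointProj n f) (f - endpointProj n f) ≤
      polyInner (derivative f - legendreProj n (derivative f))
        (derivative f - legendreProj n (derivative f)) := by
  set g := derivative f - legendreProj n (derivative f) with hg
  obtain ⟨e, he⟩ : ∃ e, e = f - endpointProj n f := ⟨_, rfl⟩
  have he' : derivative e = g := by rw [he, map_sub, derivative_endpointProj]
  rw [← he]
  set R := polyPrim e
  have h1 : polyInner e e = - polyInner (R - legendreProj n R) g := by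
    have h2 := polyInner_derivative_left R e
    have h3 : polyInner (legendreProj n R) g = 0 := by
      rw [polyInner_comm]; exact polyInner_sub_legendreProj n _ (legendreProj_mem n R)
    have e1 : e.eval 1 = 0 := by rw [he, eval_sub, eval_one_endpointProj hn, sub_self]
    have e2 : e.eval (-1) = 0 := by rw [he, eval_sub, eval_neg_one_endpointProj, sub_self]
    rw [derivative_polyPrim, e1, e2, he'] at h2
    rw [LinearMap.map_sub₂, h3, h2]; simp
  have h2 := polyInner_sq_le (R - legendreProj n R) g
  have h3 := sub_legendreProj_le_derivative n R
  rw [derivative_polyPrim] at h3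
  have h4 := polyInner_self_nonneg e
  have h5 := polyInner_self_nonneg g
  -- One factor `‖e‖²` is to be cancelled, so the case `e = 0` is treated apart.
  rcases h4.eq_or_lt with h0 | h0
  · rw [← h0]; simpa using h5
  · have h6 : (n : ℝ) ^ 2 * polyInner e e ^ 2 ≤ polyInner e e * polyInner g g := by
      calc (n : ℝ) ^ 2 * polyInner e e ^ 2 = (n : ℝ) ^ 2 * polyInner (R - legendreProj n R) g ^ 2 := by
            rw [h1]; ring
        _ ≤ (n : ℝ) ^ 2 * (polyInner (R - legendreProj n R) (R - legendreProj n R) *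
              polyInner g g) := by gcongr
        _ = ((n : ℝ) ^ 2 * polyInner (R - legendreProj n R) (R - legendreProj n R)) *
              polyInner g g := by ring
        _ ≤ _ := by gcongr
    refine le_of_mul_le_mul_left ?_ h0
    linarith

theorem endpointProj_error {n k : ℕ} (hn : 1 ≤ n) (hk : k ≤ n) (f : ℝ[X]) :
    ((n : ℝ) * n.descFactorial k) ^ 2 * polyInner (f - endpointProj n f) (f - endpointProj n f) ≤
      polyInner (derivative^[k + 1] f) (derivative^[k + 1] f) := by
  refine le_trans ?_ (legendreProj_error n k hk (derivative f))
  rw [mul_pow, mul_comm ((_ : ℝ) ^ 2) ((n.descFactorial k : ℝ) ^ 2), mul_assoc]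
  exact mul_le_mul_of_nonneg_left (sub_endpointProj_le hn f) (sq_nonneg _)

/-- The one-dimensional Sobolev inequality for polynomials. -/
theorem eval_sq_le (f : ℝ[X]) {x : ℝ} (hx : x ∈ Icc (-1 : ℝ) 1) :
    f.eval x ^ 2 ≤ 2 * (polyInner f f + polyInner (derivative f) (derivative f)) := by
  -- Integrate `(f²)' = 2 f f'`, bounded by `f² + f'²`, from `s` to `x`; averaging over `s` then
  -- removes the value at `s`.
  have key : ∀ s ∈ Icc (-1 : ℝ) 1, f.eval x ^ 2 ≤
      f.eval s * f.eval s + (polyInner f f + polyInner (derivative f) (derivative f)) := by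
    intro s hs
    have hc1 := f.continuous
    have hc2 := (derivative f).continuous
    have hI : ∀ a b : ℝ, IntervalIntegrable
        (fun t => f.eval t * f.eval t + (derivative f).eval t * (derivative f).eval t) volume a b :=
      fun a b => (by fun_prop : Continuous _).intervalIntegrable a b
    have h1 : ∫ t in s..x, (2 * f.eval t * (derivative f).eval t) = f.eval x ^ 2 - f.eval s ^ 2 := by
      refine intervalIntegral.integral_eq_sub_of_hasDerivAt (f := fun t => f.eval t ^ 2)
        (fun t _ => ?_) ((by fun_prop : Continuous _).intervalIntegrable _ _)
      convert! (f.hasDerivAt t).pow 2 using 1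
      simp
    have h2 : |∫ t in s..x, (2 * f.eval t * (derivative f).eval t)| ≤
        polyInner f f + polyInner (derivative f) (derivative f) := by
      have hsum : polyInner f f + polyInner (derivative f) (derivative f) = ∫ t in (-1 : ℝ)..1,
          (f.eval t * f.eval t + (derivative f).eval t * (derivative f).eval t) :=
        (intervalIntegral.integral_add ((hc1.mul hc1).intervalIntegrable _ _)
          ((hc2.mul hc2).intervalIntegrable _ _)).symm
      have hnn : ∀ t, 0 ≤ f.eval t * f.eval t + (derivative f).eval t * (derivative f).eval t :=
        fun t => add_nonneg (mul_self_nonneg _) (mul_self_nonneg _)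
      rw [hsum]
      have h3 : |∫ t in s..x, (2 * f.eval t * (derivative f).eval t)| ≤
          |∫ t in s..x, f.eval t * f.eval t + (derivative f).eval t * (derivative f).eval t| := by
        have hb : ∀ t, ‖2 * f.eval t * (derivative f).eval t‖ ≤
            f.eval t * f.eval t + (derivative f).eval t * (derivative f).eval t := fun t => by
          rw [Real.norm_eq_abs, abs_le]
          constructor <;> nlinarith [sq_nonneg (f.eval t + (derivative f).eval t),
            sq_nonneg (f.eval t - (derivative f).eval t)]
        exact intervalIntegral.norm_integral_le_abs_of_norm_le (.of_forall hb) (hI _ _)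
      refine h3.trans ?_
      refine intervalIntegral.abs_integral_mono_interval ?_ ?_ (hI (-1) 1) |>.trans (le_of_eq ?_)
      · rw [uIoc_of_le (by norm_num : (-1 : ℝ) ≤ 1)]
        exact Ioc_subset_Ioc (le_min hs.1 hx.1) (max_le hs.2 hx.2)
      · exact .of_forall hnn
      · exact abs_of_nonneg (intervalIntegral.integral_nonneg (by norm_num) fun t _ => hnn t)
    have h3 := le_of_abs_le h2
    rw [h1] at h3
    linarith
  have hi : ∫ _ in (-1 : ℝ)..1, f.eval x ^ 2 ≤ ∫ s in (-1 : ℝ)..1, (f.eval s * f.eval s +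
      (polyInner f f + polyInner (derivative f) (derivative f))) :=
    intervalIntegral.integral_mono_on (by norm_num) (by simp)
      (((f.continuous.mul f.continuous).add continuous_const).intervalIntegrable _ _) key
  have hadd : ∫ s in (-1 : ℝ)..1, (f.eval s * f.eval s +
      (polyInner f f + polyInner (derivative f) (derivative f))) = polyInner f f +
      ∫ _ in (-1 : ℝ)..1, (polyInner f f + polyInner (derivative f) (derivative f)) :=
    intervalIntegral.integral_add ((f.continuous.mul f.continuous).intervalIntegrable _ _)
      (by simp)
  rw [hadd, intervalIntegral.integral_const, intervalIntegral.integral_const, smul_eq_mul,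
    smul_eq_mul] at hi
  have h5 := polyInner_self_nonneg f
  have h6 := polyInner_self_nonneg (derivative f)
  linarith

end Interval

/-- Factor by factor, `n(k-i) ≤ k(n-i)` gives `n^k k! ≤ k^k n(n-1)⋯(n-k+1)`; then `k^k ≤ e^k k!` is
one term of the exponential series. -/
theorem pow_le_exp_mul_descFactorial {n k : ℕ} (hk : k ≤ n) :
    (n : ℝ) ^ k ≤ Real.exp 1 ^ k * n.descFactorial k := by
  rcases Nat.eq_zero_or_pos k with rfl | hk0
  · simp
  have h1 : (n : ℝ) ^ k * k.factorial ≤ (k : ℝ) ^ k * n.descFactorial k := by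
    have h2 : n ^ k * k.descFactorial k ≤ k ^ k * n.descFactorial k := by
      rw [Nat.descFactorial_eq_prod_range, Nat.descFactorial_eq_prod_range,
        ← Finset.card_range k, ← Finset.prod_const, ← Finset.prod_const, Finset.card_range,
        ← Finset.prod_mul_distrib, ← Finset.prod_mul_distrib]
      refine Finset.prod_le_prod' fun i hi => ?_
      rw [Nat.mul_sub, Nat.mul_sub, mul_comm n k]
      have := Nat.mul_le_mul_right i hk
      omega
    rw [Nat.descFactorial_self] at h2
    exact_mod_cast h2
  have h3 : (k : ℝ) ^ k ≤ Real.exp 1 ^ k * k.factorial := by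
    have := Real.pow_div_factorial_le_exp (x := (k : ℝ)) (Nat.cast_nonneg k) k
    rw [div_le_iff₀ (by positivity)] at this
    rwa [← Real.exp_nat_mul, mul_one]
  have h4 : (0 : ℝ) < k.factorial := by positivity
  refine le_of_mul_le_mul_right (h1.trans ?_) h4
  calc (k : ℝ) ^ k * n.descFactorial k ≤ (Real.exp 1 ^ k * k.factorial) * n.descFactorial k := by
        gcongr
    _ = _ := by ring

/-! ### Polynomials on the square as tensors -/

section Tensor

open Polynomial TensorProduct

/-- The polynomial in two variables given by a tensor. -/
noncomputable def tensorToMv : ℝ[X] ⊗[ℝ] ℝ[X] →ₗ[ℝ] MvPolynomial (Fin 2) ℝ :=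
  TensorProduct.lift ((LinearMap.mul ℝ (MvPolynomial (Fin 2) ℝ)).compl₁₂
    (aeval (MvPolynomial.X 0)).toLinearMap (aeval (MvPolynomial.X 1)).toLinearMap)

theorem tensorToMv_tmul (f g : ℝ[X]) : tensorToMv (f ⊗ₜ g) =
    aeval (MvPolynomial.X 0 : MvPolynomial (Fin 2) ℝ) f * aeval (MvPolynomial.X 1) g := by
  simp [tensorToMv]

theorem tensorToMv_surjective : Function.Surjective tensorToMv := by
  intro q
  induction q using MvPolynomial.induction_on with
  | C a => exact ⟨C a ⊗ₜ 1, by simp [tensorToMv_tmul, MvPolynomial.algebraMap_eq]⟩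
  | add p q hp hq =>
    obtain ⟨s, rfl⟩ := hp
    obtain ⟨t, rfl⟩ := hq
    exact ⟨s + t, map_add _ _ _⟩
  | mul_X p i hp =>
    obtain ⟨s, rfl⟩ := hp
    fin_cases i
    · refine ⟨LinearMap.rTensor _ (LinearMap.mulLeft ℝ X) s, ?_⟩
      induction s using TensorProduct.induction_on with
      | zero => simp
      | tmul f g => simp [tensorToMv_tmul]; ring
      | add s t hs ht => simp only [map_add, hs, ht, add_mul]
    · refine ⟨LinearMap.lTensor _ (LinearMap.mulLeft ℝ X) s, ?_⟩
      induction s using TensorProduct.induction_on with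
      | zero => simp
      | tmul f g => simp [tensorToMv_tmul]; ring
      | add s t hs ht => simp only [map_add, hs, ht, add_mul]

/-- The restriction of a polynomial in two variables to a horizontal line. -/
noncomputable def sliceX (y : ℝ) : ℝ[X] ⊗[ℝ] ℝ[X] →ₗ[ℝ] ℝ[X] :=
  (TensorProduct.rid ℝ ℝ[X]).toLinearMap ∘ₗ LinearMap.lTensor _ (leval y)

/-- The restriction of a polynomial in two variables to a vertical line. -/
noncomputable def sliceY (x : ℝ) : ℝ[X] ⊗[ℝ] ℝ[X] →ₗ[ℝ] ℝ[X] :=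
  (TensorProduct.lid ℝ ℝ[X]).toLinearMap ∘ₗ LinearMap.rTensor _ (leval x)

theorem polyValue_tmul (f g : ℝ[X]) (z : ℝ × ℝ) :
    polyValue (tensorToMv (f ⊗ₜ g)) z = f.eval z.1 * g.eval z.2 := by
  have h0 (f : ℝ[X]) (i : Fin 2) (v : Fin 2 → ℝ) :
      MvPolynomial.eval v (aeval (MvPolynomial.X i : MvPolynomial (Fin 2) ℝ) f) = f.eval (v i) := by
    have := Polynomial.aeval_algHom_apply (MvPolynomial.aeval (R := ℝ) v)
      (MvPolynomial.X i : MvPolynomial (Fin 2) ℝ) f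
    simp only [MvPolynomial.aeval_X] at this
    rw [← MvPolynomial.coe_aeval_eq_eval, ← Polynomial.coe_aeval_eq_eval]
    exact this.symm
  simp [tensorToMv_tmul, polyValue, h0]

theorem polyValue_add (p q : MvPolynomial (Fin 2) ℝ) :
    polyValue (p + q) = polyValue p + polyValue q := by
  ext z; simp [polyValue]

theorem polyValue_sub (p q : MvPolynomial (Fin 2) ℝ) :
    polyValue (p - q) = polyValue p - polyValue q := by
  ext z; simp [polyValue]

theorem polyValue_smul (c : ℝ) (q : MvPolynomial (Fin 2) ℝ) :
    polyValue (c • q) = c • polyValue q := by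
  ext z; simp [polyValue]

theorem eval_sliceX (t : ℝ[X] ⊗[ℝ] ℝ[X]) (z : ℝ × ℝ) :
    (sliceX z.2 t).eval z.1 = polyValue (tensorToMv t) z := by
  induction t using TensorProduct.induction_on with
  | zero => simp [polyValue]
  | tmul f g => simp [sliceX, polyValue_tmul, leval, mul_comm]
  | add s t hs ht => simp [polyValue_add, hs, ht]

theorem eval_sliceY (t : ℝ[X] ⊗[ℝ] ℝ[X]) (z : ℝ × ℝ) :
    (sliceY z.1 t).eval z.2 = polyValue (tensorToMv t) z := by
  induction t using TensorProduct.induction_on with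
  | zero => simp [polyValue]
  | tmul f g => simp [sliceY, polyValue_tmul, leval]
  | add s t hs ht => simp [polyValue_add, hs, ht]

theorem sliceX_rTensor (A : ℝ[X] →ₗ[ℝ] ℝ[X]) (y : ℝ) (t : ℝ[X] ⊗[ℝ] ℝ[X]) :
    sliceX y (A.rTensor _ t) = A (sliceX y t) := by
  induction t using TensorProduct.induction_on with
  | zero => simp
  | tmul f g => simp [sliceX]
  | add s t hs ht => simp only [map_add, hs, ht]

theorem sliceY_lTensor (A : ℝ[X] →ₗ[ℝ] ℝ[X]) (x : ℝ) (t : ℝ[X] ⊗[ℝ] ℝ[X]) :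
    sliceY x (A.lTensor _ t) = A (sliceY x t) := by
  induction t using TensorProduct.induction_on with
  | zero => simp
  | tmul f g => simp [sliceY]
  | add s t hs ht => simp only [map_add, hs, ht]

theorem pderiv_zero_tensorToMv (t : ℝ[X] ⊗[ℝ] ℝ[X]) :
    MvPolynomial.pderiv 0 (tensorToMv t) = tensorToMv (derivative.rTensor _ t) := by
  induction t using TensorProduct.induction_on with
  | zero => simp
  | tmul f g => simp [tensorToMv_tmul, mul_comm]
  | add s t hs ht => simp only [map_add, hs, ht]

theorem pderiv_one_tensorToMv (t : ℝ[X] ⊗[ℝ] ℝ[X]) :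
    MvPolynomial.pderiv 1 (tensorToMv t) = tensorToMv (derivative.lTensor _ t) := by
  induction t using TensorProduct.induction_on with
  | zero => simp
  | tmul f g => simp [tensorToMv_tmul, mul_comm]
  | add s t hs ht => simp only [map_add, hs, ht]

theorem polyDeriv_tensorToMv (a b : ℕ) (t : ℝ[X] ⊗[ℝ] ℝ[X]) :
    polyDeriv a b (tensorToMv t) =
      tensorToMv ((derivative ^ a).rTensor _ ((derivative ^ b).lTensor _ t)) := by
  induction a generalizing t with
  | zero =>
    induction b generalizing t with
    | zero => simp [polyDeriv, Module.End.one_eq_id]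
    | succ b ih =>
      rw [polyDeriv_succ_right, pderiv_one_tensorToMv, ih, pow_succ, Module.End.mul_eq_comp,
        LinearMap.lTensor_comp_apply]
  | succ a ih =>
    rw [polyDeriv_succ_left, pderiv_zero_tensorToMv, ih, pow_succ, Module.End.mul_eq_comp,
      LinearMap.rTensor_comp_apply]
    simp only [← LinearMap.comp_apply, LinearMap.lTensor_comp_rTensor,
      LinearMap.rTensor_comp_lTensor]

/-- The square of the `L²` norm on the open square. -/
noncomputable def sqNorm (q : MvPolynomial (Fin 2) ℝ) : ℝ := ∫ z in openSquare, polyValue q z ^ 2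

theorem sqNorm_nonneg (q : MvPolynomial (Fin 2) ℝ) : 0 ≤ sqNorm q :=
  integral_nonneg fun _ => sq_nonneg _

theorem volume_restrict_openSquare : (volume : Measure (ℝ × ℝ)).restrict openSquare =
    (volume.restrict (Ioo (-1 : ℝ) 1)).prod (volume.restrict (Ioo (-1 : ℝ) 1)) := by
  rw [openSquare, Measure.volume_eq_prod, Measure.prod_restrict]

theorem openSquare_subset_closedSquare : openSquare ⊆ closedSquare :=
  prod_mono Ioo_subset_Icc_self Ioo_subset_Icc_self

theorem isCompact_closedSquare : IsCompact closedSquare := isCompact_Icc.prod isCompact_Icc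

theorem Continuous.integrableOn_openSquare {f : ℝ × ℝ → ℝ} (hf : Continuous f) :
    IntegrableOn f openSquare :=
  (hf.continuousOn.integrableOn_compact isCompact_closedSquare).mono_set
    openSquare_subset_closedSquare

theorem integrableOn_polyValue_sq (q : MvPolynomial (Fin 2) ℝ) :
    IntegrableOn (fun z => polyValue q z ^ 2) openSquare :=
  ((continuous_polyValue q).pow 2).integrableOn_openSquare

theorem polyInner_eq_setIntegral (f : ℝ[X]) :
    polyInner f f = ∫ x in Ioo (-1 : ℝ) 1, f.eval x ^ 2 := by
  rw [polyInner_apply, intervalIntegral.integral_of_le (by norm_num), integral_Ioc_eq_integral_Ioo]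
  simp only [sq]

theorem sqNorm_eq_integral_sliceX (t : ℝ[X] ⊗[ℝ] ℝ[X]) :
    IntegrableOn (fun y => polyInner (sliceX y t) (sliceX y t)) (Ioo (-1) 1) ∧
    sqNorm (tensorToMv t) = ∫ y in Ioo (-1 : ℝ) 1, polyInner (sliceX y t) (sliceX y t) := by
  have h := integrableOn_polyValue_sq (tensorToMv t)
  rw [IntegrableOn, volume_restrict_openSquare] at h
  simp only [sqNorm, volume_restrict_openSquare, polyInner_eq_setIntegral, IntegrableOn]
  simp only [← eval_sliceX] at h ⊢
  exact ⟨h.integral_prod_right, integral_prod_symm _ h⟩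

theorem sqNorm_eq_integral_sliceY (t : ℝ[X] ⊗[ℝ] ℝ[X]) :
    IntegrableOn (fun x => polyInner (sliceY x t) (sliceY x t)) (Ioo (-1) 1) ∧
    sqNorm (tensorToMv t) = ∫ x in Ioo (-1 : ℝ) 1, polyInner (sliceY x t) (sliceY x t) := by
  have h := integrableOn_polyValue_sq (tensorToMv t)
  rw [IntegrableOn, volume_restrict_openSquare] at h
  simp only [sqNorm, volume_restrict_openSquare, polyInner_eq_setIntegral, IntegrableOn]
  simp only [← eval_sliceY] at h ⊢
  exact ⟨h.integral_prod_left, integral_prod _ h⟩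

/-- The operators act on each horizontal slice separately, so a one-dimensional inequality
integrates over the slices by Fubini. -/
theorem sqNorm_rTensor_le {A B : ℝ[X] →ₗ[ℝ] ℝ[X]} {c : ℝ}
    (h : ∀ f, c * polyInner (A f) (A f) ≤ polyInner (B f) (B f)) (t : ℝ[X] ⊗[ℝ] ℝ[X]) :
    c * sqNorm (tensorToMv (A.rTensor _ t)) ≤ sqNorm (tensorToMv (B.rTensor _ t)) := by
  obtain ⟨i1, e1⟩ := sqNorm_eq_integral_sliceX (A.rTensor _ t)
  obtain ⟨i2, e2⟩ := sqNorm_eq_integral_sliceX (B.rTensor _ t)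
  rw [e1, e2, ← integral_const_mul]
  refine integral_mono (i1.const_mul c) i2 fun y => ?_
  simp only [sliceX_rTensor]
  exact h _

theorem sqNorm_lTensor_le {A B : ℝ[X] →ₗ[ℝ] ℝ[X]} {c : ℝ}
    (h : ∀ f, c * polyInner (A f) (A f) ≤ polyInner (B f) (B f)) (t : ℝ[X] ⊗[ℝ] ℝ[X]) :
    c * sqNorm (tensorToMv (A.lTensor _ t)) ≤ sqNorm (tensorToMv (B.lTensor _ t)) := by
  obtain ⟨i1, e1⟩ := sqNorm_eq_integral_sliceY (A.lTensor _ t)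
  obtain ⟨i2, e2⟩ := sqNorm_eq_integral_sliceY (B.lTensor _ t)
  rw [e1, e2, ← integral_const_mul]
  refine integral_mono (i1.const_mul c) i2 fun y => ?_
  simp only [sliceY_lTensor]
  exact h _

theorem sqNorm_add_le (p q : MvPolynomial (Fin 2) ℝ) :
    sqNorm (p + q) ≤ 2 * sqNorm p + 2 * sqNorm q := by
  simp only [sqNorm, polyValue_add, Pi.add_apply]
  rw [← integral_const_mul, ← integral_const_mul,
    ← integral_add ((integrableOn_polyValue_sq p).const_mul 2)
      ((integrableOn_polyValue_sq q).const_mul 2)]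
  refine integral_mono (((continuous_polyValue p).add
    (continuous_polyValue q)).pow 2).integrableOn_openSquare
    (((integrableOn_polyValue_sq p).const_mul 2).add
      ((integrableOn_polyValue_sq q).const_mul 2)) fun z => ?_
  nlinarith [sq_nonneg (polyValue p z - polyValue q z)]

/-- The two-dimensional Sobolev inequality for polynomials. -/
theorem polyValue_sq_le (q : MvPolynomial (Fin 2) ℝ) {z : ℝ × ℝ} (hz : z ∈ closedSquare) :
    polyValue q z ^ 2 ≤ 4 * (sqNorm q + sqNorm (polyDeriv 1 0 q) + sqNorm (polyDeriv 0 1 q) +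
      sqNorm (polyDeriv 1 1 q)) := by
  obtain ⟨t, rfl⟩ := tensorToMv_surjective q
  -- The one-dimensional inequality on vertical lines, integrated in `x`, controls a single
  -- horizontal slice. It is used for `t` and for `∂₁t`, and this produces the mixed derivative.
  have key (t : ℝ[X] ⊗[ℝ] ℝ[X]) : polyInner (sliceX z.2 t) (sliceX z.2 t) ≤
      2 * (sqNorm (tensorToMv t) + sqNorm (polyDeriv 0 1 (tensorToMv t))) := by
    rw [polyDeriv_tensorToMv]
    simp only [pow_zero, pow_one, Module.End.one_eq_id, LinearMap.rTensor_id, LinearMap.id_apply]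
    obtain ⟨i1, e1⟩ := sqNorm_eq_integral_sliceY t
    obtain ⟨i2, e2⟩ := sqNorm_eq_integral_sliceY (derivative.lTensor _ t)
    rw [e1, e2, ← integral_add i1 i2, ← integral_const_mul, polyInner_eq_setIntegral]
    refine integral_mono ?_ ((i1.add i2).const_mul 2) fun x => ?_
    · exact (((sliceX z.2 t).continuous.pow 2).continuousOn.integrableOn_compact
        isCompact_Icc).mono_set Ioo_subset_Icc_self
    · have h1 := eval_sq_le (sliceY x t) hz.2
      have h2 := eval_sliceX t (x, z.2)
      have h3 := eval_sliceY t (x, z.2)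
      simp only [sliceY_lTensor] at h2 h3 ⊢
      rw [h2, ← h3]
      exact h1
  have h1 := eval_sq_le (sliceX z.2 t) hz.1
  rw [eval_sliceX] at h1
  have h2 := key t
  have h3 := key (derivative.rTensor _ t)
  rw [sliceX_rTensor] at h3
  have e1 : polyDeriv 1 0 (tensorToMv t) = tensorToMv (derivative.rTensor _ t) := by
    rw [polyDeriv_tensorToMv]
    simp [Module.End.one_eq_id]
  have e2 : polyDeriv 1 1 (tensorToMv t) = polyDeriv 0 1 (tensorToMv (derivative.rTensor _ t)) := by
    rw [← e1]; exact polyDeriv_succ_left 0 1 _ |>.trans rfl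
  rw [e1, e2]
  linarith


/-! ### The tensor product projection on the square and its error -/

/-- Degree `n` in each variable only gives total degree `2 * n`; this forces `n = p / 2` later and
is the source of `2 ^ k`. -/
theorem totalDegree_tensorToMv_map_le {n : ℕ} {A B : ℝ[X] →ₗ[ℝ] ℝ[X]}
    (hA : ∀ f, A f ∈ degreeLT ℝ (n + 1)) (hB : ∀ f, B f ∈ degreeLT ℝ (n + 1))
    (t : ℝ[X] ⊗[ℝ] ℝ[X]) : (tensorToMv (TensorProduct.map A B t)).totalDegree ≤ 2 * n := by
  have key (i : Fin 2) (f : ℝ[X]) (hf : f ∈ degreeLT ℝ (n + 1)) :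
      (aeval (MvPolynomial.X i : MvPolynomial (Fin 2) ℝ) f).totalDegree ≤ n := by
    have hd : f.natDegree ≤ n := by
      rw [mem_degreeLT, degree_lt_iff_coeff_zero] at hf
      exact natDegree_le_iff_coeff_eq_zero.2 fun m hm => hf m hm
    rw [aeval_eq_sum_range]
    refine MvPolynomial.totalDegree_finsetSum_le fun m hm => ?_
    refine (MvPolynomial.totalDegree_smul_le _ _).trans ?_
    refine (MvPolynomial.totalDegree_X_pow i m).le.trans ?_
    rw [Finset.mem_range] at hm
    omega
  induction t using TensorProduct.induction_on with
  | zero => simp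
  | tmul f g =>
    rw [TensorProduct.map_tmul, tensorToMv_tmul]
    refine (MvPolynomial.totalDegree_mul _ _).trans ?_
    have h1 := key 0 _ (hA f)
    have h2 := key 1 _ (hB g)
    omega
  | add s t hs ht =>
    rw [map_add, map_add]
    exact (MvPolynomial.totalDegree_add _ _).trans (max_le hs ht)

theorem polyValue_map_endpointProj {n : ℕ} (hn : 1 ≤ n) (t : ℝ[X] ⊗[ℝ] ℝ[X]) {z : ℝ × ℝ}
    (hz : z ∈ squareVertices) :
    polyValue (tensorToMv (TensorProduct.map (endpointProj n) (endpointProj n) t)) z =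
      polyValue (tensorToMv t) z := by
  induction t using TensorProduct.induction_on with
  | zero => simp
  | tmul f g =>
    rw [TensorProduct.map_tmul, polyValue_tmul, polyValue_tmul]
    rcases hz with rfl | rfl | rfl | rfl <;>
      simp [eval_one_endpointProj hn, eval_neg_one_endpointProj]
  | add s t hs ht => simp only [map_add, polyValue_add, Pi.add_apply, hs, ht]

/-- The leading factor `n` of `endpointProj_error` needs no exponential; a surplus factor `e` is
given away so that both projections have the same constant. -/
theorem endpointProj_error_pow {n k : ℕ} (hk : k + 1 ≤ n) (f : ℝ[X]) :
    (n : ℝ) ^ (2 * (k + 1)) * polyInner (f - endpointProj n f) (f - endpointProj n f) ≤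
      Real.exp 1 ^ (2 * (k + 1)) * polyInner (derivative^[k + 1] f) (derivative^[k + 1] f) := by
  have h := endpointProj_error (n := n) (k := k) (by omega) (by omega) f
  have h2 := pow_le_exp_mul_descFactorial (n := n) (k := k) (by omega)
  have h3 : (n : ℝ) ^ (k + 1) ≤ Real.exp 1 ^ (k + 1) * (n * n.descFactorial k) := by
    calc (n : ℝ) ^ (k + 1) = n * n ^ k := pow_succ' _ _
      _ ≤ n * (Real.exp 1 ^ k * n.descFactorial k) := by gcongr
      _ ≤ n * (Real.exp 1 ^ (k + 1) * n.descFactorial k) := by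
          gcongr
          · exact Real.one_le_exp zero_le_one
          · exact Nat.le_succ k
      _ = _ := by ring
  have h4 := polyInner_self_nonneg (f - endpointProj n f)
  rw [mul_comm 2, pow_mul, pow_mul]
  calc ((n : ℝ) ^ (k + 1)) ^ 2 * polyInner (f - endpointProj n f) (f - endpointProj n f)
      ≤ (Real.exp 1 ^ (k + 1) * (n * n.descFactorial k)) ^ 2 *
        polyInner (f - endpointProj n f) (f - endpointProj n f) := by gcongr
    _ = (Real.exp 1 ^ (k + 1)) ^ 2 * ((n * n.descFactorial k) ^ 2 *
        polyInner (f - endpointProj n f) (f - endpointProj n f)) := by ring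
    _ ≤ _ := by gcongr

theorem legendreProj_error_pow {n k : ℕ} (hk : k ≤ n) (f : ℝ[X]) :
    (n : ℝ) ^ (2 * k) * polyInner (f - legendreProj n f) (f - legendreProj n f) ≤
      Real.exp 1 ^ (2 * k) * polyInner (derivative^[k] f) (derivative^[k] f) := by
  have h := legendreProj_error n k hk f
  have h3 := pow_le_exp_mul_descFactorial hk
  have h4 := polyInner_self_nonneg (f - legendreProj n f)
  rw [mul_comm 2, pow_mul, pow_mul]
  calc ((n : ℝ) ^ k) ^ 2 * polyInner (f - legendreProj n f) (f - legendreProj n f)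
      ≤ (Real.exp 1 ^ k * n.descFactorial k) ^ 2 *
        polyInner (f - legendreProj n f) (f - legendreProj n f) := by gcongr
    _ = (Real.exp 1 ^ k) ^ 2 * ((n.descFactorial k) ^ 2 *
        polyInner (f - legendreProj n f) (f - legendreProj n f)) := by ring
    _ ≤ _ := by gcongr

/-- The operator `cᵐ dᵐ/dxᵐ`. -/
noncomputable def scaledDerivative (c : ℝ) (m : ℕ) : ℝ[X] →ₗ[ℝ] ℝ[X] := c ^ m • derivative ^ m

theorem polyInner_scaledDerivative (c : ℝ) (m : ℕ) (f : ℝ[X]) :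
    polyInner (scaledDerivative c m f) (scaledDerivative c m f) =
      c ^ (2 * m) * polyInner (derivative^[m] f) (derivative^[m] f) := by
  rw [scaledDerivative, LinearMap.smul_apply, Module.End.pow_apply, map_smul, map_smul,
    LinearMap.smul_apply, smul_eq_mul, smul_eq_mul]
  ring

/-- The constant is absorbed into the operator on the right, which gives the shape required by
`sqNorm_rTensor_le` and `sqNorm_lTensor_le`. -/
theorem id_sub_endpointProj_error {n k : ℕ} (hk : k + 1 ≤ n) (f : ℝ[X]) :
    (n : ℝ) ^ (2 * (k + 1)) * polyInner ((LinearMap.id - endpointProj n : ℝ[X] →ₗ[ℝ] ℝ[X]) f)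
        ((LinearMap.id - endpointProj n : ℝ[X] →ₗ[ℝ] ℝ[X]) f) ≤
      polyInner (scaledDerivative (Real.exp 1) (k + 1) f)
        (scaledDerivative (Real.exp 1) (k + 1) f) := by
  rw [polyInner_scaledDerivative]
  exact endpointProj_error_pow hk f

theorem id_sub_legendreProj_error {n k : ℕ} (hk : k ≤ n) (f : ℝ[X]) :
    (n : ℝ) ^ (2 * k) * polyInner ((LinearMap.id - legendreProj n : ℝ[X] →ₗ[ℝ] ℝ[X]) f)
        ((LinearMap.id - legendreProj n : ℝ[X] →ₗ[ℝ] ℝ[X]) f) ≤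
      polyInner (scaledDerivative (Real.exp 1) k f) (scaledDerivative (Real.exp 1) k f) := by
  rw [polyInner_scaledDerivative]
  exact legendreProj_error_pow hk f

theorem sqNorm_smul (c : ℝ) (q : MvPolynomial (Fin 2) ℝ) : sqNorm (c • q) = c ^ 2 * sqNorm q := by
  simp only [sqNorm, polyValue_smul, Pi.smul_apply, smul_eq_mul, mul_pow, integral_const_mul]

theorem sqNorm_scaledDerivative_rTensor (c : ℝ) (m : ℕ) (t : ℝ[X] ⊗[ℝ] ℝ[X]) :
    sqNorm (tensorToMv ((scaledDerivative c m).rTensor _ t)) =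
      c ^ (2 * m) * sqNorm (polyDeriv m 0 (tensorToMv t)) := by
  rw [scaledDerivative, LinearMap.rTensor_smul, LinearMap.smul_apply, map_smul, sqNorm_smul, polyDeriv_tensorToMv]
  simp [Module.End.one_eq_id]
  left; ring

theorem sqNorm_scaledDerivative_lTensor (c : ℝ) (m : ℕ) (t : ℝ[X] ⊗[ℝ] ℝ[X]) :
    sqNorm (tensorToMv ((scaledDerivative c m).lTensor _ t)) =
      c ^ (2 * m) * sqNorm (polyDeriv 0 m (tensorToMv t)) := by
  rw [scaledDerivative, LinearMap.lTensor_smul, LinearMap.smul_apply, map_smul, sqNorm_smul, polyDeriv_tensorToMv]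
  simp [Module.End.one_eq_id]
  left; ring

theorem mul_le_two_mul_add {c E S a b b' A B : ℝ} (hc : 0 ≤ c) (h : S ≤ 2 * a + 2 * b)
    (h₁ : c * a ≤ E * A) (h₂ : b ≤ b') (h₃ : c * b' ≤ E * B) : c * S ≤ 2 * E * (A + B) := by
  have h4 := mul_le_mul_of_nonneg_left h hc
  have h5 := mul_le_mul_of_nonneg_left h₂ hc
  linarith

/-- Because `D π = P D`, with `π` the end point projection and `P` the Legendre projection, `D ⊗ 1 -
D π ⊗ π` telescopes into `(1 - P) D ⊗ 1 + P D ⊗ (1 - π)`. The first term is an error in `x` alone,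
the second an error in `y` under the contraction `P`. -/
theorem polyDeriv_one_zero_sub_map (n : ℕ) (t : ℝ[X] ⊗[ℝ] ℝ[X]) :
    polyDeriv 1 0 (tensorToMv (t - TensorProduct.map (endpointProj n) (endpointProj n) t)) =
      tensorToMv ((LinearMap.id - legendreProj n).rTensor _ (derivative.rTensor _ t)) +
      tensorToMv ((legendreProj n).rTensor _
        ((LinearMap.id - endpointProj n).lTensor _ (derivative.rTensor _ t))) := by
  rw [show polyDeriv 1 0 (tensorToMv _) = _ from pderiv_zero_tensorToMv _, ← map_add]
  congr 1
  induction t using TensorProduct.induction_on with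
  | zero => simp
  | tmul f g =>
    simp only [map_sub, TensorProduct.map_tmul, LinearMap.rTensor_tmul, LinearMap.lTensor_tmul,
      LinearMap.sub_apply, LinearMap.id_apply, derivative_endpointProj, sub_tmul, tmul_sub]
    abel
  | add s t hs ht =>
    simp only [map_add, add_sub_add_comm] at hs ht ⊢
    rw [hs, ht]; abel

theorem sqNorm_polyDeriv_one_zero_sub_le {n k : ℕ} (hk : k + 1 ≤ n) (t : ℝ[X] ⊗[ℝ] ℝ[X]) :
    (n : ℝ) ^ (2 * (k + 1)) * sqNorm (polyDeriv 1 0 (tensorToMv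
      (t - TensorProduct.map (endpointProj n) (endpointProj n) t))) ≤
    2 * Real.exp 1 ^ (2 * (k + 1)) * (sqNorm (polyDeriv (k + 2) 0 (tensorToMv t)) +
      sqNorm (polyDeriv 1 (k + 1) (tensorToMv t))) := by
  obtain ⟨s, hs⟩ : ∃ s, s = (derivative : ℝ[X] →ₗ[ℝ] ℝ[X]).rTensor ℝ[X] t := ⟨_, rfl⟩
  have hs' : tensorToMv s = MvPolynomial.pderiv 0 (tensorToMv t) := by
    rw [hs, pderiv_zero_tensorToMv]
  have h1 := sqNorm_rTensor_le (id_sub_legendreProj_error hk) s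
  have h2 := sqNorm_rTensor_le (A := legendreProj n) (B := LinearMap.id) (c := 1)
    (fun f => by rw [one_mul]; exact polyInner_legendreProj_le n f)
    ((LinearMap.id - endpointProj n).lTensor _ s)
  have h3 := sqNorm_lTensor_le (id_sub_endpointProj_error hk) s
  rw [sqNorm_scaledDerivative_rTensor, hs', ← polyDeriv_succ_left] at h1
  rw [sqNorm_scaledDerivative_lTensor, hs', ← polyDeriv_succ_left] at h3
  rw [LinearMap.rTensor_id, LinearMap.id_apply, one_mul] at h2
  rw [polyDeriv_one_zero_sub_map, ← hs]
  exact mul_le_two_mul_add (by positivity) (sqNorm_add_le _ _) h1 h2 h3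

theorem polyDeriv_zero_one_sub_map (n : ℕ) (t : ℝ[X] ⊗[ℝ] ℝ[X]) :
    polyDeriv 0 1 (tensorToMv (t - TensorProduct.map (endpointProj n) (endpointProj n) t)) =
      tensorToMv ((LinearMap.id - legendreProj n).lTensor _ (derivative.lTensor _ t)) +
      tensorToMv ((legendreProj n).lTensor _
        ((LinearMap.id - endpointProj n).rTensor _ (derivative.lTensor _ t))) := by
  rw [show polyDeriv 0 1 (tensorToMv _) = _ from pderiv_one_tensorToMv _, ← map_add]
  congr 1
  induction t using TensorProduct.induction_on with
  | zero => simp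
  | tmul f g =>
    simp only [map_sub, TensorProduct.map_tmul, LinearMap.rTensor_tmul, LinearMap.lTensor_tmul,
      LinearMap.sub_apply, LinearMap.id_apply, derivative_endpointProj, sub_tmul, tmul_sub]
    abel
  | add s t hs ht =>
    simp only [map_add, add_sub_add_comm] at hs ht ⊢
    rw [hs, ht]; abel

theorem sqNorm_polyDeriv_zero_one_sub_le {n k : ℕ} (hk : k + 1 ≤ n) (t : ℝ[X] ⊗[ℝ] ℝ[X]) :
    (n : ℝ) ^ (2 * (k + 1)) * sqNorm (polyDeriv 0 1 (tensorToMv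
      (t - TensorProduct.map (endpointProj n) (endpointProj n) t))) ≤
    2 * Real.exp 1 ^ (2 * (k + 1)) * (sqNorm (polyDeriv 0 (k + 2) (tensorToMv t)) +
      sqNorm (polyDeriv (k + 1) 1 (tensorToMv t))) := by
  obtain ⟨s, hs⟩ : ∃ s, s = (derivative : ℝ[X] →ₗ[ℝ] ℝ[X]).lTensor ℝ[X] t := ⟨_, rfl⟩
  have hs' : tensorToMv s = MvPolynomial.pderiv 1 (tensorToMv t) := by
    rw [hs, pderiv_one_tensorToMv]
  have h1 := sqNorm_lTensor_le (id_sub_legendreProj_error hk) s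
  have h2 := sqNorm_lTensor_le (A := legendreProj n) (B := LinearMap.id) (c := 1)
    (fun f => by rw [one_mul]; exact polyInner_legendreProj_le n f)
    ((LinearMap.id - endpointProj n).rTensor _ s)
  have h3 := sqNorm_rTensor_le (id_sub_endpointProj_error hk) s
  rw [sqNorm_scaledDerivative_lTensor, hs', ← polyDeriv_succ_right] at h1
  rw [sqNorm_scaledDerivative_rTensor, hs', ← polyDeriv_succ_right] at h3
  rw [LinearMap.lTensor_id, LinearMap.id_apply, one_mul] at h2
  rw [polyDeriv_zero_one_sub_map, ← hs]
  exact mul_le_two_mul_add (by positivity) (sqNorm_add_le _ _) h1 h2 h3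

/-- Polynomial approximation of a polynomial of high degree, with interpolation at the vertices. -/
theorem exists_interpolating_poly {n k : ℕ} (hk : 1 ≤ k) (hkn : k ≤ n)
    (u : MvPolynomial (Fin 2) ℝ) :
    ∃ q : MvPolynomial (Fin 2) ℝ, q.totalDegree ≤ 2 * n ∧
      (∀ V ∈ squareVertices, polyValue q V = polyValue u V) ∧
      (n : ℝ) ^ (2 * k) * (sqNorm (polyDeriv 1 0 (u - q)) + sqNorm (polyDeriv 0 1 (u - q))) ≤
        8 * Real.exp 1 ^ (2 * k) *
          ∑ a ∈ Finset.range (k + 2), sqNorm (polyDeriv a (k + 1 - a) u) := by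
  obtain ⟨k, rfl⟩ : ∃ j, k = j + 1 := ⟨k - 1, by omega⟩
  obtain ⟨t, rfl⟩ := tensorToMv_surjective u
  refine ⟨tensorToMv (TensorProduct.map (endpointProj n) (endpointProj n) t),
    totalDegree_tensorToMv_map_le (endpointProj_mem n) (endpointProj_mem n) t,
    fun V hV => polyValue_map_endpointProj (by omega) t hV, ?_⟩
  rw [← map_sub]
  have h1 := sqNorm_polyDeriv_one_zero_sub_le hkn t
  have h2 := sqNorm_polyDeriv_zero_one_sub_le hkn t
  -- Each of the four derivatives in the two bounds is one term of the full sum; four of them with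
  -- the factor 2 give the constant 8.
  have hS (a b : ℕ) (hab : a + b = k + 2) : sqNorm (polyDeriv a b (tensorToMv t)) ≤
      ∑ a ∈ Finset.range (k + 1 + 2), sqNorm (polyDeriv a (k + 1 + 1 - a) (tensorToMv t)) := by
    have hb : b = k + 1 + 1 - a := by omega
    rw [hb]
    exact Finset.single_le_sum (f := fun a => sqNorm (polyDeriv a (k + 1 + 1 - a) (tensorToMv t)))
      (fun _ _ => sqNorm_nonneg _) (Finset.mem_range.2 (by omega))
  have a1 := hS (k + 2) 0 (by omega)
  have a2 := hS 1 (k + 1) (by omega)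
  have a3 := hS 0 (k + 2) (by omega)
  have a4 := hS (k + 1) 1 (by omega)
  generalize (∑ a ∈ Finset.range (k + 1 + 2),
    sqNorm (polyDeriv a (k + 1 + 1 - a) (tensorToMv t))) = S at *
  have h5 : (0 : ℝ) ≤ 2 * Real.exp 1 ^ (2 * (k + 1)) := by positivity
  have b1 := mul_le_mul_of_nonneg_left (add_le_add a1 a2) h5
  have b2 := mul_le_mul_of_nonneg_left (add_le_add a3 a4) h5
  linarith

end Tensor

/-! ### Mollification -/

section Mollify

open scoped Convolution
open Filter Topology

/-- The convolution of two real functions on the plane. -/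
noncomputable def mollify (u ψ : ℝ × ℝ → ℝ) (z : ℝ × ℝ) : ℝ := ∫ t, u t * ψ (z - t)

theorem mollify_eq_convolution (u ψ : ℝ × ℝ → ℝ) :
    mollify u ψ = u ⋆[ContinuousLinearMap.lsmul ℝ ℝ, volume] ψ := rfl

theorem mollify_eq_swap (u ψ : ℝ × ℝ → ℝ) (z : ℝ × ℝ) :
    mollify u ψ z = ∫ t, u (z - t) * ψ t :=
  convolution_lsmul_swap (f := u) (g := ψ) (μ := volume)

theorem mollify_comm (u ψ : ℝ × ℝ → ℝ) : mollify u ψ = mollify ψ u := by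
  ext z; rw [mollify_eq_swap]; simp only [mollify, mul_comm]

theorem contDiff_mollify {u ψ : ℝ × ℝ → ℝ} (hu : LocallyIntegrable u) (hψ : ContDiff ℝ ∞ ψ)
    (hc : HasCompactSupport ψ) : ContDiff ℝ ∞ (mollify u ψ) :=
  hc.contDiff_convolution_right (ContinuousLinearMap.lsmul ℝ ℝ) hu hψ

theorem fderiv_mollify {u ψ : ℝ × ℝ → ℝ} (hu : LocallyIntegrable u) (hψ : ContDiff ℝ ∞ ψ)
    (hc : HasCompactSupport ψ) (z v : ℝ × ℝ) :
    fderiv ℝ (mollify u ψ) z v = mollify u (fun t => fderiv ℝ ψ t v) z := by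
  have hψ1 : ContDiff ℝ 1 ψ := hψ.of_le (by exact_mod_cast le_top)
  rw [mollify_eq_convolution, (hc.hasFDerivAt_convolution_right
    (ContinuousLinearMap.lsmul ℝ ℝ) hu hψ1 z).fderiv,
    convolution_precompR_apply _ hu (hc.fderiv ℝ) (hψ1.continuous_fderiv one_ne_zero)]
  rfl

theorem partial_iterate_mollify {u ψ : ℝ × ℝ → ℝ} (hu : LocallyIntegrable u)
    (hψ : IsTestFunction univ ψ) (a b : ℕ) :
    partialX^[a] (partialY^[b] (mollify u ψ)) = mollify u (partialX^[a] (partialY^[b] ψ)) := by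
  induction a with
  | zero =>
    induction b with
    | zero => rfl
    | succ b ih =>
      have h := hψ.iterate 0 b
      simp only [Function.iterate_zero, id] at ih h ⊢
      rw [Function.iterate_succ_apply', ih, Function.iterate_succ_apply']
      ext z
      exact fderiv_mollify hu h.1 h.2.1 z (0, 1)
  | succ a ih =>
    have h := hψ.iterate a b
    rw [Function.iterate_succ_apply', ih, Function.iterate_succ_apply']
    ext z
    exact fderiv_mollify hu h.1 h.2.1 z (1, 0)

theorem fderiv_const_mul_comp_affine {ψ : ℝ × ℝ → ℝ} (hψ : Differentiable ℝ ψ) (x : ℝ × ℝ)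
    (r s : ℝ) (t v : ℝ × ℝ) :
    fderiv ℝ (fun t => r * ψ (x + s • t)) t v = (r * s) * fderiv ℝ ψ (x + s • t) v := by
  have h1 : HasFDerivAt (fun t : ℝ × ℝ => x + s • t) (s • ContinuousLinearMap.id ℝ (ℝ × ℝ)) t :=
    ((hasFDerivAt_id t).const_smul s).const_add x
  have h2 := ((hψ (x + s • t)).hasFDerivAt.comp t h1).const_mul r
  rw [show (fun t => r * ψ (x + s • t)) = fun t => r * (ψ ∘ fun t => x + s • t) t from rfl,
    h2.fderiv]
  simp [mul_assoc]

/-- Needed with `s = -1` for the reflected mollifier and with `s = 1 - mollRadius j` for the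
contraction. -/
theorem partial_iterate_comp_affine {ψ : ℝ × ℝ → ℝ} (hψ : ContDiff ℝ ∞ ψ) (x : ℝ × ℝ)
    (s : ℝ) (a b : ℕ) :
    partialX^[a] (partialY^[b] (fun t => ψ (x + s • t))) =
      fun t => s ^ (a + b) * (partialX^[a] (partialY^[b] ψ)) (x + s • t) := by
  have hX (f : ℝ × ℝ → ℝ) (hf : ContDiff ℝ ∞ f) : ContDiff ℝ ∞ (partialX f) :=
    (hf.fderiv_right (m := ∞) (by simp)).clm_apply contDiff_const
  have hY (f : ℝ × ℝ → ℝ) (hf : ContDiff ℝ ∞ f) : ContDiff ℝ ∞ (partialY f) :=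
    (hf.fderiv_right (m := ∞) (by simp)).clm_apply contDiff_const
  have hYb (b : ℕ) : ContDiff ℝ ∞ (partialY^[b] ψ) := by
    induction b with
    | zero => exact hψ
    | succ b ih => rw [Function.iterate_succ_apply']; exact hY _ ih
  have hXa (a : ℕ) : ContDiff ℝ ∞ (partialX^[a] (partialY^[b] ψ)) := by
    induction a with
    | zero => exact hYb b
    | succ a ih => rw [Function.iterate_succ_apply']; exact hX _ ih
  induction a with
  | zero =>
    simp only [Function.iterate_zero, id, zero_add]
    clear hXa
    induction b with
    | zero => simp
    | succ b ih =>
      rw [Function.iterate_succ_apply', ih, Function.iterate_succ_apply', pow_succ]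
      ext t
      exact fderiv_const_mul_comp_affine ((hYb b).differentiable (by simp)) x _ s t (0, 1)
  | succ a ih =>
    rw [Function.iterate_succ_apply', ih, Function.iterate_succ_apply',
      show a + 1 + b = a + b + 1 by ring, pow_succ]
    ext t
    exact fderiv_const_mul_comp_affine ((hXa a).differentiable (by simp)) x _ s t (1, 0)

/-- The function `ψ (z - ·)` is an admissible test function on `U`; the sign from the reflection
cancels the one in the definition of the weak derivative. -/
theorem HasWeakDeriv.mollify_eq {a b : ℕ} {U : Set (ℝ × ℝ)} (hU : MeasurableSet U)
    {u v ψ : ℝ × ℝ → ℝ} (h : HasWeakDeriv a b U u v) (hψ : IsTestFunction univ ψ) {z : ℝ × ℝ}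
    (hz : ∀ t, z - t ∈ tsupport ψ → t ∈ U) :
    mollify (U.indicator u) (partialX^[a] (partialY^[b] ψ)) z = mollify (U.indicator v) ψ z := by
  have hφ : IsTestFunction U (fun t => ψ (z - t)) := by
    refine ⟨hψ.1.comp (contDiff_const.sub contDiff_id), ?_, ?_⟩
    · exact hψ.2.1.comp_homeomorph (Homeomorph.subLeft z)
    · intro t ht
      exact hz t (tsupport_comp_subset_preimage ψ (f := fun t => z - t) (by fun_prop) ht)
  have e := partial_iterate_comp_affine hψ.1 z (-1) a b
  have e' : (fun t => ψ (z + (-1 : ℝ) • t)) = fun t => ψ (z - t) := by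
    ext t; simp [sub_eq_add_neg]
  rw [e'] at e
  have hw := h.2.2 _ hφ
  rw [e] at hw
  have hw' : ∫ t in U, u t * partialX^[a] (partialY^[b] ψ) (z - t) = ∫ t in U, v t * ψ (z - t) := by
    refine mul_left_cancel₀ (pow_ne_zero (a + b) (by norm_num : (-1 : ℝ) ≠ 0)) ?_
    rw [← hw, ← integral_const_mul]
    refine integral_congr_ae (.of_forall fun t => ?_)
    simp only [neg_smul, one_smul, ← sub_eq_add_neg]
    ring
  have hi (f g : ℝ × ℝ → ℝ) : ∫ t, U.indicator f t * g t = ∫ t in U, f t * g t := by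
    rw [← integral_indicator hU]
    simp only [indicator_mul_left]
  rw [mollify, mollify, hi u fun t => _, hi v fun t => _]
  exact hw'

/-- Jensen's inequality for the probability density `ρ (z - ·)`, obtained from the nonnegativity of
the variance. -/
theorem sq_mollify_le {u ρ : ℝ × ℝ → ℝ} (hu : MemLp u 2) (hc : Continuous ρ)
    (hs : HasCompactSupport ρ) (h0 : ∀ t, 0 ≤ ρ t) (h1 : ∫ t, ρ t = 1) (z : ℝ × ℝ) :
    mollify u ρ z ^ 2 ≤ mollify (fun t => u t ^ 2) ρ z := by
  have hu1 : LocallyIntegrable u := hu.locallyIntegrable (by norm_num)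
  have hu2 : LocallyIntegrable (fun t => u t ^ 2) := hu.integrable_sq.locallyIntegrable
  have i1 : Integrable (fun t => u t * ρ (z - t)) :=
    hs.convolutionExists_right (ContinuousLinearMap.lsmul ℝ ℝ) hu1 hc z
  have i2 : Integrable (fun t => u t ^ 2 * ρ (z - t)) :=
    hs.convolutionExists_right (ContinuousLinearMap.lsmul ℝ ℝ) hu2 hc z
  have i3 : Integrable (fun t => ρ (z - t)) :=
    (hc.integrable_of_hasCompactSupport hs).comp_sub_left z
  have e3 : ∫ t, ρ (z - t) = 1 := by rw [integral_sub_left_eq_self ρ volume z, h1]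
  set m := mollify u ρ z with hm
  have key : 0 ≤ ∫ t, (u t - m) ^ 2 * ρ (z - t) :=
    integral_nonneg fun t => mul_nonneg (sq_nonneg _) (h0 _)
  have e : ∫ t, (u t - m) ^ 2 * ρ (z - t) =
      (mollify (fun t => u t ^ 2) ρ z - 2 * m * m) + m ^ 2 * 1 := by
    have f1 : 2 * m * m = ∫ t, 2 * m * (u t * ρ (z - t)) := by
      rw [integral_const_mul]; rfl
    have f2 : mollify (fun t => u t ^ 2) ρ z - 2 * m * m =
        ∫ t, (u t ^ 2 * ρ (z - t) - 2 * m * (u t * ρ (z - t))) := by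
      rw [f1]; exact (integral_sub i2 (i1.const_mul _)).symm
    have f3 : m ^ 2 * 1 = ∫ t, m ^ 2 * ρ (z - t) := by rw [integral_const_mul, e3]
    rw [f2, f3]
    refine Eq.trans ?_ (integral_add (i2.sub (i1.const_mul _)) (i3.const_mul _))
    refine integral_congr_ae (.of_forall fun t => ?_)
    dsimp only
    ring
  rw [e] at key
  linarith

theorem integral_sq_mollify_le {u ρ : ℝ × ℝ → ℝ} (hu : MemLp u 2) (hc : Continuous ρ)
    (hs : HasCompactSupport ρ) (h0 : ∀ t, 0 ≤ ρ t) (h1 : ∫ t, ρ t = 1) :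
    Integrable (fun z => mollify u ρ z ^ 2) ∧
      ∫ z, mollify u ρ z ^ 2 ≤ ∫ z, u z ^ 2 := by
  have hu1 : LocallyIntegrable u := hu.locallyIntegrable (by norm_num)
  have hi : Integrable (mollify (fun t => u t ^ 2) ρ) :=
    hu.integrable_sq.integrable_convolution (ContinuousLinearMap.lsmul ℝ ℝ)
      (hc.integrable_of_hasCompactSupport hs)
  have hcont : Continuous (mollify u ρ) :=
    hs.continuous_convolution_right (ContinuousLinearMap.lsmul ℝ ℝ) hu1 hc
  have hi' : Integrable (fun z => mollify u ρ z ^ 2) := by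
    refine hi.mono' (hcont.pow 2).aestronglyMeasurable (.of_forall fun z => ?_)
    rw [Real.norm_of_nonneg (sq_nonneg _)]
    exact sq_mollify_le hu hc hs h0 h1 z
  refine ⟨hi', (integral_mono hi' hi (sq_mollify_le hu hc hs h0 h1)).trans_eq ?_⟩
  have := integral_convolution (ContinuousLinearMap.lsmul ℝ ℝ) (μ := volume) (ν := volume)
    hu.integrable_sq (hc.integrable_of_hasCompactSupport hs)
  rw [mollify_eq_convolution, this, h1]
  simp

theorem abs_mollify_le {g ρ : ℝ × ℝ → ℝ} {M : ℝ} (hg : ∀ z, |g z| ≤ M) (hc : Continuous ρ)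
    (hs : HasCompactSupport ρ) (h0 : ∀ t, 0 ≤ ρ t) (h1 : ∫ t, ρ t = 1) (z : ℝ × ℝ) :
    |mollify g ρ z| ≤ M := by
  have i3 : Integrable (fun t => M * ρ t) := (hc.integrable_of_hasCompactSupport hs).const_mul M
  rw [mollify_eq_swap]
  have hb (t : ℝ × ℝ) : ‖g (z - t) * ρ t‖ ≤ M * ρ t := by
    rw [norm_mul, Real.norm_eq_abs, Real.norm_of_nonneg (h0 _)]
    exact mul_le_mul_of_nonneg_right (hg _) (h0 _)
  refine (norm_integral_le_of_norm_le i3 (.of_forall hb)).trans_eq ?_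
  rw [integral_const_mul, h1, mul_one]

end Mollify

/-! ### Polynomial approximation of smooth functions by Landau kernels -/

section Landau

open Filter Topology

theorem integral_sq_add_le {α : Type*} [MeasurableSpace α] {μ : Measure α} {f g : α → ℝ}
    (hf : MemLp f 2 μ) (hg : MemLp g 2 μ) :
    ∫ z, (f z + g z) ^ 2 ∂μ ≤ 2 * ∫ z, f z ^ 2 ∂μ + 2 * ∫ z, g z ^ 2 ∂μ := by
  rw [← integral_const_mul, ← integral_const_mul,
    ← integral_add (hf.integrable_sq.const_mul 2) (hg.integrable_sq.const_mul 2)]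
  refine integral_mono (hf.add hg).integrable_sq
    ((hf.integrable_sq.const_mul 2).add (hg.integrable_sq.const_mul 2)) fun z => ?_
  dsimp only
  nlinarith [sq_nonneg (f z - g z)]

theorem integral_sq_sub_le {α : Type*} [MeasurableSpace α] {μ : Measure α} {f g h : α → ℝ}
    (hf : MemLp f 2 μ) (hg : MemLp g 2 μ) (hh : MemLp h 2 μ) :
    ∫ z, (f z - h z) ^ 2 ∂μ ≤ 2 * ∫ z, (f z - g z) ^ 2 ∂μ + 2 * ∫ z, (g z - h z) ^ 2 ∂μ := by
  have := integral_sq_add_le (hf.sub hg) (hg.sub hh)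
  simpa using this

theorem Continuous.memLp_openSquare {f : ℝ × ℝ → ℝ} (hf : Continuous f) :
    MemLp f 2 (volume.restrict openSquare) :=
  (memLp_two_iff_integrable_sq hf.aestronglyMeasurable).2 (hf.pow 2).integrableOn_openSquare

instance isFiniteMeasure_openSquare : IsFiniteMeasure ((volume : Measure (ℝ × ℝ)).restrict openSquare) :=
  ⟨by
    rw [Measure.restrict_apply_univ]
    exact (measure_mono openSquare_subset_closedSquare).trans_lt
      isCompact_closedSquare.measure_lt_top⟩

/-- The convolution of a compactly supported function with a polynomial is a polynomial. -/
theorem exists_polyValue_eq_mollify (κ : MvPolynomial (Fin 2) ℝ) {F : ℝ × ℝ → ℝ}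
    (hF : Continuous F) (hc : HasCompactSupport F) :
    ∃ q : MvPolynomial (Fin 2) ℝ, polyValue q = mollify F (polyValue κ) := by
  have hi (κ : MvPolynomial (Fin 2) ℝ) {F : ℝ × ℝ → ℝ}
      (hF : Continuous F) (hc : HasCompactSupport F) (z : ℝ × ℝ) :
      Integrable fun t => F t * polyValue κ (z - t) :=
    (hF.mul ((continuous_polyValue κ).comp (by fun_prop))).integrable_of_hasCompactSupport
      hc.mul_right
  induction κ using MvPolynomial.induction_on generalizing F with
  | C a =>
    refine ⟨MvPolynomial.C (∫ t, F t * a), ?_⟩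
    ext z
    simp [polyValue, mollify]
  | add p q hp hq =>
    obtain ⟨p', hp'⟩ := hp hF hc
    obtain ⟨q', hq'⟩ := hq hF hc
    refine ⟨p' + q', ?_⟩
    ext z
    rw [polyValue_add, hp', hq', polyValue_add, Pi.add_apply, mollify, mollify, mollify,
      ← integral_add (hi p hF hc z) (hi q hF hc z)]
    simp only [Pi.add_apply, mul_add]
  | mul_X p i hp =>
    have hX : ∃ l : ℝ × ℝ →L[ℝ] ℝ, ∀ z, polyValue (MvPolynomial.X i) z = l z := by
      fin_cases i
      · exact ⟨ContinuousLinearMap.fst ℝ ℝ ℝ, fun z => by simp [polyValue]⟩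
      · exact ⟨ContinuousLinearMap.snd ℝ ℝ ℝ, fun z => by simp [polyValue]⟩
    obtain ⟨l, hl⟩ := hX
    have hmul (p q : MvPolynomial (Fin 2) ℝ) (z : ℝ × ℝ) :
        polyValue (p * q) z = polyValue p z * polyValue q z := by simp [polyValue]
    obtain ⟨p', hp'⟩ := hp hF hc
    -- Since `l (z - t) = l z - l t`, the new factor splits into one that leaves the integral and
    -- one absorbed by `F`; this is why the induction runs over all `F`.
    obtain ⟨q', hq'⟩ := hp (F := fun t => l t * F t) (l.continuous.mul hF) hc.mul_left
    refine ⟨p' * MvPolynomial.X i - q', ?_⟩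
    ext z
    rw [polyValue_sub, Pi.sub_apply, hmul, hp', hq', hl, mollify, mollify, mollify,
      ← integral_mul_const]
    refine (integral_sub ((hi p hF hc z).mul_const _)
      (hi p (F := fun t => l t * F t) (l.continuous.mul hF) hc.mul_left z)).symm.trans ?_
    refine integral_congr_ae (.of_forall fun t => ?_)
    simp only [hmul, hl, map_sub]
    ring

/-- The base of the Landau kernels. -/
noncomputable def landauBase : MvPolynomial (Fin 2) ℝ :=
  (1 - MvPolynomial.C (1 / 16) * MvPolynomial.X 0 ^ 2) *
    (1 - MvPolynomial.C (1 / 16) * MvPolynomial.X 1 ^ 2)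

theorem polyValue_landauBase (z : ℝ × ℝ) :
    polyValue landauBase z = (1 - 1 / 16 * z.1 ^ 2) * (1 - 1 / 16 * z.2 ^ 2) := by
  simp [polyValue, landauBase]

theorem abs_le_of_mem_closedBall {z : ℝ × ℝ} {r : ℝ} (hz : z ∈ Metric.closedBall (0 : ℝ × ℝ) r) :
    |z.1| ≤ r ∧ |z.2| ≤ r := by
  rw [mem_closedBall_zero_iff] at hz
  exact ⟨(norm_fst_le z).trans hz, (norm_snd_le z).trans hz⟩

theorem landauBase_nonneg {z : ℝ × ℝ} (hz : z ∈ Metric.closedBall (0 : ℝ × ℝ) 4) :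
    0 ≤ polyValue landauBase z := by
  obtain ⟨h1, h2⟩ := abs_le_of_mem_closedBall hz
  rw [polyValue_landauBase]
  have h3 := sq_le_sq' (neg_le_of_abs_le h1) (le_of_abs_le h1)
  have h4 := sq_le_sq' (neg_le_of_abs_le h2) (le_of_abs_le h2)
  exact mul_nonneg (by linarith) (by linarith)

theorem landauBase_lt {z : ℝ × ℝ} (hz : z ∈ Metric.closedBall (0 : ℝ × ℝ) 4) (h0 : z ≠ 0) :
    polyValue landauBase z < polyValue landauBase 0 := by
  obtain ⟨h1, h2⟩ := abs_le_of_mem_closedBall hz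
  rw [polyValue_landauBase, polyValue_landauBase]
  have h3 := sq_le_sq' (neg_le_of_abs_le h1) (le_of_abs_le h1)
  have h4 := sq_le_sq' (neg_le_of_abs_le h2) (le_of_abs_le h2)
  have h5 : 0 < z.1 ^ 2 + z.2 ^ 2 := by
    by_contra! h
    have e1 : z.1 = 0 := by nlinarith [sq_nonneg z.1, sq_nonneg z.2]
    have e2 : z.2 = 0 := by nlinarith [sq_nonneg z.1, sq_nonneg z.2]
    exact h0 (Prod.ext e1 e2)
  have h6 := mul_nonneg (sq_nonneg z.1) (sub_nonneg.2 h4)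
  have h7 := mul_nonneg (sq_nonneg z.2) (sub_nonneg.2 h3)
  simp only [Prod.fst_zero, Prod.snd_zero]
  nlinarith

/-- The convolution with the normalized Landau kernel. -/
noncomputable def landauConv (G : ℝ × ℝ → ℝ) (n : ℕ) (z : ℝ × ℝ) : ℝ :=
  (∫ w in Metric.closedBall (0 : ℝ × ℝ) 4, polyValue landauBase w ^ n)⁻¹ *
    mollify G (polyValue (landauBase ^ n)) z

/-- For `z` in the unit square and `z - w` in the support of `G`, the sup norm of `w` is at most `1
+ 3 = 4`. Only the region where the kernel is nonnegative and peaks at 0 contributes. -/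
theorem landauConv_eq {G : ℝ × ℝ → ℝ} (hG : tsupport G ⊆ Metric.closedBall 0 3) (n : ℕ)
    {z : ℝ × ℝ} (hz : z ∈ openSquare) :
    landauConv G n z = (∫ w in Metric.closedBall (0 : ℝ × ℝ) 4, polyValue landauBase w ^ n)⁻¹ •
      ∫ w in Metric.closedBall (0 : ℝ × ℝ) 4, polyValue landauBase w ^ n • G (z - w) := by
  have hz1 : ‖z‖ ≤ 1 := by
    rw [Prod.norm_def]
    exact max_le (abs_le.2 ⟨hz.1.1.le, hz.1.2.le⟩) (abs_le.2 ⟨hz.2.1.le, hz.2.2.le⟩)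
  rw [landauConv, mollify_eq_swap, smul_eq_mul]
  congr 1
  symm
  have hp (w : ℝ × ℝ) : polyValue (landauBase ^ n) w = polyValue landauBase w ^ n := by
    simp [polyValue]
  simp only [smul_eq_mul, hp]
  rw [setIntegral_eq_integral_of_forall_compl_eq_zero]
  · simp only [mul_comm]
  · intro w hw
    rw [image_eq_zero_of_notMem_tsupport (f := G) (x := z - w), mul_zero]
    intro h
    apply hw
    have h3 := hG h
    rw [mem_closedBall_zero_iff] at h3 ⊢
    calc ‖w‖ = ‖z - (z - w)‖ := by congr 1; abel
      _ ≤ ‖z‖ + ‖z - w‖ := norm_sub_le _ _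
      _ ≤ 4 := by linarith

theorem tendsto_landauConv {G : ℝ × ℝ → ℝ} (hc : Continuous G)
    (hG : tsupport G ⊆ Metric.closedBall 0 3) {z : ℝ × ℝ} (hz : z ∈ openSquare) :
    Tendsto (fun n => landauConv G n z) atTop (𝓝 (G z)) := by
  simp only [landauConv_eq hG _ hz]
  have := tendsto_setIntegral_pow_smul_of_unique_maximum_of_isCompact_of_continuousOn
    (μ := volume) (isCompact_closedBall (0 : ℝ × ℝ) 4)
    (c := polyValue landauBase) (x₀ := 0) (g := fun w => G (z - w))
    (continuous_polyValue _).continuousOn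
    (fun y hy h0 => landauBase_lt hy h0) (fun y hy => landauBase_nonneg hy)
    (by simp [polyValue_landauBase])
    (by
      refine subset_closure ?_
      exact interior_mono (Metric.ball_subset_closedBall) (by
        rw [Metric.isOpen_ball.interior_eq]; simp))
    (by fun_prop)
  simpa using this

theorem abs_landauConv_le {G : ℝ × ℝ → ℝ} {M : ℝ} (hM : ∀ z, |G z| ≤ M)
    (hG : tsupport G ⊆ Metric.closedBall 0 3) (n : ℕ) {z : ℝ × ℝ} (hz : z ∈ openSquare) :
    |landauConv G n z| ≤ M := by
  have hM0 : 0 ≤ M := (abs_nonneg _).trans (hM 0)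
  set S := Metric.closedBall (0 : ℝ × ℝ) 4
  have hS : MeasurableSet S := Metric.isClosed_closedBall.measurableSet
  have hi : IntegrableOn (fun w => polyValue landauBase w ^ n) S :=
    ((continuous_polyValue _).pow n).continuousOn.integrableOn_compact (isCompact_closedBall _ _)
  rw [landauConv_eq hG n hz, smul_eq_mul, abs_mul]
  have h0 : 0 ≤ ∫ w in S, polyValue landauBase w ^ n :=
    setIntegral_nonneg hS fun w hw => pow_nonneg (landauBase_nonneg hw) n
  have h1 : |∫ w in S, polyValue landauBase w ^ n • G (z - w)| ≤
      (∫ w in S, polyValue landauBase w ^ n) * M := by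
    rw [← integral_mul_const]
    rw [← Real.norm_eq_abs]
    refine norm_integral_le_of_norm_le (hi.mul_const M) ?_
    filter_upwards [ae_restrict_mem hS] with w hw
    rw [norm_smul, Real.norm_of_nonneg (pow_nonneg (landauBase_nonneg hw) n)]
    exact mul_le_mul_of_nonneg_left (hM _) (pow_nonneg (landauBase_nonneg hw) n)
  rw [abs_inv, abs_of_nonneg h0]
  rcases h0.eq_or_lt with h | h
  · rw [← h]; simpa using hM0
  · rwa [inv_mul_le_iff₀ h]

/-- A smooth function supported in the square of side `6` is approximated, together with all its
derivatives, by polynomials on the square `(-1,1)²`. -/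
theorem exists_polyValue_tendsto {F : ℝ × ℝ → ℝ} (hF : ContDiff ℝ ∞ F)
    (hs : tsupport F ⊆ Metric.closedBall 0 3) :
    ∃ q : ℕ → MvPolynomial (Fin 2) ℝ, ∀ a b : ℕ, Tendsto (fun n => ∫ z in openSquare,
      (partialX^[a] (partialY^[b] F) z - polyValue (polyDeriv a b (q n)) z) ^ 2) atTop (𝓝 0) := by
  have hFc : HasCompactSupport F := (isCompact_closedBall (0 : ℝ × ℝ) 3).of_isClosed_subset
    (isClosed_tsupport F) hs
  have hF3 : IsTestFunction univ F := ⟨hF, hFc, subset_univ _⟩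
  choose q hq using fun n => exists_polyValue_eq_mollify (landauBase ^ n) hF.continuous hFc
  set c : ℕ → ℝ := fun n => (∫ w in Metric.closedBall (0 : ℝ × ℝ) 4, polyValue landauBase w ^ n)⁻¹
  refine ⟨fun n => c n • q n, fun a b => ?_⟩
  set G := partialX^[a] (partialY^[b] F) with hGdef
  have hGt : IsTestFunction univ G := hF3.iterate a b
  have hGs : tsupport G ⊆ Metric.closedBall 0 3 := by
    have hX (f : ℝ × ℝ → ℝ) : tsupport (partialX f) ⊆ tsupport f :=
      tsupport_fderiv_apply_subset ℝ (1, 0)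
    have hY (f : ℝ × ℝ → ℝ) : tsupport (partialY f) ⊆ tsupport f :=
      tsupport_fderiv_apply_subset ℝ (0, 1)
    refine Subset.trans ?_ hs
    have h1 : tsupport (partialY^[b] F) ⊆ tsupport F := by
      clear * - hY
      induction b with
      | zero => exact Subset.rfl
      | succ b ih => rw [Function.iterate_succ_apply']; exact (hY _).trans ih
    refine Subset.trans ?_ h1
    rw [hGdef]
    clear * - hX
    induction a with
    | zero => exact Subset.rfl
    | succ a ih => rw [Function.iterate_succ_apply']; exact (hX _).trans ih
  have e (n : ℕ) : polyValue (polyDeriv a b (c n • q n)) = landauConv G n := by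
    have h1 : polyDeriv a b (c n • q n) = c n • polyDeriv a b (q n) := by
      simp only [polyDeriv, ← Derivation.coeFn_coe, ← Module.End.pow_apply, map_smul]
    -- All derivatives are put on `F` rather than on the kernel, so one sequence of polynomials
    -- serves every `a` and `b`.
    rw [h1, polyValue_smul, ← partial_iterate_polyValue, hq, mollify_comm]
    ext z
    rw [Pi.smul_apply, smul_eq_mul, partial_iterate_mollify
      (continuous_polyValue _).locallyIntegrable hF3, mollify_comm, landauConv]
  simp only [e]
  obtain ⟨M, hM⟩ := hGt.2.1.exists_bound_of_continuous hGt.1.continuous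
  have hlim : Tendsto (fun n => ∫ z in openSquare, (G z - landauConv G n z) ^ 2) atTop
      (𝓝 (∫ z in openSquare, (0 : ℝ))) := by
    refine tendsto_integral_of_dominated_convergence (fun _ => (2 * M) ^ 2) (fun n => ?_)
      (integrable_const _) (fun n => ?_) ?_
    · rw [← e]
      exact ((hGt.1.continuous.sub (continuous_polyValue _)).pow 2).aestronglyMeasurable
    · filter_upwards [ae_restrict_mem isOpen_openSquare.measurableSet] with z hz
      rw [Real.norm_of_nonneg (sq_nonneg _)]
      have h1 := abs_landauConv_le hM hGs n hz
      have h2 := hM z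
      rw [Real.norm_eq_abs] at h2
      refine sq_le_sq' ?_ ?_
      · linarith [neg_le_of_abs_le h2, le_of_abs_le h1]
      · linarith [neg_le_of_abs_le h1, le_of_abs_le h2]
    · filter_upwards [ae_restrict_mem isOpen_openSquare.measurableSet] with z hz
      have h1 := ((tendsto_const_nhds (x := G z)).sub
        (tendsto_landauConv hGt.1.continuous hGs hz)).pow 2
      simpa using h1
  simpa using hlim

end Landau

/-! ### Density of polynomials in the Sobolev spaces on the square -/

section Density

open Filter Topology

/-- A sequence of mollification radii. -/
noncomputable def mollRadius (j : ℕ) : ℝ := 1 / ((j : ℝ) + 3)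

theorem mollRadius_pos (j : ℕ) : 0 < mollRadius j := by unfold mollRadius; positivity

theorem mollRadius_le (j : ℕ) : mollRadius j ≤ 1 / 3 := by
  unfold mollRadius
  gcongr
  have : (0 : ℝ) ≤ j := Nat.cast_nonneg j
  linarith

theorem tendsto_mollRadius : Tendsto mollRadius atTop (𝓝 0) := by
  have : Tendsto (fun j : ℕ => (j : ℝ) + 3) atTop atTop :=
    tendsto_atTop_add_const_right _ _ tendsto_natCast_atTop_atTop
  refine this.inv_tendsto_atTop.congr fun j => ?_
  simp [mollRadius]

/-- The bump function of radius `mollRadius j`. -/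
noncomputable def mollBump (j : ℕ) : ContDiffBump (0 : ℝ × ℝ) where
  rIn := mollRadius j / 2
  rOut := mollRadius j
  rIn_pos := half_pos (mollRadius_pos j)
  rIn_lt_rOut := half_lt_self (mollRadius_pos j)

/-- The normalized mollifier of radius `mollRadius j`. -/
noncomputable def mollKernel (j : ℕ) : ℝ × ℝ → ℝ := (mollBump j).normed volume

theorem mollKernel_nonneg (j : ℕ) (t : ℝ × ℝ) : 0 ≤ mollKernel j t := (mollBump j).nonneg_normed t

theorem integral_mollKernel (j : ℕ) : ∫ t, mollKernel j t = 1 := (mollBump j).integral_normed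

theorem mollKernel_hasCompactSupport (j : ℕ) : HasCompactSupport (mollKernel j) :=
  (mollBump j).hasCompactSupport_normed

theorem mollKernel_contDiff (j : ℕ) : ContDiff ℝ ∞ (mollKernel j) := (mollBump j).contDiff_normed

theorem tsupport_mollKernel (j : ℕ) :
    tsupport (mollKernel j) = Metric.closedBall 0 (mollRadius j) :=
  (mollBump j).tsupport_normed_eq

/-- Contraction towards the origin followed by mollification. -/
noncomputable def smoothing (f : ℝ × ℝ → ℝ) (j : ℕ) (z : ℝ × ℝ) : ℝ :=
  mollify f (mollKernel j) ((1 - mollRadius j) • z)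

theorem contDiff_smoothing {f : ℝ × ℝ → ℝ} (hf : LocallyIntegrable f) (j : ℕ) :
    ContDiff ℝ ∞ (smoothing f j) :=
  (contDiff_mollify hf (mollKernel_contDiff j) (mollKernel_hasCompactSupport j)).comp
    (contDiff_const_smul _)

/-- Mollification does not increase the norm; undoing the contraction in the plane costs `(1 -
mollRadius j)⁻²`, at most `9/4`. -/
theorem integral_sq_smoothing_le {f : ℝ × ℝ → ℝ} (hf : MemLp f 2) (j : ℕ) :
    ∫ z in openSquare, smoothing f j z ^ 2 ≤ 4 * ∫ z, f z ^ 2 := by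
  obtain ⟨h1, h2⟩ := integral_sq_mollify_le hf (mollKernel_contDiff j).continuous
    (mollKernel_hasCompactSupport j) (mollKernel_nonneg j) (integral_mollKernel j)
  have hc : 2 / 3 ≤ 1 - mollRadius j := by linarith [mollRadius_le j]
  have hc0 : 1 - mollRadius j ≠ 0 := by linarith
  have h3 : Integrable (fun z => smoothing f j z ^ 2) := h1.comp_smul hc0
  have h4 : ∫ z, smoothing f j z ^ 2 =
      |((1 - mollRadius j) ^ 2)⁻¹| * ∫ z, mollify f (mollKernel j) z ^ 2 := by
    have := Measure.integral_comp_smul (volume : Measure (ℝ × ℝ))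
      (fun z => mollify f (mollKernel j) z ^ 2) (1 - mollRadius j)
    simpa [smoothing] using this
  have h5 : |((1 - mollRadius j) ^ 2)⁻¹| ≤ 4 := by
    rw [abs_of_nonneg (by positivity)]
    rw [inv_le_comm₀ (by positivity) (by norm_num)]
    nlinarith
  have h6 : 0 ≤ ∫ z, mollify f (mollKernel j) z ^ 2 := integral_nonneg fun _ => sq_nonneg _
  calc ∫ z in openSquare, smoothing f j z ^ 2 ≤ ∫ z, smoothing f j z ^ 2 :=
        setIntegral_le_integral h3 (.of_forall fun _ => sq_nonneg _)
    _ ≤ 4 * ∫ z, mollify f (mollKernel j) z ^ 2 := by rw [h4]; gcongr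
    _ ≤ _ := by gcongr

/-- The factor with exponent `m` is the one that the chain rule produces for derivatives of order
`m` of a contracted function. The proof is dominated convergence. -/
theorem tendsto_smoothing_of_continuous {g : ℝ × ℝ → ℝ} (hg : Continuous g)
    (hc : HasCompactSupport g) (m : ℕ) :
    Tendsto (fun j => ∫ z in openSquare, ((1 - mollRadius j) ^ m * smoothing g j z - g z) ^ 2)
      atTop (𝓝 0) := by
  obtain ⟨M, hM⟩ := hc.exists_bound_of_continuous hg
  have hcj : Tendsto (fun j => 1 - mollRadius j) atTop (𝓝 1) := by
    simpa using tendsto_mollRadius.const_sub 1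
  have hlim : Tendsto (fun j => ∫ z in openSquare,
      ((1 - mollRadius j) ^ m * smoothing g j z - g z) ^ 2) atTop
      (𝓝 (∫ z in openSquare, (0 : ℝ))) := by
    refine tendsto_integral_of_dominated_convergence (fun _ => (2 * M) ^ 2) (fun j => ?_)
      (integrable_const _) (fun j => .of_forall fun z => ?_) (.of_forall fun z => ?_)
    · exact (((continuous_const.mul (contDiff_smoothing hg.locallyIntegrable j).continuous).sub
        hg).pow 2).aestronglyMeasurable
    · rw [Real.norm_of_nonneg (sq_nonneg _)]
      have h1 := abs_mollify_le hM (mollKernel_contDiff j).continuous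
        (mollKernel_hasCompactSupport j) (mollKernel_nonneg j) (integral_mollKernel j)
        ((1 - mollRadius j) • z)
      have h2 := hM z
      rw [Real.norm_eq_abs] at h2
      have h3 : |(1 - mollRadius j) ^ m * smoothing g j z| ≤ M := by
        have h4 : |(1 - mollRadius j) ^ m| ≤ 1 := by
          rw [abs_pow]
          refine pow_le_one₀ (abs_nonneg _) ?_
          rw [abs_le]
          constructor <;> linarith [mollRadius_pos j, mollRadius_le j]
        rw [abs_mul]
        calc _ ≤ 1 * |smoothing g j z| := by gcongr
          _ ≤ M := by rw [one_mul]; exact h1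
      refine sq_le_sq' ?_ ?_
      · linarith [neg_le_of_abs_le h3, le_of_abs_le h2]
      · linarith [neg_le_of_abs_le h2, le_of_abs_le h3]
    · have h1 : Tendsto (fun j => smoothing g j z) atTop (𝓝 (g z)) := by
        have := ContDiffBump.convolution_tendsto_right (μ := volume) (φ := mollBump)
          (g := fun _ => g) (k := fun j => (1 - mollRadius j) • z) (x₀ := z) (z₀ := g z)
          tendsto_mollRadius (.of_forall fun _ => hg.aestronglyMeasurable)
          ((hg.tendsto z).comp tendsto_snd) (by simpa using hcj.smul_const z)
        simpa only [smoothing, mollify_comm g] using! this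
      have h2 := (((hcj.pow m).mul h1).sub_const (g z)).pow 2
      simpa using h2
  simpa using hlim

theorem tendsto_smoothing {f : ℝ × ℝ → ℝ} (hf : MemLp f 2) (m : ℕ) :
    Tendsto (fun j => ∫ z in openSquare, ((1 - mollRadius j) ^ m * smoothing f j z - f z) ^ 2)
      atTop (𝓝 0) := by
  rw [Metric.tendsto_atTop]
  intro ε hε
  -- The total error is at most `2·4·ε/40 + 4·ε/8 + 4·ε/40`, which is less than `ε`.
  obtain ⟨g, hgc, hg1, hg, hg2⟩ := MemLp.exists_hasCompactSupport_integral_rpow_sub_le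
    (p := 2) two_pos (by simpa using hf) (ε := ε / 40) (by positivity)
  simp only [Real.rpow_two, Real.norm_eq_abs, sq_abs] at hg1
  have hg2' : MemLp g 2 := by simpa using hg2
  obtain ⟨N, hN⟩ := (Metric.tendsto_atTop.1 (tendsto_smoothing_of_continuous hg hgc m)) (ε / 8)
    (by positivity)
  refine ⟨N, fun j hj => ?_⟩
  have h1 := hN j hj
  rw [Real.dist_eq, sub_zero, abs_of_nonneg (integral_nonneg fun _ => sq_nonneg _)] at h1 ⊢
  have hfl : LocallyIntegrable f := hf.locallyIntegrable (by norm_num)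
  have hfg : MemLp (f - g) 2 := hf.sub hg2'
  have hsub : smoothing (f - g) j = smoothing f j - smoothing g j := by
    ext z
    have i1 : Integrable fun t => f t * mollKernel j ((1 - mollRadius j) • z - t) :=
      (mollKernel_hasCompactSupport j).convolutionExists_right (ContinuousLinearMap.lsmul ℝ ℝ) hfl
        (mollKernel_contDiff j).continuous _
    have i2 : Integrable fun t => g t * mollKernel j ((1 - mollRadius j) • z - t) :=
      (mollKernel_hasCompactSupport j).convolutionExists_right (ContinuousLinearMap.lsmul ℝ ℝ)
        hg.locallyIntegrable (mollKernel_contDiff j).continuous _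
    simp only [smoothing, mollify, Pi.sub_apply, sub_mul]
    exact integral_sub i1 i2
  set c := (1 - mollRadius j) ^ m
  have hsc (f : ℝ × ℝ → ℝ) (hf : LocallyIntegrable f) :
      MemLp (fun z => c * smoothing f j z) 2 (volume.restrict openSquare) :=
    (continuous_const.mul (contDiff_smoothing hf j).continuous).memLp_openSquare
  have m1 := hsc f hfl
  have m2 := hsc g hg.locallyIntegrable
  have m3 := hf.restrict openSquare
  have m4 := hg2'.restrict openSquare
  have t1 := integral_sq_sub_le m1 m2 m3
  have t2 := integral_sq_sub_le m2 m4 m3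
  have hc1 : c ^ 2 ≤ 1 := by
    have h0 : 0 ≤ 1 - mollRadius j := by linarith [mollRadius_le j]
    have h01 : c ≤ 1 := pow_le_one₀ h0 (by linarith [mollRadius_pos j])
    exact pow_le_one₀ (pow_nonneg h0 _) h01
  have t3 : ∫ z in openSquare, (c * smoothing f j z - c * smoothing g j z) ^ 2 ≤
      4 * (ε / 40) := by
    have e : ∀ z, (c * smoothing f j z - c * smoothing g j z) ^ 2 =
        c ^ 2 * smoothing (f - g) j z ^ 2 := fun z => by
      rw [hsub, Pi.sub_apply]; ring
    simp only [e, integral_const_mul]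
    have h5 := integral_sq_smoothing_le hfg j
    simp only [Pi.sub_apply] at h5
    have h6 : 0 ≤ ∫ z in openSquare, smoothing (f - g) j z ^ 2 :=
      integral_nonneg fun _ => sq_nonneg _
    calc _ ≤ 1 * ∫ z in openSquare, smoothing (f - g) j z ^ 2 := by gcongr
      _ ≤ _ := by linarith
  have t4 : ∫ z in openSquare, (g z - f z) ^ 2 ≤ ε / 40 := by
    refine le_trans ?_ hg1
    have e : ∀ z, (g z - f z) ^ 2 = (f z - g z) ^ 2 := fun z => by ring
    simp only [e]
    exact setIntegral_le_integral hfg.integrable_sq (.of_forall fun _ => sq_nonneg _)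
  linarith

/-- The contracted point `(1 - r) • z` has distance more than `r` from the boundary, so a mollifier
of radius `r` sees only the square. The jump of the extension by zero therefore never enters. -/
theorem smoothing_hasWeakDeriv {a b : ℕ} {u v : ℝ × ℝ → ℝ}
    (hu : IntegrableOn u openSquare) (h : HasWeakDeriv a b openSquare u v) (j : ℕ) {z : ℝ × ℝ}
    (hz : z ∈ openSquare) :
    partialX^[a] (partialY^[b] (smoothing (openSquare.indicator u) j)) z =
      (1 - mollRadius j) ^ (a + b) * smoothing (openSquare.indicator v) j z := by
  have hu' : LocallyIntegrable (openSquare.indicator u) :=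
    ((integrable_indicator_iff isOpen_openSquare.measurableSet).2 hu).locallyIntegrable
  have ht : IsTestFunction univ (mollKernel j) :=
    ⟨mollKernel_contDiff j, mollKernel_hasCompactSupport j, subset_univ _⟩
  have e := partial_iterate_comp_affine
    (contDiff_mollify hu' (mollKernel_contDiff j) (mollKernel_hasCompactSupport j)) 0
    (1 - mollRadius j) a b
  simp only [zero_add] at e
  change partialX^[a] (partialY^[b] fun z => mollify _ _ ((1 - mollRadius j) • z)) z = _
  rw [e, partial_iterate_mollify hu' ht]
  dsimp only
  rw [h.mollify_eq isOpen_openSquare.measurableSet ht]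
  · rfl
  · intro t htz
    rw [tsupport_mollKernel, mem_closedBall_zero_iff] at htz
    have h0 := mollRadius_pos j
    have h1 := mollRadius_le j
    have h2 := abs_le.1 ((norm_fst_le _).trans htz)
    have h3 := abs_le.1 ((norm_snd_le _).trans htz)
    simp only [Prod.fst_sub, Prod.snd_sub, Prod.smul_fst, Prod.smul_snd, smul_eq_mul] at h2 h3
    obtain ⟨⟨a1, a2⟩, a3, a4⟩ := hz
    refine ⟨⟨?_, ?_⟩, ?_, ?_⟩ <;> nlinarith

/-- On the support, `(1 - r)‖z‖ ≤ 1 + r` with `r ≤ 1/3`, so even `‖z‖ ≤ 2`; radius 3 is what the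
Landau approximation accepts. -/
theorem tsupport_smoothing (u : ℝ × ℝ → ℝ) (j : ℕ) :
    tsupport (smoothing (openSquare.indicator u) j) ⊆ Metric.closedBall 0 3 := by
  refine closure_minimal (fun z hz => ?_) Metric.isClosed_closedBall
  have h1 : ∃ t, openSquare.indicator u t * mollKernel j ((1 - mollRadius j) • z - t) ≠ 0 := by
    by_contra! h
    exact hz (by simp [smoothing, mollify, h])
  obtain ⟨t, ht⟩ := h1
  have ht1 : t ∈ openSquare := by
    by_contra h
    exact ht (by rw [indicator_of_notMem h, zero_mul])
  have ht2 : (1 - mollRadius j) • z - t ∈ Metric.closedBall (0 : ℝ × ℝ) (mollRadius j) := by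
    rw [← tsupport_mollKernel]
    exact subset_tsupport _ (right_ne_zero_of_mul ht)
  rw [mem_closedBall_zero_iff] at ht2 ⊢
  have ht3 : ‖t‖ ≤ 1 := by
    rw [Prod.norm_def]
    exact max_le (abs_le.2 ⟨ht1.1.1.le, ht1.1.2.le⟩) (abs_le.2 ⟨ht1.2.1.le, ht1.2.2.le⟩)
  have h2 := mollRadius_le j
  have h3 := mollRadius_pos j
  have h4 : ‖(1 - mollRadius j) • z‖ = (1 - mollRadius j) * ‖z‖ := by
    rw [norm_smul, Real.norm_of_nonneg (by linarith)]
  have h5 : ‖(1 - mollRadius j) • z‖ ≤ ‖(1 - mollRadius j) • z - t‖ + ‖t‖ := by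
    simpa using norm_add_le ((1 - mollRadius j) • z - t) t
  nlinarith [norm_nonneg z]

/-- Polynomials are dense in the Sobolev spaces on the square. -/
theorem exists_polyValue_close {m : ℕ} {u : ℝ × ℝ → ℝ}
    (hu : IntegrableOn u openSquare) (v : ℕ → ℕ → ℝ × ℝ → ℝ)
    (hv : ∀ a b, a + b ≤ m → HasWeakDeriv a b openSquare u (v a b) ∧
      MemLp (v a b) 2 (volume.restrict openSquare)) {ε : ℝ} (hε : 0 < ε) :
    ∃ q : MvPolynomial (Fin 2) ℝ, ∀ a b, a + b ≤ m →
      ∫ z in openSquare, (v a b z - polyValue (polyDeriv a b q) z) ^ 2 < ε := by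
  have hind (a b : ℕ) (hab : a + b ≤ m) : MemLp (openSquare.indicator (v a b)) 2 :=
    (memLp_indicator_iff_restrict isOpen_openSquare.measurableSet).2 (hv a b hab).2
  have hu' : LocallyIntegrable (openSquare.indicator u) :=
    ((integrable_indicator_iff isOpen_openSquare.measurableSet).2 hu).locallyIntegrable
  let I := Finset.range (m + 1) ×ˢ Finset.range (m + 1)
  have hI (a b : ℕ) (hab : a + b ≤ m) : (a, b) ∈ I := by
    simp only [I, Finset.mem_product, Finset.mem_range]; omega
  -- Only finitely many derivatives matter, so one `j`, and then one `n`, serves them all. Two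
  -- errors `ε / 4`, doubled by the squared triangle inequality, add up to `ε`.
  have h1 : ∀ᶠ j in atTop, ∀ ab ∈ I, ab.1 + ab.2 ≤ m →
      ∫ z in openSquare, ((1 - mollRadius j) ^ (ab.1 + ab.2) *
        smoothing (openSquare.indicator (v ab.1 ab.2)) j z -
          openSquare.indicator (v ab.1 ab.2) z) ^ 2 < ε / 4 := by
    refine (Finset.eventually_all I).2 fun ab _ => ?_
    by_cases hab : ab.1 + ab.2 ≤ m
    · exact ((tendsto_smoothing (hind _ _ hab) _).eventually_lt_const (by positivity)).mono
        fun j hj _ => hj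
    · exact .of_forall fun j h => absurd h hab
  obtain ⟨j, hj⟩ := h1.exists
  obtain ⟨q, hq⟩ := exists_polyValue_tendsto (contDiff_smoothing hu' j) (tsupport_smoothing u j)
  have h2 : ∀ᶠ n in atTop, ∀ ab ∈ I,
      ∫ z in openSquare, (partialX^[ab.1] (partialY^[ab.2]
        (smoothing (openSquare.indicator u) j)) z -
          polyValue (polyDeriv ab.1 ab.2 (q n)) z) ^ 2 < ε / 4 :=
    (Finset.eventually_all I).2 fun ab _ => (hq ab.1 ab.2).eventually_lt_const (by positivity)
  obtain ⟨n, hn⟩ := h2.exists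
  refine ⟨q n, fun a b hab => ?_⟩
  have h3 := hj (a, b) (hI a b hab) hab
  have h4 := hn (a, b) (hI a b hab)
  set F := partialX^[a] (partialY^[b] (smoothing (openSquare.indicator u) j)) with hF
  have hFt : IsTestFunction univ F := IsTestFunction.iterate ⟨contDiff_smoothing hu' j,
    (isCompact_closedBall (0 : ℝ × ℝ) 3).of_isClosed_subset (isClosed_tsupport _)
      (tsupport_smoothing u j), subset_univ _⟩ a b
  have h5 := integral_sq_sub_le (hv a b hab).2 hFt.1.continuous.memLp_openSquare
    (continuous_polyValue (polyDeriv a b (q n))).memLp_openSquare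
  have h6 : ∫ z in openSquare, (v a b z - F z) ^ 2 < ε / 4 := by
    refine lt_of_eq_of_lt (setIntegral_congr_fun isOpen_openSquare.measurableSet fun z hz => ?_) h3
    simp only [indicator_of_mem hz, hF, smoothing_hasWeakDeriv hu (hv a b hab).1 j hz]
    ring
  linarith

end Density

/-! ### Sobolev functions on the square -/

section SobolevSquare

open Filter Topology

theorem Sobolev.hasWeakDeriv {m a b : ℕ} (hab : a + b ≤ m)
    {u : Lp ℝ 2 (volume.restrict openSquare)} (hu : u ∈ Sobolev m openSquare) :
    HasWeakDeriv a b openSquare u (weakDeriv a b openSquare u) := by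
  obtain ⟨v, hv, -⟩ := hu a b hab
  have h' : ∃ v, HasWeakDeriv a b openSquare u v := ⟨v, hv⟩
  have : weakDeriv a b openSquare u = h'.choose := by simp [weakDeriv, h']
  rw [this]
  exact h'.choose_spec

theorem Sobolev.memLp_weakDeriv {m a b : ℕ} (hab : a + b ≤ m)
    {u : Lp ℝ 2 (volume.restrict openSquare)} (hu : u ∈ Sobolev m openSquare) :
    MemLp (weakDeriv a b openSquare u) 2 (volume.restrict openSquare) := by
  obtain ⟨v, hv, hm⟩ := hu a b hab
  exact hm.ae_eq (weakDeriv_ae_eq isOpen_openSquare hv).symm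

/-- The weak derivative `∂₁ᵃ ∂₂ᵇ` as a linear map from `H²` to `L²`. -/
noncomputable def sobolevDeriv (a b : ℕ) (hab : a + b ≤ 2) :
    Sobolev 2 openSquare →ₗ[ℝ] Lp ℝ 2 (volume.restrict openSquare) where
  toFun u := (Sobolev.memLp_weakDeriv hab u.2).toLp _
  map_add' u w := by
    rw [← MemLp.toLp_add, MemLp.toLp_eq_toLp_iff]
    refine weakDeriv_ae_eq isOpen_openSquare (HasWeakDeriv.congr
      ((Sobolev.hasWeakDeriv hab u.2).add (Sobolev.hasWeakDeriv hab w.2))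
      (locallyIntegrableOn_of_Lp _) (Lp.coeFn_add _ _))
  map_smul' c u := by
    rw [RingHom.id_apply, ← MemLp.toLp_const_smul, MemLp.toLp_eq_toLp_iff]
    refine weakDeriv_ae_eq isOpen_openSquare (HasWeakDeriv.congr
      ((Sobolev.hasWeakDeriv hab u.2).smul c) (locallyIntegrableOn_of_Lp _) (Lp.coeFn_smul _ _))

theorem sobolevDeriv_ae_eq {a b : ℕ} (hab : a + b ≤ 2) (u : Sobolev 2 openSquare) :
    sobolevDeriv a b hab u =ᵐ[volume.restrict openSquare]
      weakDeriv a b openSquare (u : Lp ℝ 2 (volume.restrict openSquare)) :=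
  MemLp.coeFn_toLp (Sobolev.memLp_weakDeriv hab u.2)

/-- A polynomial as an element of `H²`. -/
noncomputable def polyToSobolev : MvPolynomial (Fin 2) ℝ →ₗ[ℝ] Sobolev 2 openSquare where
  toFun q := ⟨(continuous_polyValue q).memLp_openSquare.toLp _, fun a b _ =>
    ⟨polyValue (polyDeriv a b q), (polyValue_hasWeakDeriv a b q).congr
      (locallyIntegrableOn_of_Lp _) (MemLp.coeFn_toLp (continuous_polyValue q).memLp_openSquare),
      (continuous_polyValue _).memLp_openSquare⟩⟩
  map_add' p q := by
    refine Subtype.ext ?_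
    exact (MemLp.toLp_eq_toLp_iff (continuous_polyValue _).memLp_openSquare ((continuous_polyValue p).memLp_openSquare.add
      (continuous_polyValue q).memLp_openSquare)).2 (.of_eq (polyValue_add p q))
  map_smul' c q := by
    refine Subtype.ext ?_
    exact (MemLp.toLp_eq_toLp_iff (continuous_polyValue _).memLp_openSquare ((continuous_polyValue q).memLp_openSquare.const_smul c)).2
      (.of_eq (polyValue_smul c q))

theorem polyToSobolev_ae_eq (q : MvPolynomial (Fin 2) ℝ) :
    (polyToSobolev q : Lp ℝ 2 (volume.restrict openSquare)) =ᵐ[volume.restrict openSquare]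
      polyValue q := MemLp.coeFn_toLp (continuous_polyValue q).memLp_openSquare

theorem weakDeriv_polyToSobolev (a b : ℕ) (q : MvPolynomial (Fin 2) ℝ) :
    weakDeriv a b openSquare (polyToSobolev q : Lp ℝ 2 (volume.restrict openSquare))
      =ᵐ[volume.restrict openSquare] polyValue (polyDeriv a b q) :=
  weakDeriv_ae_eq isOpen_openSquare ((polyValue_hasWeakDeriv a b q).congr
      (locallyIntegrableOn_of_Lp _) (polyToSobolev_ae_eq q))

theorem polySpace_eq_map (p : ℕ) :
    polySpace p = (MvPolynomial.restrictTotalDegree (Fin 2) ℝ p).map polyToSobolev := by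
  ext u
  constructor
  · rintro ⟨q, hq, e⟩
    refine ⟨q, (MvPolynomial.mem_restrictTotalDegree _ _ _).2 hq, ?_⟩
    ext1
    exact Lp.ext ((polyToSobolev_ae_eq q).trans e.symm)
  · rintro ⟨q, hq, rfl⟩
    exact ⟨q, (MvPolynomial.mem_restrictTotalDegree _ _ _).1 hq, polyToSobolev_ae_eq q⟩

instance finiteDimensional_polySpace (p : ℕ) : FiniteDimensional ℝ (polySpace p) := by
  rw [polySpace_eq_map]; infer_instance

/-- The sum of the squared `L²` distances of the derivatives of `u` and `q` that occur in the
Sobolev inequality. -/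
noncomputable def sobolevGap (u : Sobolev 2 openSquare) (q : MvPolynomial (Fin 2) ℝ) : ℝ :=
  ∑ a ∈ Finset.range 2, ∑ b ∈ Finset.range 2, ∫ z in openSquare,
    (weakDeriv a b openSquare (u : Lp ℝ 2 (volume.restrict openSquare)) z -
      polyValue (polyDeriv a b q) z) ^ 2

theorem sobolevGap_nonneg (u : Sobolev 2 openSquare) (q : MvPolynomial (Fin 2) ℝ) :
    0 ≤ sobolevGap u q :=
  Finset.sum_nonneg fun _ _ => Finset.sum_nonneg fun _ _ => integral_nonneg fun _ => sq_nonneg _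

theorem polyDeriv_sub (a b : ℕ) (p q : MvPolynomial (Fin 2) ℝ) :
    polyDeriv a b (p - q) = polyDeriv a b p - polyDeriv a b q := by
  simp only [polyDeriv, ← Derivation.coeFn_coe, ← Module.End.pow_apply, map_sub]

/-- Two polynomials close to the same `u` are uniformly close to each other, so convergence in the
Sobolev sense becomes uniform convergence. -/
theorem sq_polyValue_sub_le (u : Sobolev 2 openSquare) (p q : MvPolynomial (Fin 2) ℝ)
    {z : ℝ × ℝ} (hz : z ∈ closedSquare) :
    (polyValue p z - polyValue q z) ^ 2 ≤ 8 * (sobolevGap u p + sobolevGap u q) := by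
  have h1 := polyValue_sq_le (p - q) hz
  rw [polyValue_sub, Pi.sub_apply] at h1
  have h2 (a b : ℕ) (hab : a + b ≤ 2) : sqNorm (polyDeriv a b (p - q)) ≤
      2 * (∫ z in openSquare, (weakDeriv a b openSquare
        (u : Lp ℝ 2 (volume.restrict openSquare)) z - polyValue (polyDeriv a b p) z) ^ 2) +
      2 * (∫ z in openSquare, (weakDeriv a b openSquare
        (u : Lp ℝ 2 (volume.restrict openSquare)) z - polyValue (polyDeriv a b q) z) ^ 2) := by
    have h3 := integral_sq_sub_le (continuous_polyValue (polyDeriv a b p)).memLp_openSquare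
      (Sobolev.memLp_weakDeriv hab u.2)
      (continuous_polyValue (polyDeriv a b q)).memLp_openSquare
    rw [polyDeriv_sub, sqNorm, polyValue_sub]
    refine h3.trans_eq ?_
    congr 2
    exact integral_congr_ae (.of_forall fun z => by dsimp only; ring)
  have a1 := h2 0 0 (by norm_num)
  have a2 := h2 1 0 (by norm_num)
  have a3 := h2 0 1 (by norm_num)
  have a4 := h2 1 1 (by norm_num)
  rw [show polyDeriv 0 0 (p - q) = p - q from rfl] at a1
  simp only [sobolevGap, Finset.sum_range_succ, Finset.sum_range_zero, zero_add]
  linarith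

theorem hasWeakDeriv_zero_zero (u : Lp ℝ 2 (volume.restrict openSquare)) :
    HasWeakDeriv 0 0 openSquare u u :=
  ⟨locallyIntegrableOn_of_Lp u, locallyIntegrableOn_of_Lp u, fun φ _ => by simp⟩

theorem integrableOn_coe_Lp (u : Lp ℝ 2 (volume.restrict openSquare)) :
    IntegrableOn u openSquare := (Lp.memLp u).integrable (by norm_num)

theorem exists_poly_close_of_mem_Sobolev {m : ℕ} {u : Lp ℝ 2 (volume.restrict openSquare)}
    (hu : u ∈ Sobolev m openSquare) {ε : ℝ} (hε : 0 < ε) :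
    ∃ q : MvPolynomial (Fin 2) ℝ, ∀ a b, a + b ≤ m → ∫ z in openSquare,
      (weakDeriv a b openSquare u z - polyValue (polyDeriv a b q) z) ^ 2 < ε :=
  exists_polyValue_close (integrableOn_coe_Lp u) (fun a b => weakDeriv a b openSquare u)
    (fun _ _ hab => ⟨Sobolev.hasWeakDeriv hab hu, Sobolev.memLp_weakDeriv hab hu⟩) hε

theorem sobolevGap_lt {u : Sobolev 2 openSquare} {q : MvPolynomial (Fin 2) ℝ} {ε : ℝ}
    (h : ∀ a b, a + b ≤ 2 → ∫ z in openSquare,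
      (weakDeriv a b openSquare (u : Lp ℝ 2 (volume.restrict openSquare)) z -
        polyValue (polyDeriv a b q) z) ^ 2 < ε) : sobolevGap u q < 4 * ε := by
  have a1 := h 0 0 (by norm_num)
  have a2 := h 1 0 (by norm_num)
  have a3 := h 0 1 (by norm_num)
  have a4 := h 1 1 (by norm_num)
  simp only [sobolevGap, Finset.sum_range_succ, Finset.sum_range_zero, zero_add]
  linarith

/-- Functions in `H²` have a representative that is continuous on the closed square. -/
theorem exists_continuous_representative (u : Sobolev 2 openSquare) :
    ∃ f : ℝ × ℝ → ℝ, ContinuousOn f closedSquare ∧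
      (u : Lp ℝ 2 (volume.restrict openSquare)) =ᵐ[volume.restrict openSquare] f ∧
      ∀ q : MvPolynomial (Fin 2) ℝ, ∀ z ∈ closedSquare,
        (f z - polyValue q z) ^ 2 ≤ 8 * sobolevGap u q := by
  choose q hq using fun n : ℕ => exists_poly_close_of_mem_Sobolev u.2
    (ε := 1 / ((n : ℝ) + 1)) (by positivity)
  have hgap : Tendsto (fun n => sobolevGap u (q n)) atTop (𝓝 0) := by
    refine squeeze_zero (fun n => sobolevGap_nonneg u (q n)) (fun n => (sobolevGap_lt (hq n)).le) ?_
    simpa using tendsto_one_div_add_atTop_nhds_zero_nat.const_mul (4 : ℝ)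
  have hcauchy (z : ℝ × ℝ) (hz : z ∈ closedSquare) : CauchySeq fun n => polyValue (q n) z := by
    rw [Metric.cauchySeq_iff]
    intro ε hε
    obtain ⟨N, hN⟩ := eventually_atTop.1 (hgap.eventually_lt_const (show 0 < ε ^ 2 / 16 by positivity))
    refine ⟨N, fun m hm n hn => ?_⟩
    rw [Real.dist_eq]
    refine abs_lt_of_sq_lt_sq ?_ hε.le
    have := sq_polyValue_sub_le u (q m) (q n) hz
    linarith [hN m hm, hN n hn]
  choose! f hf using fun z hz => cauchySeq_tendsto_of_complete (hcauchy z hz)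
  -- The comparison of two polynomials passes to the limit in one of them; the result gives both
  -- uniform convergence and the quantitative bound for `f`.
  have hest (p : MvPolynomial (Fin 2) ℝ) (z : ℝ × ℝ) (hz : z ∈ closedSquare) :
      (f z - polyValue p z) ^ 2 ≤ 8 * sobolevGap u p := by
    have h1 := ((hf z hz).sub_const (polyValue p z)).pow 2
    have h2 := (hgap.add_const (sobolevGap u p)).const_mul 8
    rw [zero_add] at h2
    exact le_of_tendsto_of_tendsto' h1 h2 fun n => sq_polyValue_sub_le u (q n) p hz
  have hunif : TendstoUniformlyOn (fun n => polyValue (q n)) f atTop closedSquare := by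
    rw [Metric.tendstoUniformlyOn_iff]
    intro ε hε
    filter_upwards [hgap.eventually_lt_const (show 0 < ε ^ 2 / 8 by positivity)] with n hn z hz
    rw [Real.dist_eq]
    refine abs_lt_of_sq_lt_sq ?_ hε.le
    linarith [hest (q n) z hz]
  have hcont : ContinuousOn f closedSquare :=
    hunif.continuousOn (.of_forall fun n => (continuous_polyValue (q n)).continuousOn)
  refine ⟨f, hcont, ?_, hest⟩
  have hfm : MemLp f 2 (volume.restrict openSquare) := by
    have h1 : IntegrableOn (fun z => f z ^ 2) openSquare :=
      ((hcont.pow 2).integrableOn_compact isCompact_closedSquare).mono_set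
        openSquare_subset_closedSquare
    exact (memLp_two_iff_integrable_sq ((hcont.mono
      openSquare_subset_closedSquare).aestronglyMeasurable isOpen_openSquare.measurableSet)).2 h1
  have hum := Lp.memLp (u : Lp ℝ 2 (volume.restrict openSquare))
  -- The final factor 4 is the area of the square; letting `n` grow shows that `u` and `f` agree
  -- almost everywhere.
  have hbound (n : ℕ) : ∫ z in openSquare,
      ((u : Lp ℝ 2 (volume.restrict openSquare)) z - f z) ^ 2 ≤
      2 * sobolevGap u (q n) + 2 * (8 * sobolevGap u (q n) * 4) := by
    refine (integral_sq_sub_le hum (continuous_polyValue (q n)).memLp_openSquare hfm).trans ?_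
    have h1 : ∫ z in openSquare, ((u : Lp ℝ 2 (volume.restrict openSquare)) z -
        polyValue (q n) z) ^ 2 ≤ sobolevGap u (q n) := by
      have e : ∫ z in openSquare, ((u : Lp ℝ 2 (volume.restrict openSquare)) z -
          polyValue (q n) z) ^ 2 = ∫ z in openSquare,
          (weakDeriv 0 0 openSquare (u : Lp ℝ 2 (volume.restrict openSquare)) z -
            polyValue (polyDeriv 0 0 (q n)) z) ^ 2 := by
        refine integral_congr_ae ?_
        filter_upwards [weakDeriv_ae_eq isOpen_openSquare (hasWeakDeriv_zero_zero
          (u : Lp ℝ 2 (volume.restrict openSquare)))] with z hz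
        rw [hz]; rfl
      rw [e]
      have hnn (a b : ℕ) : 0 ≤ ∫ z in openSquare,
          (weakDeriv a b openSquare (u : Lp ℝ 2 (volume.restrict openSquare)) z -
            polyValue (polyDeriv a b (q n)) z) ^ 2 := integral_nonneg fun _ => sq_nonneg _
      simp only [sobolevGap, Finset.sum_range_succ, Finset.sum_range_zero, zero_add]
      linarith [hnn 0 1, hnn 1 0, hnn 1 1]
    have h2 : ∫ z in openSquare, (polyValue (q n) z - f z) ^ 2 ≤ 8 * sobolevGap u (q n) * 4 := by
      have h3 : ∫ z in openSquare, (polyValue (q n) z - f z) ^ 2 ≤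
          ∫ z in openSquare, 8 * sobolevGap u (q n) := by
        refine setIntegral_mono_on (((continuous_polyValue (q n)).memLp_openSquare.sub
          hfm).integrable_sq) (integrable_const _) isOpen_openSquare.measurableSet fun z hz => ?_
        have := hest (q n) z (openSquare_subset_closedSquare hz)
        nlinarith
      refine h3.trans_eq ?_
      have hv : (volume : Measure (ℝ × ℝ)).real openSquare = 4 := by
        rw [openSquare, Measure.volume_eq_prod, measureReal_prod_prod]
        norm_num [Real.volume_real_Ioo]
      rw [setIntegral_const, hv, smul_eq_mul, mul_comm]
    linarith
  have hzero : ∫ z in openSquare, ((u : Lp ℝ 2 (volume.restrict openSquare)) z - f z) ^ 2 ≤ 0 := by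
    have h1 : Tendsto (fun n => 2 * sobolevGap u (q n) + 2 * (8 * sobolevGap u (q n) * 4)) atTop
        (𝓝 0) := by
      have := (hgap.const_mul 2).add (((hgap.const_mul 8).mul_const 4).const_mul 2)
      simpa using this
    exact ge_of_tendsto' h1 hbound
  have h0 := (integral_eq_zero_iff_of_nonneg (fun z => sq_nonneg _) (hum.sub hfm).integrable_sq).1
    (le_antisymm hzero (integral_nonneg fun _ => sq_nonneg _))
  filter_upwards [h0] with z hz
  exact sub_eq_zero.1 (pow_eq_zero_iff two_ne_zero |>.1 hz)

theorem closedSquare_subset_closure : closedSquare ⊆ closure openSquare := by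
  rw [openSquare, closure_prod_eq, closure_Ioo (by norm_num)]
  exact Subset.rfl

theorem eqOn_closedSquare_of_ae_eq {f g : ℝ × ℝ → ℝ} (hf : ContinuousOn f closedSquare)
    (hg : ContinuousOn g closedSquare) (h : f =ᵐ[volume.restrict openSquare] g) :
    EqOn f g closedSquare :=
  (Measure.eqOn_open_of_ae_eq h isOpen_openSquare (hf.mono openSquare_subset_closedSquare)
    (hg.mono openSquare_subset_closedSquare)).of_subset_closure hf hg
    openSquare_subset_closedSquare closedSquare_subset_closure

/-- The representative of a function in `H²` that is continuous on the closed square. -/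
noncomputable def contRep (u : Sobolev 2 openSquare) : ℝ × ℝ → ℝ :=
  (exists_continuous_representative u).choose

theorem continuousOn_contRep (u : Sobolev 2 openSquare) : ContinuousOn (contRep u) closedSquare :=
  (exists_continuous_representative u).choose_spec.1

theorem contRep_ae_eq (u : Sobolev 2 openSquare) :
    (u : Lp ℝ 2 (volume.restrict openSquare)) =ᵐ[volume.restrict openSquare] contRep u :=
  (exists_continuous_representative u).choose_spec.2.1

theorem sq_contRep_sub_le (u : Sobolev 2 openSquare) (q : MvPolynomial (Fin 2) ℝ) {z : ℝ × ℝ}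
    (hz : z ∈ closedSquare) : (contRep u z - polyValue q z) ^ 2 ≤ 8 * sobolevGap u q :=
  (exists_continuous_representative u).choose_spec.2.2 q z hz

/-- Uniqueness of the continuous representative is what makes point evaluation, defined by a choice,
linear. -/
theorem contRep_eq {u : Sobolev 2 openSquare} {f : ℝ × ℝ → ℝ} (hf : ContinuousOn f closedSquare)
    (h : (u : Lp ℝ 2 (volume.restrict openSquare)) =ᵐ[volume.restrict openSquare] f)
    {z : ℝ × ℝ} (hz : z ∈ closedSquare) : contRep u z = f z :=
  eqOn_closedSquare_of_ae_eq (continuousOn_contRep u) hf ((contRep_ae_eq u).symm.trans h) hz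

theorem contRep_polyToSobolev (q : MvPolynomial (Fin 2) ℝ) {z : ℝ × ℝ} (hz : z ∈ closedSquare) :
    contRep (polyToSobolev q) z = polyValue q z :=
  contRep_eq (continuous_polyValue q).continuousOn (polyToSobolev_ae_eq q) hz

theorem squareVertices_subset : squareVertices ⊆ closedSquare := by
  rintro z (rfl | rfl | rfl | rfl) <;> simp [closedSquare]

/-- The values at the vertices of the square. -/
noncomputable def vertexValues : Sobolev 2 openSquare →ₗ[ℝ] (squareVertices → ℝ) where
  toFun u V := contRep u V
  map_add' u w := by
    ext V
    exact contRep_eq (f := contRep u + contRep w)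
      ((continuousOn_contRep u).add (continuousOn_contRep w))
      ((Lp.coeFn_add _ _).trans ((contRep_ae_eq u).add (contRep_ae_eq w)))
      (squareVertices_subset V.2)
  map_smul' c u := by
    ext V
    exact contRep_eq (f := c • contRep u) ((continuousOn_contRep u).const_smul c)
      ((Lp.coeFn_smul _ _).trans ((contRep_ae_eq u).const_smul c)) (squareVertices_subset V.2)

theorem interpolatesAtVertices_of_eq {u w : Sobolev 2 openSquare}
    (h : vertexValues w = vertexValues u) : InterpolatesAtVertices u w :=
  ⟨contRep u, contRep w, continuousOn_contRep u, continuousOn_contRep w, contRep_ae_eq u,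
    contRep_ae_eq w, fun V hV => congrFun h ⟨V, hV⟩⟩

end SobolevSquare

/-! ### Minimal projections subject to linear constraints -/

/-- Minimizing `‖G (u - q)‖` over the `q ∈ W` with `ev q = ev u` can be done by a linear
projection onto `W` as soon as there is a linear `I` into `W` that preserves `ev`. -/
theorem exists_constrained_minimal_projection {X Y E : Type*} [AddCommGroup X] [Module ℝ X]
    [AddCommGroup Y] [Module ℝ Y] [NormedAddCommGroup E] [InnerProductSpace ℝ E]
    (G : X →ₗ[ℝ] E) (W : Submodule ℝ X) [FiniteDimensional ℝ W] (ev : X →ₗ[ℝ] Y)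
    (I : X →ₗ[ℝ] X) (hIW : ∀ u, I u ∈ W) (hI : ∀ u, ev (I u) = ev u) :
    ∃ Q : X →ₗ[ℝ] X, LinearMap.IsProj W Q ∧ (∀ u, ev (Q u) = ev u) ∧
      ∀ u, ∀ q ∈ W, ev q = ev u → ‖G (u - Q u)‖ ≤ ‖G (u - q)‖ := by
  -- The admissible `q` are exactly `I u + n` with `n ∈ N`, so the task is to approximate `G (u - I
  -- u)` from the subspace `M`.
  let N : Submodule ℝ X := W ⊓ LinearMap.ker ev
  let M : Submodule ℝ E := N.map G
  have : FiniteDimensional ℝ N := Submodule.finiteDimensional_inf_left _ _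
  have : FiniteDimensional ℝ M := inferInstance
  let GN : N →ₗ[ℝ] M := (G.domRestrict N).codRestrict M fun n => ⟨n, n.2, rfl⟩
  -- A linear section lifts the orthogonal projection from `M` back to `N`.
  obtain ⟨s, hs⟩ := GN.exists_rightInverse_of_surjective (by
    rw [LinearMap.range_eq_top]
    rintro ⟨_, n, hn, rfl⟩
    exact ⟨⟨n, hn⟩, rfl⟩)
  -- Where `G` fails to be injective on `N`, the minimiser is not unique and the section need not
  -- return the given element of `W`. The projection `ρ` onto this ambiguity restores it without
  -- changing `G` or `ev`.
  let Z : Submodule ℝ X := N ⊓ LinearMap.ker G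
  obtain ⟨ρ, hρ⟩ := Z.subtype.exists_leftInverse_of_injective Z.ker_subtype
  have hs' (m : M) : G (s m) = m := congrArg Subtype.val (LinearMap.congr_fun hs m)
  have hρ' (z : X) (hz : z ∈ Z) : (ρ z : X) = z :=
    congrArg Subtype.val (LinearMap.congr_fun hρ ⟨z, hz⟩)
  let A : X →ₗ[ℝ] X := N.subtype ∘ₗ s ∘ₗ M.orthogonalProjectionOnto.toLinearMap ∘ₗ G ∘ₗ
    (LinearMap.id - I)
  have hA (u : X) : G (A u) = M.starProjection (G (u - I u)) := hs' _
  have hAN (u : X) : A u ∈ N := Subtype.coe_prop _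
  let R : X →ₗ[ℝ] X := Z.subtype ∘ₗ ρ ∘ₗ (LinearMap.id - I - A)
  have hRZ (u : X) : R u ∈ Z := Subtype.coe_prop _
  refine ⟨I + A + R, ⟨fun u => ?_, fun q hq => ?_⟩, fun u => ?_, fun u q hq hqu => ?_⟩
  · exact W.add_mem (W.add_mem (hIW u) (hAN u).1) (hRZ u).1.1
  · have h1 : q - I q ∈ N := ⟨W.sub_mem hq (hIW q), by simp [hI]⟩
    have h2 : G (A q) = G (q - I q) := by
      rw [hA, Submodule.starProjection_eq_self_iff]
      exact ⟨_, h1, rfl⟩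
    have h3 : q - I q - A q ∈ Z := ⟨N.sub_mem h1 (hAN q), by
      rw [SetLike.mem_coe, LinearMap.mem_ker, map_sub, h2, sub_self]⟩
    have h4 : R q = q - I q - A q := hρ' _ h3
    rw [LinearMap.add_apply, LinearMap.add_apply, h4]
    abel
  · have h1 : ev (A u) = 0 := (hAN u).2
    have h2 : ev (R u) = 0 := (hRZ u).1.2
    simp [hI, h1, h2]
  · have h1 : G (R u) = 0 := (hRZ u).2
    have h2 : G (u - (I + A + R) u) = G (u - I u) - M.starProjection (G (u - I u)) := by
      rw [← hA, ← map_sub]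
      have : u - (I + A + R) u = (u - I u - A u) - R u := by
        simp only [LinearMap.add_apply]; abel
      rw [this, map_sub, h1, sub_zero]
    have h3 : q - I u ∈ N := ⟨W.sub_mem hq (hIW u), by simp [hI, hqu]⟩
    have h4 : G (u - q) = G (u - I u) - (⟨G (q - I u), ⟨_, h3, rfl⟩⟩ : M) := by
      rw [← map_sub]; congr 1; abel
    rw [h2, h4, Submodule.starProjection_minimal]
    exact ciInf_le ⟨0, by rintro _ ⟨y, rfl⟩; positivity⟩ _

/-! ### The bilinear interpolant at the vertices -/

section Interpolation

/-- The bilinear shape function of the vertex `(s,t)` of the square. -/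
noncomputable def vertexShape (s t : ℝ) : MvPolynomial (Fin 2) ℝ :=
  MvPolynomial.C (1 / 4) * (1 + MvPolynomial.C s * MvPolynomial.X 0) *
    (1 + MvPolynomial.C t * MvPolynomial.X 1)

/-- The bilinear polynomial with given values at the vertices. -/
noncomputable def bilinearInterp : (squareVertices → ℝ) →ₗ[ℝ] MvPolynomial (Fin 2) ℝ :=
  (LinearMap.proj ⟨(-1, -1), by simp [squareVertices]⟩).smulRight (vertexShape (-1) (-1)) +
  (LinearMap.proj ⟨(1, -1), by simp [squareVertices]⟩).smulRight (vertexShape 1 (-1)) +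
  (LinearMap.proj ⟨(1, 1), by simp [squareVertices]⟩).smulRight (vertexShape 1 1) +
  (LinearMap.proj ⟨(-1, 1), by simp [squareVertices]⟩).smulRight (vertexShape (-1) 1)

theorem totalDegree_vertexShape (s t : ℝ) : (vertexShape s t).totalDegree ≤ 2 := by
  have h (c : ℝ) (i : Fin 2) :
      (1 + MvPolynomial.C c * MvPolynomial.X i : MvPolynomial (Fin 2) ℝ).totalDegree ≤ 1 := by
    refine (MvPolynomial.totalDegree_add _ _).trans (max_le (by simp) ?_)
    refine (MvPolynomial.totalDegree_mul _ _).trans ?_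
    simp
  refine (MvPolynomial.totalDegree_mul _ _).trans ?_
  have h1 := h t 1
  have h2 := (MvPolynomial.totalDegree_mul (MvPolynomial.C (1 / 4 : ℝ))
    (1 + MvPolynomial.C s * MvPolynomial.X (0 : Fin 2)))
  have h3 := h s 0
  rw [MvPolynomial.totalDegree_C] at h2
  omega

theorem totalDegree_bilinearInterp (c : squareVertices → ℝ) :
    (bilinearInterp c).totalDegree ≤ 2 := by
  have h (r s t : ℝ) : (r • vertexShape s t).totalDegree ≤ 2 :=
    (MvPolynomial.totalDegree_smul_le _ _).trans (totalDegree_vertexShape s t)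
  refine (MvPolynomial.totalDegree_add _ _).trans (max_le ?_ (h _ _ _))
  refine (MvPolynomial.totalDegree_add _ _).trans (max_le ?_ (h _ _ _))
  exact (MvPolynomial.totalDegree_add _ _).trans (max_le (h _ _ _) (h _ _ _))

theorem polyValue_vertexShape (s t : ℝ) (z : ℝ × ℝ) :
    polyValue (vertexShape s t) z = 1 / 4 * (1 + s * z.1) * (1 + t * z.2) := by
  simp [polyValue, vertexShape]

theorem polyValue_bilinearInterp (c : squareVertices → ℝ) (V : squareVertices) :
    polyValue (bilinearInterp c) V = c V := by
  simp only [bilinearInterp, LinearMap.add_apply, LinearMap.smulRight_apply, polyValue_add,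
    polyValue_smul, Pi.add_apply, Pi.smul_apply, polyValue_vertexShape, smul_eq_mul,
    LinearMap.proj_apply]
  obtain ⟨V, hV⟩ := V
  have hV' := hV
  rcases hV with rfl | rfl | rfl | rfl <;> norm_num

theorem sqNorm_le_of_abs_le {q : MvPolynomial (Fin 2) ℝ} {M : ℝ}
    (h : ∀ z ∈ openSquare, |polyValue q z| ≤ M) : sqNorm q ≤ 4 * M ^ 2 := by
  have hv : (volume : Measure (ℝ × ℝ)).real openSquare = 4 := by
    rw [openSquare, Measure.volume_eq_prod, measureReal_prod_prod]
    norm_num [Real.volume_real_Ioo]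
  have h3 : sqNorm q ≤ ∫ _ in openSquare, M ^ 2 :=
    setIntegral_mono_on (integrableOn_polyValue_sq q) (integrable_const _)
      isOpen_openSquare.measurableSet fun z hz => sq_le_sq' (neg_le_of_abs_le (h z hz))
        (le_of_abs_le (h z hz))
  rwa [setIntegral_const, hv, smul_eq_mul] at h3

/-- The first derivatives of the four shape functions are at most `1/2` on the square, so each
partial derivative is at most `2 * δ`; the area 4 turns this into `16 * δ ^ 2`. -/
theorem sqNorm_deriv_bilinearInterp_le {c : squareVertices → ℝ} {δ : ℝ} (hc : ∀ V, |c V| ≤ δ) :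
    sqNorm (polyDeriv 1 0 (bilinearInterp c)) ≤ 16 * δ ^ 2 ∧
      sqNorm (polyDeriv 0 1 (bilinearInterp c)) ≤ 16 * δ ^ 2 := by
  have hδ : 0 ≤ δ := (abs_nonneg _).trans (hc ⟨(-1, -1), by simp [squareVertices]⟩)
  have e1 (s t : ℝ) : MvPolynomial.pderiv 0 (vertexShape s t) =
      MvPolynomial.C (1 / 4) * MvPolynomial.C s * (1 + MvPolynomial.C t * MvPolynomial.X 1) := by
    simp [vertexShape, MvPolynomial.pderiv_X]
    ring
  have e2 (s t : ℝ) : MvPolynomial.pderiv 1 (vertexShape s t) =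
      MvPolynomial.C (1 / 4) * MvPolynomial.C t * (1 + MvPolynomial.C s * MvPolynomial.X 0) := by
    simp [vertexShape, MvPolynomial.pderiv_X]
    ring
  have v1 (s t : ℝ) (z : ℝ × ℝ) : polyValue (MvPolynomial.pderiv 0 (vertexShape s t)) z =
      1 / 4 * s * (1 + t * z.2) := by simp [e1, polyValue]
  have v2 (s t : ℝ) (z : ℝ × ℝ) : polyValue (MvPolynomial.pderiv 1 (vertexShape s t)) z =
      1 / 4 * t * (1 + s * z.1) := by simp [e2, polyValue]
  have hb (c r : ℝ) (hc : |c| ≤ δ) (hr : |r| ≤ 1 / 2) : |c * r| ≤ δ * (1 / 2) := by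
    rw [abs_mul]; exact mul_le_mul hc hr (abs_nonneg _) hδ
  have h4 (a b c d : ℝ) (ha : |a| ≤ δ * (1 / 2)) (hb : |b| ≤ δ * (1 / 2))
      (hc : |c| ≤ δ * (1 / 2)) (hd : |d| ≤ δ * (1 / 2)) : |a + b + c + d| ≤ 2 * δ := by
    rw [abs_le] at *
    constructor <;> linarith [ha.1, ha.2, hb.1, hb.2, hc.1, hc.2, hd.1, hd.2]
  constructor
  · refine (sqNorm_le_of_abs_le (M := 2 * δ) fun z hz => ?_).trans_eq (by ring)
    obtain ⟨-, h1, h2⟩ := hz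
    simp only [polyDeriv, Function.iterate_zero, id, Function.iterate_one, bilinearInterp,
      LinearMap.add_apply, LinearMap.smulRight_apply, map_add, Derivation.map_smul, polyValue_add,
      polyValue_smul, Pi.add_apply, Pi.smul_apply, v1, smul_eq_mul, LinearMap.proj_apply]
    refine h4 _ _ _ _ (hb _ _ (hc _) ?_) (hb _ _ (hc _) ?_) (hb _ _ (hc _) ?_) (hb _ _ (hc _) ?_)
      <;> rw [abs_le] <;> constructor <;> linarith
  · refine (sqNorm_le_of_abs_le (M := 2 * δ) fun z hz => ?_).trans_eq (by ring)
    obtain ⟨⟨h1, h2⟩, -⟩ := hz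
    simp only [polyDeriv, Function.iterate_zero, id, Function.iterate_one, bilinearInterp,
      LinearMap.add_apply, LinearMap.smulRight_apply, map_add, Derivation.map_smul, polyValue_add,
      polyValue_smul, Pi.add_apply, Pi.smul_apply, v2, smul_eq_mul, LinearMap.proj_apply]
    refine h4 _ _ _ _ (hb _ _ (hc _) ?_) (hb _ _ (hc _) ?_) (hb _ _ (hc _) ?_) (hb _ _ (hc _) ?_)
      <;> rw [abs_le] <;> constructor <;> linarith

end Interpolation

/-! ### The projection operators -/

section Projection

open Filter Topology

/-- The gradient on `H²`. -/
noncomputable def sobolevGrad : Sobolev 2 openSquare →ₗ[ℝ]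
    WithLp 2 (Lp ℝ 2 (volume.restrict openSquare) × Lp ℝ 2 (volume.restrict openSquare)) :=
  (WithLp.linearEquiv 2 ℝ _).symm.toLinearMap ∘ₗ
    (sobolevDeriv 1 0 (by norm_num)).prod (sobolevDeriv 0 1 (by norm_num))

theorem norm_sq_eq_integral (f : Lp ℝ 2 (volume.restrict openSquare)) :
    ‖f‖ ^ 2 = ∫ z in openSquare, f z ^ 2 := by
  rw [← real_inner_self_eq_norm_sq, L2.inner_def]
  refine integral_congr_ae (.of_forall fun z => ?_)
  simp [sq]

theorem norm_sobolevGrad_sq (u : Sobolev 2 openSquare) {f g : ℝ × ℝ → ℝ}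
    (hf : weakDeriv 1 0 openSquare (u : Lp ℝ 2 (volume.restrict openSquare))
      =ᵐ[volume.restrict openSquare] f)
    (hg : weakDeriv 0 1 openSquare (u : Lp ℝ 2 (volume.restrict openSquare))
      =ᵐ[volume.restrict openSquare] g) :
    ‖sobolevGrad u‖ ^ 2 = (∫ z in openSquare, f z ^ 2) + ∫ z in openSquare, g z ^ 2 := by
  rw [WithLp.prod_norm_eq_of_L2, Real.sq_sqrt (by positivity)]
  have h (a b : ℕ) (hab : a + b ≤ 2) (f : ℝ × ℝ → ℝ)
      (hf : weakDeriv a b openSquare (u : Lp ℝ 2 (volume.restrict openSquare))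
        =ᵐ[volume.restrict openSquare] f) :
      ‖sobolevDeriv a b hab u‖ ^ 2 = ∫ z in openSquare, f z ^ 2 := by
    rw [norm_sq_eq_integral]
    refine integral_congr_ae ?_
    filter_upwards [(sobolevDeriv_ae_eq hab u).trans hf] with z hz
    rw [hz]
  exact congrArg₂ _ (h 1 0 _ f hf) (h 0 1 _ g hg)

theorem interior_closedSquare : interior closedSquare = openSquare := by
  rw [closedSquare, interior_prod_eq, interior_Icc, openSquare]

/-- The weak derivatives on the two sets are separate choices; by uniqueness they agree almost
everywhere on the smaller set, and the integral is monotone in the domain. -/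
theorem sobolevSeminorm_interior_le {K : Set (ℝ × ℝ)} (hK : K ⊆ closedSquare)
    (u : Sobolev 2 openSquare) :
    sobolevSeminorm 1 (interior K) (u : Lp ℝ 2 (volume.restrict openSquare)) ≤
      ‖sobolevGrad u‖ := by
  have hKQ : interior K ⊆ openSquare := by
    rw [← interior_closedSquare]; exact interior_mono hK
  have h (a b : ℕ) (hab : a + b ≤ 2) : ∫ z in interior K,
      weakDeriv a b (interior K) (u : Lp ℝ 2 (volume.restrict openSquare)) z ^ 2 ≤
      ∫ z in openSquare, weakDeriv a b openSquare
        (u : Lp ℝ 2 (volume.restrict openSquare)) z ^ 2 := by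
    have e := weakDeriv_ae_eq isOpen_interior ((Sobolev.hasWeakDeriv hab u.2).mono hKQ)
    rw [integral_congr_ae (e.mono fun z hz => congrArg (· ^ 2) hz)]
    exact setIntegral_mono_set (Sobolev.memLp_weakDeriv hab u.2).integrable_sq
      (.of_forall fun _ => sq_nonneg _) hKQ.eventuallyLE
  rw [sobolevSeminorm]
  refine Real.sqrt_le_iff.2 ⟨norm_nonneg _, ?_⟩
  rw [norm_sobolevGrad_sq u (.refl _ _) (.refl _ _)]
  simp only [Finset.sum_range_succ, Finset.sum_range_zero, zero_add, Nat.sub_self, Nat.sub_zero]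
  linarith [h 0 1 (by norm_num), h 1 0 (by norm_num)]

theorem norm_sobolevGrad_polyToSobolev (q : MvPolynomial (Fin 2) ℝ) :
    ‖sobolevGrad (polyToSobolev q)‖ ^ 2 =
      sqNorm (polyDeriv 1 0 q) + sqNorm (polyDeriv 0 1 q) :=
  norm_sobolevGrad_sq _ (weakDeriv_polyToSobolev 1 0 q) (weakDeriv_polyToSobolev 0 1 q)

theorem weakDeriv_sub_polyToSobolev {a b : ℕ} (hab : a + b ≤ 2) (u : Sobolev 2 openSquare)
    (q : MvPolynomial (Fin 2) ℝ) :
    weakDeriv a b openSquare ((u - polyToSobolev q : Sobolev 2 openSquare) :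
      Lp ℝ 2 (volume.restrict openSquare)) =ᵐ[volume.restrict openSquare]
    fun z => weakDeriv a b openSquare (u : Lp ℝ 2 (volume.restrict openSquare)) z -
      polyValue (polyDeriv a b q) z := by
  refine (sobolevDeriv_ae_eq hab _).symm.trans ?_
  rw [map_sub]
  refine (Lp.coeFn_sub _ _).trans ((sobolevDeriv_ae_eq hab u).sub ?_)
  exact (sobolevDeriv_ae_eq hab _).trans (weakDeriv_polyToSobolev a b q)

/-- The bilinear interpolant serves as the constraint-preserving map; it has total degree 2, hence
`2 ≤ p`. -/
theorem exists_vertex_preserving_projection {p : ℕ} (hp : 2 ≤ p) :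
    ∃ Q : Sobolev 2 openSquare →ₗ[ℝ] Sobolev 2 openSquare,
      LinearMap.IsProj (polySpace p) Q ∧ (∀ u, vertexValues (Q u) = vertexValues u) ∧
      ∀ u, ∀ q ∈ polySpace p, vertexValues q = vertexValues u →
        ‖sobolevGrad (u - Q u)‖ ≤ ‖sobolevGrad (u - q)‖ := by
  refine exists_constrained_minimal_projection sobolevGrad (polySpace p) vertexValues
    (polyToSobolev ∘ₗ bilinearInterp ∘ₗ vertexValues) (fun u => ?_) (fun u => ?_)
  · exact ⟨_, (totalDegree_bilinearInterp _).trans hp, polyToSobolev_ae_eq _⟩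
  · ext V
    exact (contRep_polyToSobolev _ (squareVertices_subset V.2)).trans
      (polyValue_bilinearInterp _ V)

/-- Rounding `p / 2` down costs at most `(1 + 1/(2n))^k ≤ exp (k/(2n))`, which stays below 3 because
`k ≤ n`. -/
theorem pow_two_mul_add_one_le {n k p : ℕ} (hk : k ≤ n) (hn : 1 ≤ n) (hp : p ≤ 2 * n + 1) :
    (p : ℝ) ^ k ≤ 3 * (2 ^ k * (n : ℝ) ^ k) := by
  have hn0 : (0 : ℝ) < n := by exact_mod_cast hn
  have h1 : (p : ℝ) ≤ 2 * n * (1 + 1 / (2 * n)) := by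
    have : (p : ℝ) ≤ 2 * n + 1 := by exact_mod_cast hp
    field_simp
    linarith
  have h2 : (1 + 1 / (2 * n) : ℝ) ^ k ≤ 3 := by
    have h3 : (1 + 1 / (2 * n) : ℝ) ≤ Real.exp (1 / (2 * n)) := by
      linarith [Real.add_one_le_exp (1 / (2 * n) : ℝ)]
    calc (1 + 1 / (2 * n) : ℝ) ^ k ≤ Real.exp (1 / (2 * n)) ^ k := by gcongr
      _ = Real.exp (k * (1 / (2 * n))) := (Real.exp_nat_mul _ _).symm
      _ ≤ Real.exp 1 := by
          refine Real.exp_le_exp.2 ?_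
          have : (k : ℝ) ≤ n := by exact_mod_cast hk
          rw [mul_one_div, div_le_one (by positivity)]
          linarith
      _ ≤ 3 := by linarith [Real.exp_one_lt_d9]
  calc (p : ℝ) ^ k ≤ (2 * n * (1 + 1 / (2 * n))) ^ k := by gcongr
    _ = 2 ^ k * (n : ℝ) ^ k * (1 + 1 / (2 * n)) ^ k := by rw [mul_pow, mul_pow]
    _ ≤ 2 ^ k * (n : ℝ) ^ k * 3 := by gcongr
    _ = _ := by ring

/-- The approximation error of every constrained minimizer. -/
theorem norm_sobolevGrad_le_of_minimal {n k p : ℕ} (hk : 1 ≤ k) (hkn : k ≤ n) (hp : 2 * n ≤ p)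
    {u : Sobolev 2 openSquare}
    (hu : (u : Lp ℝ 2 (volume.restrict openSquare)) ∈ Sobolev (k + 1) openSquare) {B : ℝ}
    (hB : ∀ q ∈ polySpace p, vertexValues q = vertexValues u → B ≤ ‖sobolevGrad (u - q)‖) :
    (n : ℝ) ^ k * B ≤ 4 * Real.exp 1 ^ k *
      sobolevSeminorm (k + 1) openSquare (u : Lp ℝ 2 (volume.restrict openSquare)) := by
  set T := ∑ a ∈ Finset.range (k + 2), ∫ z in openSquare,
    weakDeriv a (k + 1 - a) openSquare (u : Lp ℝ 2 (volume.restrict openSquare)) z ^ 2 with hT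
  have hT0 : 0 ≤ T := Finset.sum_nonneg fun _ _ => integral_nonneg fun _ => sq_nonneg _
  have key : ∀ ε : ℝ, 0 < ε → (n : ℝ) ^ k * B ≤ (n : ℝ) ^ k * √(2 * ε) +
      √(8 * Real.exp 1 ^ (2 * k) * (2 * T + 2 * ((k + 2 : ℕ) * ε))) +
        (n : ℝ) ^ k * √(1024 * ε) := by
    intro ε hε
    obtain ⟨r, hr⟩ := exists_poly_close_of_mem_Sobolev hu hε
    obtain ⟨q, hqd, hqv, hqe⟩ := exists_interpolating_poly hk hkn r
    have hgap : sobolevGap u r < 4 * ε := sobolevGap_lt fun a b hab => hr a b (by omega)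
    -- The competitor built from the approximant `r` has the vertex values of `r`, not of `u`. The
    -- bilinear polynomial with values `c` corrects this, and `8 * 4 * ε` bounds the square of the
    -- mismatch.
    let c : squareVertices → ℝ := fun V => vertexValues u V - polyValue r (V : ℝ × ℝ)
    have hc (V : squareVertices) : |c V| ≤ √(32 * ε) := by
      refine Real.abs_le_sqrt ?_
      have := sq_contRep_sub_le u r (squareVertices_subset V.2)
      change (contRep u V - polyValue r V) ^ 2 ≤ _
      linarith
    obtain ⟨hc1, hc2⟩ := sqNorm_deriv_bilinearInterp_le hc
    rw [Real.sq_sqrt (by positivity)] at hc1 hc2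
    have hB' := hB (polyToSobolev (q + bilinearInterp c))
      ⟨_, (MvPolynomial.totalDegree_add _ _).trans (max_le (hqd.trans hp)
        ((totalDegree_bilinearInterp c).trans (by omega))), polyToSobolev_ae_eq _⟩ (by
        ext V
        refine (contRep_polyToSobolev _ (squareVertices_subset V.2)).trans ?_
        rw [polyValue_add, Pi.add_apply, polyValue_bilinearInterp, hqv V V.2]
        change _ + (vertexValues u V - polyValue r V) = _
        ring)
    have hsplit : u - polyToSobolev (q + bilinearInterp c) =
        (u - polyToSobolev r) + polyToSobolev (r - q) - polyToSobolev (bilinearInterp c) := by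
      rw [map_add, map_sub]; abel
    -- Three errors: density, tensor projection of `r`, and vertex correction. The last has squared
    -- gradient norm at most `2 * 16 * 32 * ε = 1024 * ε`.
    have n1 : ‖sobolevGrad (u - polyToSobolev r)‖ ≤ √(2 * ε) := by
      refine Real.le_sqrt_of_sq_le ?_
      rw [norm_sobolevGrad_sq _ (weakDeriv_sub_polyToSobolev (by norm_num) u r)
        (weakDeriv_sub_polyToSobolev (by norm_num) u r)]
      linarith [hr 1 0 (by omega), hr 0 1 (by omega)]
    have n3 : ‖sobolevGrad (polyToSobolev (bilinearInterp c))‖ ≤ √(1024 * ε) := by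
      refine Real.le_sqrt_of_sq_le ?_
      rw [norm_sobolevGrad_polyToSobolev]
      linarith
    have hsum : ∑ a ∈ Finset.range (k + 2), sqNorm (polyDeriv a (k + 1 - a) r) ≤
        2 * T + 2 * ((k + 2 : ℕ) * ε) := by
      -- The top-order derivatives of `r` are those of `u` up to `ε`; the factor 2 enters the final
      -- constant through `8 * 2 = 4 ^ 2`.
      have h1 (a : ℕ) (ha : a ∈ Finset.range (k + 2)) : sqNorm (polyDeriv a (k + 1 - a) r) ≤
          2 * (∫ z in openSquare, weakDeriv a (k + 1 - a) openSquare
            (u : Lp ℝ 2 (volume.restrict openSquare)) z ^ 2) + 2 * ε := by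
        rw [Finset.mem_range] at ha
        have hm := Sobolev.memLp_weakDeriv (a := a) (b := k + 1 - a) (by omega) hu
        have h2 := integral_sq_add_le hm
          ((continuous_polyValue (polyDeriv a (k + 1 - a) r)).memLp_openSquare.sub hm)
        have h3 := hr a (k + 1 - a) (by omega)
        have h4 : ∫ z in openSquare, ((polyValue (polyDeriv a (k + 1 - a) r) - weakDeriv a
            (k + 1 - a) openSquare (u : Lp ℝ 2 (volume.restrict openSquare))) z) ^ 2 < ε := by
          refine lt_of_eq_of_lt (integral_congr_ae (.of_forall fun z => ?_)) h3
          simp only [Pi.sub_apply]; ring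
        have h5 : sqNorm (polyDeriv a (k + 1 - a) r) = ∫ z in openSquare, (weakDeriv a
            (k + 1 - a) openSquare (u : Lp ℝ 2 (volume.restrict openSquare)) z +
            (polyValue (polyDeriv a (k + 1 - a) r) - weakDeriv a
            (k + 1 - a) openSquare (u : Lp ℝ 2 (volume.restrict openSquare))) z) ^ 2 := by
          refine integral_congr_ae (.of_forall fun z => ?_)
          simp
        rw [h5]
        linarith
      refine (Finset.sum_le_sum h1).trans_eq ?_
      rw [Finset.sum_add_distrib, ← Finset.mul_sum, Finset.sum_const, Finset.card_range, hT,
        nsmul_eq_mul]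
      ring
    have n2 : (n : ℝ) ^ k * ‖sobolevGrad (polyToSobolev (r - q))‖ ≤
        √(8 * Real.exp 1 ^ (2 * k) * (2 * T + 2 * ((k + 2 : ℕ) * ε))) := by
      refine Real.le_sqrt_of_sq_le ?_
      rw [mul_pow, norm_sobolevGrad_polyToSobolev, ← pow_mul, mul_comm k 2]
      exact hqe.trans (by gcongr)
    have htri : ‖sobolevGrad (u - polyToSobolev (q + bilinearInterp c))‖ ≤
        ‖sobolevGrad (u - polyToSobolev r)‖ + ‖sobolevGrad (polyToSobolev (r - q))‖ +
          ‖sobolevGrad (polyToSobolev (bilinearInterp c))‖ := by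
      rw [hsplit, map_sub, map_add]
      exact (norm_sub_le _ _).trans (by gcongr; exact norm_add_le _ _)
    have hn : (0 : ℝ) ≤ (n : ℝ) ^ k := by positivity
    calc (n : ℝ) ^ k * B ≤ (n : ℝ) ^ k * (‖sobolevGrad (u - polyToSobolev r)‖ +
          ‖sobolevGrad (polyToSobolev (r - q))‖ +
          ‖sobolevGrad (polyToSobolev (bilinearInterp c))‖) := by
          gcongr; exact hB'.trans htri
      _ = (n : ℝ) ^ k * ‖sobolevGrad (u - polyToSobolev r)‖ +
          (n : ℝ) ^ k * ‖sobolevGrad (polyToSobolev (r - q))‖ +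
          (n : ℝ) ^ k * ‖sobolevGrad (polyToSobolev (bilinearInterp c))‖ := by ring
      _ ≤ _ := by gcongr
  have hcont : Continuous fun ε : ℝ => (n : ℝ) ^ k * √(2 * ε) +
      √(8 * Real.exp 1 ^ (2 * k) * (2 * T + 2 * ((k + 2 : ℕ) * ε))) +
        (n : ℝ) ^ k * √(1024 * ε) := by fun_prop
  -- The right-hand side is continuous at `ε = 0`, so the bound holds there although `key` needs `ε`
  -- positive.
  have hlim := (hcont.tendsto 0).mono_left (nhdsWithin_le_nhds (s := Ioi 0))
  have hle := ge_of_tendsto hlim (eventually_mem_nhdsWithin.mono fun ε hε => key ε hε)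
  refine hle.trans_eq ?_
  have e1 : 8 * Real.exp 1 ^ (2 * k) * (2 * T + 2 * ((k + 2 : ℕ) * 0)) =
      (4 * Real.exp 1 ^ k) ^ 2 * T := by ring
  have e2 : √((4 * Real.exp 1 ^ k) ^ 2 * T) = 4 * Real.exp 1 ^ k * √T := by
    rw [Real.sqrt_mul (by positivity), Real.sqrt_sq (by positivity)]
  rw [e1, e2]
  simp only [mul_zero, Real.sqrt_zero, zero_add, add_zero]
  rfl

end Projection

/-! ### The main theorem -/

theorem mainTheorem6 :
    ∃ (C : ℝ) (proj : ℕ → (Sobolev 2 openSquare →ₗ[ℝ] Sobolev 2 openSquare)),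
      0 < C ∧
      (∀ p : ℕ, 1 ≤ p → LinearMap.IsProj (polySpace p) (proj p)) ∧
      (∀ p : ℕ, 2 ≤ p → ∀ u : Sobolev 2 openSquare, InterpolatesAtVertices u (proj p u)) ∧
      ∀ K : Set (ℝ × ℝ), IsPolygonalRegion K → K ⊆ closedSquare → barycenter K = 0 →
        ∀ k p : ℕ, 1 ≤ k → 2 * k ≤ p → ∀ u : Sobolev 2 openSquare,
          (u : Lp ℝ 2 (MeasureTheory.volume.restrict openSquare)) ∈ Sobolev (k + 1) openSquare →
          sobolevSeminorm 1 (interior K)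
              ((u - proj p u : Sobolev 2 openSquare) :
                Lp ℝ 2 (MeasureTheory.volume.restrict openSquare)) ≤
            C * 2 ^ k * Real.exp 1 ^ k * ((p : ℝ) ^ k)⁻¹ *
              sobolevSeminorm (k + 1) openSquare
                (u : Lp ℝ 2 (MeasureTheory.volume.restrict openSquare)) := by
  have hex (p : ℕ) : ∃ Q : Sobolev 2 openSquare →ₗ[ℝ] Sobolev 2 openSquare,
      LinearMap.IsProj (polySpace p) Q ∧ (2 ≤ p → (∀ u, vertexValues (Q u) = vertexValues u) ∧
      ∀ u, ∀ q ∈ polySpace p, vertexValues q = vertexValues u →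
        ‖sobolevGrad (u - Q u)‖ ≤ ‖sobolevGrad (u - q)‖) := by
    -- For `p < 2` any linear projection onto the finite-dimensional space will do: neither
    -- interpolation nor an error bound is asked there.
    by_cases hp : 2 ≤ p
    · obtain ⟨Q, h1, h2⟩ := exists_vertex_preserving_projection hp
      exact ⟨Q, h1, fun _ => h2⟩
    · obtain ⟨ρ, hρ⟩ := (polySpace p).subtype.exists_leftInverse_of_injective
        (polySpace p).ker_subtype
      exact ⟨(polySpace p).subtype ∘ₗ ρ, ⟨fun u => Subtype.coe_prop _, fun q hq =>
        congrArg Subtype.val (LinearMap.congr_fun hρ ⟨q, hq⟩)⟩, fun h => absurd h hp⟩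
  choose proj hproj hproj2 using hex
  refine ⟨12, proj, by norm_num, fun p _ => hproj p, fun p hp u =>
    interpolatesAtVertices_of_eq ((hproj2 p hp).1 u), ?_⟩
  intro K _ hK _ k p hk hkp u hu
  refine (sobolevSeminorm_interior_le hK _).trans ?_
  -- With `n = p / 2`, the condition `2 * k ≤ p` becomes `k ≤ n`, and `2 * n ≤ p ≤ 2 * n + 1`. The
  -- constant 12 is the 4 of this bound times the 3 of the next.
  have h1 := norm_sobolevGrad_le_of_minimal (n := p / 2) (p := p) hk (by omega) (by omega) hu
    ((hproj2 p (by omega)).2 u)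
  have h2 := pow_two_mul_add_one_le (n := p / 2) (k := k) (p := p) (by omega) (by omega) (by omega)
  have hp0 : (0 : ℝ) < (p : ℝ) ^ k := by
    have : (0 : ℝ) < p := by exact_mod_cast (by omega : 0 < p)
    positivity
  set S := sobolevSeminorm (k + 1) openSquare (u : Lp ℝ 2 (volume.restrict openSquare))
  set B := ‖sobolevGrad (u - proj p u)‖
  have hB : 0 ≤ B := norm_nonneg _
  have h3 : (p : ℝ) ^ k * B ≤ 12 * 2 ^ k * Real.exp 1 ^ k * S := by
    calc (p : ℝ) ^ k * B ≤ 3 * (2 ^ k * ((p / 2 : ℕ) : ℝ) ^ k) * B := by gcongr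
      _ = 3 * 2 ^ k * (((p / 2 : ℕ) : ℝ) ^ k * B) := by ring
      _ ≤ 3 * 2 ^ k * (4 * Real.exp 1 ^ k * S) := by gcongr
      _ = _ := by ring
  calc B = ((p : ℝ) ^ k)⁻¹ * ((p : ℝ) ^ k * B) := by field_simp
    _ ≤ ((p : ℝ) ^ k)⁻¹ * (12 * 2 ^ k * Real.exp 1 ^ k * S) := by gcongr
    _ = _ := by ring
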